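/- Let $A$ be an abelian group (written multiplicatively) and $R$ a commutative ring with unity. **Fibered bisets.** For a finite group $Q$ let $\mathcal M(Q)$ be the set of pairs $(D,\varphi)$ with $D\le Q$ and $\varphi\in\mathrm{Hom}(D,A)$, ordered by $(L,\lambda)\le(K,\kappa)$ iff $L\le K$ and $\lambda=\kappa|_L$, with $Q$ acting by conjugation. An $A$-fibered $Q$-set is a $(Q\times A)$-set $X$ that is free over $A$ and has finitely many $A$-orbits; for $x\in X$ let $Q_x$ be the stabilizer of the $A$-orbit of $x$ and $\varphi_x\in\mathrm{Hom}(Q_x,A)$ be given by $qx=\varphi_x(q)x$. An $A$-fibered $(G,H)$-biset is an $A$-fibered $(G\times H)$-set, written with $guh=(g,h^{-1})u$; its stabilizing pairs are the $((G\times H)_u,\varphi_u)$. Put $U\otimes_{AH}V$ = the set of those orbits of $(h,a)(u,v)=(u(ha)^{-1},hav)$ on $U\times V$ that are $A$-free. $B^A(G,H)$ is the Grothendieck group of $A$-fibered $(G,H)$-bisets under disjoint union, and $B^A_R(G,H)=R\otimes_{\mathbb Z}B^A(G,H)$, with composition induced by $\otimes_{AH}$. For $(D,\varphi)\in\mathcal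 M(G\times H)$ let $\left[\frac{G\times H}{D,\varphi}\right]$ be the class of the transitive biset $(G\times H\times A)/\{(d,\varphi(d)^{-1}) : d\in D\}$. Let $p_1,p_2$ be the projections, $k_1(D)=\{g:(g,1)\in D\}$, $k_2(D)=\{h:(1,h)\in D\}$, $\varphi_1(g)=\varphi(g,1)$, $\varphi_2(h)=\varphi(1,h)^{-1}$. Let $D*E=\{(g,k):\exists h,\ (g,h)\in D,\ (h,k)\in E\}$, $D*K=\{g:\exists k\in K,\ (g,k)\in D\}$, $K*D=\{h:\exists k\in K,\ (k,h)\in D\}$, and, when $\varphi_2=\psi_1$ on $k_2(D)\cap k_1(E)$, $(D,\varphi)*(E,\psi)=(D*E,\varphi*\psi)$ with $(\varphi*\psi)(g,k)=\varphi(g,h)\psi(h,k)$. Let $\Delta(K)=\{(k,k):k\in K\}$. **The data.** Let $\mathcal G$ be a class of finite groups and, for $G,H\in\mathcal G$, let $\mathcal S(G,H)\subseteq\mathcal M(G\times H)$ be such that for all $G,H,K\in\mathcal G$: (i) $(\Delta(G),1)\in\mathcal S(G,G)$; (ii) $\mathcal S(G,H)$ is closed under $(G\times H)$-conjugation; (iii)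 if $P\in\mathcal S(G,H)$, $P'\in\mathcal S(H,K)$ and $P*P'$ is defined, then $P*P'\in\mathcal S(G,K)$; (iv) if $(D,\varphi)\in\mathcal S(G,H)$ and $L\le H$, $L\in\mathcal G$, then $D*L\in\mathcal G$ and $(D,\varphi)*(\Delta(L),1)\in\mathcal S(D*L,L)$; (vi) if $L\le G$, $L\in\mathcal G$, then $(\Delta(L),1)\in\mathcal S(L,G)$; (vii) if $(D,\varphi)\in\mathcal S(G,H)$, then $p_2(D)\in\mathcal G$, and for all $L\le p_2(D)$ with $L\in\mathcal G$ one has $D*L\in\mathcal G$ and $(D,\varphi)*(\Delta(L),1)\in\mathcal S(D*L,L)$; (viii) if $(D,\varphi)\in\mathcal S(G,H)$, then $p_1(D)\in\mathcal G$, and for all $L\le p_1(D)$ with $L\in\mathcal G$ one has $L*D\in\mathcal G$ and $(\Delta(L),1)*(D,\varphi)\in\mathcal S(L,L*D)$; (condition $k_2$) $k_2(D)=1$ for all $(D,\varphi)\in\mathcal S(G,H)$. Let $\mathcal D=\mathcal C^A(\mathcal G,\mathcal S)$ be the category with objects $\mathcal G$ whose morphisms $H\to G$ form the $R$-span in $B^A_R(G,H)$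 of the $\left[\frac{G\times H}{D,\varphi}\right]$ with $(D,\varphi)\in\mathcal S(G,H)$. Define $\mathcal S_+(G,H)=\{(D,\varphi)\in\mathcal M(G\times H): p_1(D)\in\mathcal G,\ (D,\varphi)\in\mathcal S(p_1(D),H)\}$ and $\mathcal S^+(G,H)=\{(D,\varphi)\in\mathcal M(G\times H): p_1(D),p_2(D)\in\mathcal G,\ (D,\varphi)\in\mathcal S(p_1(D),p_2(D))\}$, and let $\mathcal D_+$, $\mathcal D^+$ be the corresponding categories. Let $F$ be an $R$-linear functor from $\mathcal D$ to $R$-modules. For $K\le G$ in $\mathcal G$ put $\mathrm{Res}^G_K=\left[\frac{K\times G}{\Delta(K),1}\right]$, and for $g\in G$ write ${}^g:F(K)\to F({}^gK)$ for the map induced by the conjugation isomorphism. **$F_+$.** For $G\in\mathcal G$ consider pairs $(X,s)$ where $X$ is an $A$-fibered $G$-set with all $G_x\in\mathcal G$, and $s$ assigns to each $x\in X$ an element $s(x)\in F(G_x)$ such that ${}^gs(x)=s(gax)$ for all $g\in G$, $a\in A$. $F_+(G)$ is the free abelian group on the isomorphism classes $\{X,s\}$ of such pairs modulo the relations $\{X\sqcup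 Y,s\sqcup t\}=\{X,s\}+\{Y,t\}$ and $\{X,s+r\}=\{X,s\}+\{X,r\}$; the class of $(X,s)$ is $[X,s]$, and $r[X,s]=[X,rs]$ for $r\in R$. For an $A$-fibered $(G,H)$-biset $U$ with all stabilizing pairs in $\mathcal S_+(G,H)$ put $F_+([U])[X,s]=[U\otimes_{AH}X,U(s)]$, where $U(s)(u\otimes x)=F\left(\left[\frac{G_{u\otimes x}\times H_x}{((G\times H)_u,\varphi_u)*(\Delta(H_x),1)}\right]\right)(s(x))$. **$F^+$.** Let $\mathcal M'(G)=\{(K,\kappa)\in\mathcal M(G):K\in\mathcal G\}$, and let $F^+(G)$ be the submodule of those $(x_{(K,\kappa)})\in\bigoplus_{(K,\kappa)\in\mathcal M'(G)}F(K)$ with ${}^gx_{(K,\kappa)}=x_{{}^g(K,\kappa)}$ for all $g\in G$. For an $A$-fibered $(G,H)$-biset $U$ with all stabilizing pairs in $\mathcal S^+(G,H)$ put $F^+([U])\big((x_{(L,\lambda)})\big)=(y_{(K,\alpha)})$ with $$y_{(K,\alpha)}=\sum_{u,\lambda}F\left(\left[\frac{K\times K^u}{(\Delta(K),1)*((G\times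 H)_u,\varphi_u)}\right]\right)\big(x_{(K^u,\lambda)}\big),\qquad K^u=K*(G\times H)_u,$$ where $u$ runs over representatives of the $(A,H)$-orbits of $U$ with $K\le p_1((G\times H)_u)$, and $\lambda$ over the elements of $\mathrm{Hom}(K^u,A)$ with $(\varphi_u)_2=\lambda$ on $k_2((G\times H)_u)\cap K^u$ and $\varphi_u(k,h)\lambda(h)=\alpha(k)$ for all $(k,h)\in(G\times H)_u$ with $k\in K$. **Theorem.** Under these assumptions: 1. $\mathcal S_+=\mathcal S^+$ and $\mathcal D_+=\mathcal D^+=:\mathcal E$. 2. The formulas above give well-defined $R$-linear functors $F_+:\mathcal D_+\to R\text{-Mod}$ and $F^+:\mathcal D^+\to R\text{-Mod}$ (each is the unique $R$-linear functor with the given modules and the given values on the classes $[U]$). For every $G\in\mathcal G$ there is a unique $R$-linear map $m_{F,G}:F_+(G)\to F^+(G)$ that sends each $[X,s]$ to $(a_{(L,\lambda)})_{(L,\lambda)\in\mathcal M'(G)}$ with $$a_{(L,\lambda)}=\sum_{x\in[X/A],\ (L,\lambda)\le(G_x,\varphi_x)}F(\mathrm{Res}^{G_x}_L)(s(x)),$$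 where $[X/A]$ is any set of representatives of the $A$-orbits of $X$. 3. For all $G,H\in\mathcal G$ and every $A$-fibered $(G,H)$-biset $U$ all of whose stabilizing pairs lie in $\mathcal S_+(G,H)=\mathcal S^+(G,H)$ one has $m_{F,G}\circ F_+([U])=F^+([U])\circ m_{F,H}$. 4. The maps $m_{F,G}$, $G\in\mathcal G$, form a natural transformation $m_F:F_+\to F^+$ of functors on $\mathcal E$. -/

import Mathlib

open scoped TensorProduct DirectSum

universe u v w

namespace Fibered

noncomputable section

/-! ### Pairs `(D, φ)` with `D ≤ Q` and `φ ∈ Hom(D, A)` -/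

/-- An element of `ℳ(Q)`: a subgroup `dom` of `Q` with a homomorphism `char : dom → A`. -/
structure FPair (A Q : Type u) [CommGroup A] [Group Q] where
  dom : Subgroup Q
  char : dom →* A

namespace FPair

variable {A Q Q₁ Q₂ Q₃ : Type u} [CommGroup A] [Group Q] [Group Q₁] [Group Q₂] [Group Q₃]

/-- `(L, φ) ≤ (K, κ)` when `L ≤ K` and `φ = κ|_L`. -/
instance : LE (FPair A Q) :=
  ⟨fun P P₂ => ∃ h : P.dom ≤ P₂.dom, ∀ x : P.dom, P.char x = P₂.char (Subgroup.inclusion h x)⟩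

/-- Transport of a pair along an injective homomorphism. -/
def push (f : Q₁ →* Q₂) (hf : Function.Injective f) (P : FPair A Q₁) : FPair A Q₂ where
  dom := P.dom.map f
  char := P.char.comp (P.dom.equivMapOfInjective f hf).symm.toMonoidHom

/-- Preimage of a pair under a homomorphism. -/
def pull (f : Q₁ →* Q₂) (P : FPair A Q₂) : FPair A Q₁ where
  dom := P.dom.comap f
  char := P.char.comp (f.subgroupComap P.dom)

/-- The conjugate `^g(D, φ)`, with `^gφ(g d g⁻¹) = φ(d)`. -/
def conj (g : Q) (P : FPair A Q) : FPair A Q :=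
  P.push (MulAut.conj g).toMonoidHom (MulAut.conj g).injective

end FPair

section Subgroups

variable {Q₁ Q₂ Q₃ : Type u} [Group Q₁] [Group Q₂] [Group Q₃]

/-- First projection `p₁(D)`. -/
def p1 (D : Subgroup (Q₁ × Q₂)) : Subgroup Q₁ := D.map (MonoidHom.fst Q₁ Q₂)

/-- Second projection `p₂(D)`. -/
def p2 (D : Subgroup (Q₁ × Q₂)) : Subgroup Q₂ := D.map (MonoidHom.snd Q₁ Q₂)

/-- `k₂(D) = {h | (1, h) ∈ D}`. -/
def k2 (D : Subgroup (Q₁ × Q₂)) : Subgroup Q₂ := D.comap (MonoidHom.inr Q₁ Q₂)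

/-- `D ∗ E = {(g, k) | ∃ h, (g, h) ∈ D ∧ (h, k) ∈ E}`. -/
def starSub (D : Subgroup (Q₁ × Q₂)) (E : Subgroup (Q₂ × Q₃)) : Subgroup (Q₁ × Q₃) where
  carrier := {x | ∃ h, (x.1, h) ∈ D ∧ (h, x.2) ∈ E}
  one_mem' := ⟨1, D.one_mem, E.one_mem⟩
  mul_mem' := by
    rintro x y ⟨h, hx, hx'⟩ ⟨k, hy, hy'⟩
    exact ⟨h * k, D.mul_mem hx hy, E.mul_mem hx' hy'⟩
  inv_mem' := by
    rintro x ⟨h, hx, hx'⟩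
    exact ⟨h⁻¹, D.inv_mem hx, E.inv_mem hx'⟩

/-- `D ∗ K = {g | ∃ k ∈ K, (g, k) ∈ D}`. -/
def starRight (D : Subgroup (Q₁ × Q₂)) (K : Subgroup Q₂) : Subgroup Q₁ where
  carrier := {g | ∃ k ∈ K, (g, k) ∈ D}
  one_mem' := ⟨1, K.one_mem, D.one_mem⟩
  mul_mem' := by
    rintro x y ⟨h, hx, hx'⟩ ⟨k, hy, hy'⟩
    exact ⟨h * k, K.mul_mem hx hy, D.mul_mem hx' hy'⟩
  inv_mem' := by
    rintro x ⟨h, hx, hx'⟩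
    exact ⟨h⁻¹, K.inv_mem hx, D.inv_mem hx'⟩

/-- `K ∗ D = {h | ∃ k ∈ K, (k, h) ∈ D}`. -/
def starLeft (K : Subgroup Q₁) (D : Subgroup (Q₁ × Q₂)) : Subgroup Q₂ where
  carrier := {h | ∃ k ∈ K, (k, h) ∈ D}
  one_mem' := ⟨1, K.one_mem, D.one_mem⟩
  mul_mem' := by
    rintro x y ⟨h, hx, hx'⟩ ⟨k, hy, hy'⟩
    exact ⟨h * k, K.mul_mem hx hy, D.mul_mem hx' hy'⟩
  inv_mem' := by
    rintro x ⟨h, hx, hx'⟩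
    exact ⟨h⁻¹, K.inv_mem hx, D.inv_mem hx'⟩

end Subgroups

namespace FPair

variable {A Q Q₁ Q₂ Q₃ : Type u} [CommGroup A] [Group Q] [Group Q₁] [Group Q₂] [Group Q₃]

/-- The compatibility `φ₂ = ψ₁` on `k₂(U) ∩ k₁(V)`, where `φ₂(h) = φ(1, h)⁻¹` and
`ψ₁(h) = ψ(h, 1)`. -/
def Compat (P : FPair A (Q₁ × Q₂)) (P₂ : FPair A (Q₂ × Q₃)) : Prop :=
  ∀ (h : Q₂) (hU : ((1, h) : Q₁ × Q₂) ∈ P.dom) (hV : ((h, 1) : Q₂ × Q₃) ∈ P₂.dom),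
    (P.char ⟨(1, h), hU⟩)⁻¹ = P₂.char ⟨(h, 1), hV⟩

theorem Compat.indep {P : FPair A (Q₁ × Q₂)} {P₂ : FPair A (Q₂ × Q₃)} (hc : P.Compat P₂)
    {g : Q₁} {k : Q₃} {h h₂ : Q₂} (a : (g, h) ∈ P.dom) (b : (h, k) ∈ P₂.dom)
    (a₂ : (g, h₂) ∈ P.dom) (b₂ : (h₂, k) ∈ P₂.dom) :
    P.char ⟨(g, h), a⟩ * P₂.char ⟨(h, k), b⟩ = P.char ⟨(g, h₂), a₂⟩ * P₂.char ⟨(h₂, k), b₂⟩ := by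
  have hU : ((1, h⁻¹ * h₂) : Q₁ × Q₂) ∈ P.dom := by
    have := P.dom.mul_mem (P.dom.inv_mem a) a₂
    simpa using this
  have hV : ((h⁻¹ * h₂, 1) : Q₂ × Q₃) ∈ P₂.dom := by
    have := P₂.dom.mul_mem (P₂.dom.inv_mem b) b₂
    simpa using this
  have e := hc _ hU hV
  have e1 : P.char ⟨(g, h₂), a₂⟩ = P.char ⟨(g, h), a⟩ * P.char ⟨(1, h⁻¹ * h₂), hU⟩ := by
    rw [← map_mul]; congr 1; ext <;> simp
  have e2 : P₂.char ⟨(h₂, k), b₂⟩ = P₂.char ⟨(h, k), b⟩ * P₂.char ⟨(h⁻¹ * h₂, 1), hV⟩ := by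
    rw [← map_mul]; congr 1; ext <;> simp
  rw [e1, e2, ← e, mul_mul_mul_comm, mul_inv_cancel, mul_one]

theorem exists_mid {D : Subgroup (Q₁ × Q₂)} {E : Subgroup (Q₂ × Q₃)} (x : starSub D E) :
    ∃ h, (x.1.1, h) ∈ D ∧ (h, x.1.2) ∈ E := x.2

/-- `(U, φ) ∗ (V, ψ) = (U ∗ V, φ ∗ ψ)` with `(φ ∗ ψ)(g, k) = φ(g, h) ψ(h, k)` for any `h` with
`(g, h) ∈ U` and `(h, k) ∈ V`. -/
def star (P : FPair A (Q₁ × Q₂)) (P₂ : FPair A (Q₂ × Q₃)) (hc : P.Compat P₂) :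
    FPair A (Q₁ × Q₃) where
  dom := starSub P.dom P₂.dom
  char :=
    { toFun := fun x => P.char ⟨_, (exists_mid x).choose_spec.1⟩ *
        P₂.char ⟨_, (exists_mid x).choose_spec.2⟩
      map_one' := (hc.indep _ _ P.dom.one_mem P₂.dom.one_mem).trans
        ((congrArg₂ (· * ·) P.char.map_one P₂.char.map_one).trans (mul_one _))
      map_mul' := fun x y => by
        refine (hc.indep _ _
          (P.dom.mul_mem (exists_mid x).choose_spec.1 (exists_mid y).choose_spec.1)
          (P₂.dom.mul_mem (exists_mid x).choose_spec.2 (exists_mid y).choose_spec.2)).trans ?_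
        rw [mul_mul_mul_comm, ← map_mul, ← map_mul]
        rfl }

/-- `(Δ(K), 1)`. -/
def diag (K : Subgroup Q) : FPair A (Q × Q) where
  dom := K.map ((MonoidHom.id Q).prod (MonoidHom.id Q))
  char := 1

theorem compat_diag_right (P : FPair A (Q₁ × Q₂)) (K : Subgroup Q₂) :
    P.Compat (diag K) := by
  rintro h hU ⟨k, hk, e⟩
  obtain rfl : h = 1 := by
    have h1 := congrArg Prod.fst e
    have h2 := congrArg Prod.snd e
    simp at h1 h2
    rw [← h1, h2]
  exact (congrArg _ P.char.map_one).trans inv_one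

theorem compat_diag_left (K : Subgroup Q₁) (P : FPair A (Q₁ × Q₂)) :
    (diag K).Compat P := by
  rintro h ⟨k, hk, e⟩ hV
  obtain rfl : h = 1 := by
    have h1 := congrArg Prod.fst e
    have h2 := congrArg Prod.snd e
    simp at h1 h2
    rw [← h2, h1]
  exact inv_one.trans P.char.map_one.symm

/-- `(D, φ) ∗ (Δ(K), 1)`. -/
def resRight (P : FPair A (Q₁ × Q₂)) (K : Subgroup Q₂) : FPair A (Q₁ × Q₂) :=
  P.star (diag K) (P.compat_diag_right K)

/-- `(Δ(K), 1) ∗ (D, φ)`. -/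
def resLeft (K : Subgroup Q₁) (P : FPair A (Q₁ × Q₂)) : FPair A (Q₁ × Q₂) :=
  (diag K).star P (compat_diag_left K P)

end FPair

/-! ### Fibered sets -/

/-- The relation on a left `(Q × A)`-set whose classes are the `A`-orbits. -/
def aRel (A Q : Type u) [CommGroup A] [Group Q] (X : Type u) [MulAction (Q × A) X] : Setoid X where
  r x y := ∃ a : A, ((1 : Q), a) • x = y
  iseqv :=
    { refl := fun x => ⟨1, one_smul (Q × A) x⟩
      symm := by
        rintro x _ ⟨a, rfl⟩
        exact ⟨a⁻¹, by rw [smul_smul]; simp [← Prod.one_eq_mk]⟩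
      trans := by
        rintro x _ _ ⟨a, rfl⟩ ⟨b, rfl⟩
        exact ⟨b * a, by rw [smul_smul]; simp⟩ }

/-- A left `A`-fibered `Q`-set: a `(Q × A)`-set, free over `A`, with finitely many `A`-orbits. -/
structure FibSet (A Q : Type u) [CommGroup A] [Group Q] where
  X : Type u
  [act : MulAction (Q × A) X]
  free : ∀ (a b : A) (x : X), ((1 : Q), a) • x = ((1 : Q), b) • x → a = b
  fin : Finite (Quotient (aRel A Q X))

attribute [instance] FibSet.act

/-- `(Q × A)`-equivariance. -/
def Equivariant (A Q : Type u) [CommGroup A] [Group Q] {X Y : Type u} [MulAction (Q × A) X]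
    [MulAction (Q × A) Y] (f : X → Y) : Prop :=
  ∀ (q : Q × A) (x : X), f (q • x) = q • f x

namespace FibSet

variable {A Q : Type u} [CommGroup A] [Group Q]

/-- The set of `A`-orbits. -/
abbrev Orb (X : FibSet A Q) : Type u := Quotient (aRel A Q X.X)

/-- The stabilizer in `Q` of the `A`-orbit of `x`. -/
def stab (X : FibSet A Q) (x : X.X) : Subgroup Q where
  carrier := {q | ∃ a : A, (q, (1 : A)) • x = ((1 : Q), a) • x}
  one_mem' := ⟨1, rfl⟩
  mul_mem' := by
    rintro q r ⟨a, ha⟩ ⟨b, hb⟩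
    refine ⟨b * a, ?_⟩
    calc (q * r, (1 : A)) • x = (q, (1 : A)) • (r, (1 : A)) • x := by simp [smul_smul]
      _ = ((1 : Q), b) • (q, (1 : A)) • x := by rw [hb]; simp [smul_smul]
      _ = _ := by rw [ha]; simp [smul_smul]
  inv_mem' := by
    rintro q ⟨a, ha⟩
    refine ⟨a⁻¹, ?_⟩
    have : (q⁻¹, a⁻¹) • (q, (1 : A)) • x = (q⁻¹, a⁻¹) • ((1 : Q), a) • x := by rw [ha]
    simpa [smul_smul] using this.symm

theorem exists_weight (X : FibSet A Q) (x : X.X) (q : X.stab x) :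
    ∃ a : A, ((q : Q), (1 : A)) • x = ((1 : Q), a) • x := q.2

/-- The element `φ_x(q)` of `A` determined by `q x = φ_x(q) x`. -/
def weight (X : FibSet A Q) (x : X.X) (q : X.stab x) : A := (X.exists_weight x q).choose

theorem weight_spec (X : FibSet A Q) (x : X.X) (q : X.stab x) :
    ((q : Q), (1 : A)) • x = ((1 : Q), X.weight x q) • x := (X.exists_weight x q).choose_spec

/-- The stabilizing pair `(Q_x, φ_x)`, where `q x = φ_x(q) x` for `q ∈ Q_x`. -/
def stabPair (X : FibSet A Q) (x : X.X) : FPair A Q where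
  dom := X.stab x
  char :=
    { toFun := X.weight x
      map_one' := X.free _ _ x (X.weight_spec x 1).symm
      map_mul' := fun q r => by
        apply X.free _ _ x
        rw [← X.weight_spec x (q * r)]
        calc ((q : Q) * r, (1 : A)) • x = ((q : Q), (1 : A)) • ((r : Q), (1 : A)) • x := by
              simp [smul_smul]
          _ = ((1 : Q), X.weight x r) • ((q : Q), (1 : A)) • x := by
              rw [X.weight_spec x r]; simp [smul_smul]
          _ = _ := by rw [X.weight_spec x q]; simp [smul_smul, mul_comm] }

/-- The transitive fibered set `Q/(D, φ) = (Q × A)/{(d, φ(d)⁻¹) | d ∈ D}`. -/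
def trans [Finite Q] (P : FPair A Q) : FibSet A Q where
  X := (Q × A) ⧸ (P.dom.subtype.prod P.char⁻¹).range
  free := by
    rintro a b x
    induction x using QuotientGroup.induction_on with
    | H x =>
      intro h
      have h : (QuotientGroup.mk (((1 : Q), a) * x) : (Q × A) ⧸ (P.dom.subtype.prod P.char⁻¹).range)
        = QuotientGroup.mk (((1 : Q), b) * x) := h
      rw [QuotientGroup.eq] at h
      obtain ⟨d, hd⟩ := h
      have h1 := congrArg Prod.fst hd
      have h2 := congrArg Prod.snd hd
      simp at h1
      subst h1
      simp at h2
      have h3 : a⁻¹ * b = 1 := by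
        rw [← mul_right_inj x.2⁻¹, mul_one]
        calc x.2⁻¹ * (a⁻¹ * b) = x.2⁻¹ * a⁻¹ * (b * x.2) * x.2⁻¹ := by group
          _ = x.2⁻¹ := by rw [← h2, one_mul]
      exact (inv_mul_eq_one.mp h3)
  fin := by
    refine Finite.of_surjective
      (fun q : Q => Quotient.mk _ (QuotientGroup.mk ((q, 1) : Q × A))) ?_
    intro c
    induction c using Quotient.inductionOn with
    | h x =>
      induction x using QuotientGroup.induction_on with
      | H x =>
        refine ⟨x.1, Quotient.sound ⟨x.2, ?_⟩⟩
        change QuotientGroup.mk (((1 : Q), x.2) * (x.1, 1)) = _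
        simp

/-- The empty fibered set. -/
def empty (A Q : Type u) [CommGroup A] [Group Q] : FibSet A Q where
  X := PEmpty
  act := { smul := fun _ x => x, one_smul := fun x => x.elim, mul_smul := fun _ _ x => x.elim }
  free := fun _ _ x => x.elim
  fin := Finite.of_surjective (fun x : PEmpty.{u + 1} => x.elim) fun c => by
    induction c using Quotient.inductionOn with
    | h x => exact x.elim

/-- Disjoint union of fibered sets. -/
def sum (X Y : FibSet A Q) : FibSet A Q where
  X := X.X ⊕ Y.X
  free := by
    rintro a b (x | x) h
    · exact X.free a b x (Sum.inl_injective h)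
    · exact Y.free a b x (Sum.inr_injective h)
  fin := by
    have := X.fin
    have := Y.fin
    refine Finite.of_surjective (Sum.elim
      (Quotient.map Sum.inl ?_ : X.Orb → Quotient (aRel A Q (X.X ⊕ Y.X)))
      (Quotient.map Sum.inr ?_ : Y.Orb → Quotient (aRel A Q (X.X ⊕ Y.X)))) ?_
    · rintro x _ ⟨a, rfl⟩
      exact ⟨a, rfl⟩
    · rintro x _ ⟨a, rfl⟩
      exact ⟨a, rfl⟩
    · intro c
      induction c using Quotient.inductionOn with
      | h x =>
        rcases x with x | x
        · exact ⟨Sum.inl (Quotient.mk _ x), rfl⟩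
        · exact ⟨Sum.inr (Quotient.mk _ x), rfl⟩

/-- `Z` is the disjoint union of the images of `X` and `Y` under equivariant maps. -/
def IsUnion {X Y Z : Type u} [MulAction (Q × A) X] [MulAction (Q × A) Y] [MulAction (Q × A) Z]
    (i : X → Z) (j : Y → Z) : Prop :=
  Equivariant A Q i ∧ Equivariant A Q j ∧ Function.Bijective (Sum.elim i j)

/-- Isomorphism of fibered sets. -/
def isoSetoid (A Q : Type u) [CommGroup A] [Group Q] : Setoid (FibSet A Q) where
  r X Y := ∃ f : X.X → Y.X, Equivariant A Q f ∧ Function.Bijective f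
  iseqv :=
    { refl := fun X => ⟨id, fun _ _ => rfl, Function.bijective_id⟩
      symm := by
        rintro X Y ⟨f, hf, hb⟩
        obtain ⟨g, hl, hr⟩ := Function.bijective_iff_has_inverse.mp hb
        refine ⟨g, fun q y => ?_, Function.bijective_iff_has_inverse.mpr ⟨f, hr, hl⟩⟩
        apply hb.1
        rw [hf, hr, hr]
      trans := by
        rintro X Y Z ⟨f, hf, hb⟩ ⟨g, hg, hc⟩
        exact ⟨g ∘ f, fun q x => by simp [hf q x, hg q], hc.comp hb⟩ }

end FibSet

/-! ### The groups `B^A(Q)` -/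

section Burnside

variable (A Q : Type u) [CommGroup A] [Group Q]

/-- Isomorphism classes of `A`-fibered `Q`-sets. -/
def IsoClass : Type (u + 1) := Quotient (FibSet.isoSetoid A Q)

variable {A Q}

/-- The isomorphism class of a fibered set. -/
def IsoClass.mk (X : FibSet A Q) : IsoClass A Q := Quotient.mk _ X

theorem IsoClass.sound {X Y : FibSet A Q} (f : X.X → Y.X) (hf : Equivariant A Q f)
    (hb : Function.Bijective f) : IsoClass.mk X = IsoClass.mk Y :=
  Quotient.sound ⟨f, hf, hb⟩

instance : Add (IsoClass A Q) where
  add := Quotient.map₂ FibSet.sum (by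
    rintro X X₂ ⟨f, hf, hb⟩ Y Y₂ ⟨g, hg, hc⟩
    refine ⟨Sum.map f g, ?_, hb.sumMap hc⟩
    rintro q (x | x)
    · exact congrArg Sum.inl (hf q x)
    · exact congrArg Sum.inr (hg q x))

instance : Zero (IsoClass A Q) where
  zero := IsoClass.mk (FibSet.empty A Q)

/-- Isomorphism classes form a commutative monoid under disjoint union. -/
instance : AddCommMonoid (IsoClass A Q) where
  add_assoc := by
    rintro ⟨X⟩ ⟨Y⟩ ⟨Z⟩
    refine IsoClass.sound (Equiv.sumAssoc X.X Y.X Z.X) ?_ (Equiv.bijective _)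
    rintro q ((x | x) | x) <;> rfl
  add_comm := by
    rintro ⟨X⟩ ⟨Y⟩
    refine IsoClass.sound (Equiv.sumComm X.X Y.X) ?_ (Equiv.bijective _)
    rintro q (x | x) <;> rfl
  zero_add := by
    rintro ⟨X⟩
    refine IsoClass.sound (Equiv.emptySum PEmpty.{u + 1} X.X) ?_ (Equiv.bijective _)
    rintro q (x | x)
    · exact x.elim
    · rfl
  add_zero := by
    rintro ⟨X⟩
    refine IsoClass.sound (Equiv.sumEmpty X.X PEmpty.{u + 1}) ?_ (Equiv.bijective _)
    rintro q (x | x)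
    · rfl
    · exact x.elim
  nsmul := nsmulRec

theorem IsoClass.mk_union {X Y Z : FibSet A Q} (i : X.X → Z.X) (j : Y.X → Z.X)
    (h : FibSet.IsUnion (A := A) (Q := Q) i j) :
    IsoClass.mk Z = IsoClass.mk X + IsoClass.mk Y := by
  symm
  refine IsoClass.sound (X := X.sum Y) (Sum.elim i j) ?_ h.2.2
  rintro q (x | x)
  · exact h.1 q x
  · exact h.2.1 q x

variable (A Q) in
/-- `B^A(Q)`, the Grothendieck group of `A`-fibered `Q`-sets under disjoint union. -/
abbrev BGrp : Type (u + 1) := Algebra.GrothendieckAddGroup (IsoClass A Q)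

variable (A Q) in
/-- `B^A_R(Q) = R ⊗_ℤ B^A(Q)`. -/
abbrev BR (R : Type w) [CommRing R] : Type (max (u + 1) w) := R ⊗[ℤ] BGrp A Q

/-- The class `[X] = 1 ⊗ [X]` in `B^A_R(Q)`. -/
def cls (R : Type w) [CommRing R] (X : FibSet A Q) : BR A Q R :=
  (1 : R) ⊗ₜ[ℤ] (Algebra.GrothendieckAddGroup.of (IsoClass.mk X) : BGrp A Q)

end Burnside

/-! ### Tensor products

`Y` is a set on which `N × A` (the group over which one tensors) and `Q × A` act by commuting
actions. -/

section Tensor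

variable (A N Q : Type u) [CommGroup A] [Group N] [Group Q]

/-- The relation whose classes are the `(N × A)`-orbits. -/
def balRel (Y : Type u) [MulAction ((N × A) × (Q × A)) Y] : Setoid Y where
  r x y := ∃ n : N × A, (n, (1 : Q × A)) • x = y
  iseqv :=
    { refl := fun x => ⟨1, one_smul ((N × A) × (Q × A)) x⟩
      symm := by
        rintro x _ ⟨a, rfl⟩
        refine ⟨a⁻¹, ?_⟩
        rw [smul_smul, Prod.mk_mul_mk, inv_mul_cancel, one_mul]
        exact one_smul ((N × A) × (Q × A)) x
      trans := by
        rintro x _ _ ⟨a, rfl⟩ ⟨b, rfl⟩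
        exact ⟨b * a, by rw [smul_smul]; congr 1; ext <;> simp⟩ }

/-- The set of `(N × A)`-orbits. -/
abbrev BalOrb (Y : Type u) [MulAction ((N × A) × (Q × A)) Y] : Type u := Quotient (balRel A N Q Y)

instance (Y : Type u) [MulAction ((N × A) × (Q × A)) Y] : MulAction (Q × A) (BalOrb A N Q Y) where
  smul q := Quotient.map (fun y => ((1 : N × A), q) • y) (by
    rintro x _ ⟨n, rfl⟩
    exact ⟨n, by simp [smul_smul]⟩)
  one_smul := by
    rintro ⟨y⟩
    exact congrArg (Quotient.mk _) (one_smul ((N × A) × (Q × A)) y)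
  mul_smul := by
    rintro q r ⟨y⟩
    refine congrArg (Quotient.mk _) ?_
    change ((1 : N × A), q * r) • y = ((1 : N × A), q) • ((1 : N × A), r) • y
    rw [smul_smul]
    congr 1
    ext <;> simp

/-- The orbit of `y`. -/
def BalOrb.mk {Y : Type u} [MulAction ((N × A) × (Q × A)) Y] (y : Y) : BalOrb A N Q Y :=
  Quotient.mk _ y

theorem BalOrb.smul_mk {Y : Type u} [MulAction ((N × A) × (Q × A)) Y] (q : Q × A) (y : Y) :
    q • BalOrb.mk A N Q y = BalOrb.mk A N Q (((1 : N × A), q) • y) := rfl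

/-- `A` acts freely on the orbit `c`. -/
def AFree {Y : Type u} [MulAction ((N × A) × (Q × A)) Y] (c : BalOrb A N Q Y) : Prop :=
  ∀ a b : A, ((1 : Q), a) • c = ((1 : Q), b) • c → a = b

/-- The set of the `(N × A)`-orbits that are `A`-free. -/
def FreeOrb (Y : Type u) [MulAction ((N × A) × (Q × A)) Y] : Type u :=
  {c : BalOrb A N Q Y // AFree A N Q c}

theorem AFree.smul {Y : Type u} [MulAction ((N × A) × (Q × A)) Y] {c : BalOrb A N Q Y}
    (h : AFree A N Q c) (q : Q × A) : AFree A N Q (q • c) := by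
  intro a b e
  apply h
  have e2 : q⁻¹ • ((1 : Q), a) • q • c = q⁻¹ • ((1 : Q), b) • q • c := congrArg _ e
  have key : ∀ d : A, q⁻¹ * (((1 : Q), d) * q) = ((1 : Q), d) := by
    intro d
    ext
    · simp
    · simp [mul_comm d]
  rwa [smul_smul ((1 : Q), a), smul_smul ((1 : Q), b), smul_smul, smul_smul, key, key] at e2

instance (Y : Type u) [MulAction ((N × A) × (Q × A)) Y] : MulAction (Q × A) (FreeOrb A N Q Y) where
  smul q c := ⟨q • c.1, c.2.smul A N Q q⟩
  one_smul c := Subtype.ext (one_smul (Q × A) c.1)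
  mul_smul q r c := Subtype.ext (mul_smul q r c.1)

/-- The fibered `Q`-set of the `A`-free orbits, for `Y` with finitely many orbits under
`N`, `A` and `A`. -/
def freeOrbSet (Y : Type u) [MulAction ((N × A) × (Q × A)) Y]
    (hY : ∃ T : Set Y, T.Finite ∧ ∀ y, ∃ t ∈ T, ∃ (n : N × A) (b : A), (n, ((1 : Q), b)) • t = y) :
    FibSet A Q where
  X := FreeOrb A N Q Y
  free a b c h := c.2 a b (congrArg Subtype.val h)
  fin := by
    obtain ⟨T, hT, hcov⟩ := hY
    have := hT.to_subtype
    have hc : ∀ c : Quotient (aRel A Q (FreeOrb A N Q Y)), ∃ t : T, ∃ d : FreeOrb A N Q Y,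
        Quotient.mk _ d = c ∧ ∃ b : A, ((1 : Q), b) • BalOrb.mk A N Q t.1 = d.1 := by
      rintro ⟨⟨⟨y⟩, hy⟩⟩
      obtain ⟨t, ht, n, b, rfl⟩ := hcov y
      refine ⟨⟨t, ht⟩, _, rfl, b, ?_⟩
      exact Quotient.sound ⟨n, by rw [smul_smul]; simp⟩
    choose t d hd b hb using hc
    refine Finite.of_injective t fun c c₂ e => ?_
    rw [← hd c, ← hd c₂]
    refine Quotient.sound ⟨b c₂ * (b c)⁻¹, Subtype.ext ?_⟩
    change ((1 : Q), b c₂ * (b c)⁻¹) • (d c).1 = (d c₂).1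
    rw [← hb c, ← hb c₂, smul_smul, e]
    simp

variable {A N Q}

theorem BalOrb.mk_eq {Y : Type u} [MulAction ((N × A) × (Q × A)) Y] {y z : Y} :
    BalOrb.mk A N Q y = BalOrb.mk A N Q z ↔ ∃ n : N × A, (n, (1 : Q × A)) • y = z :=
  ⟨fun h => Quotient.exact h, fun h => Quotient.sound h⟩

section Functoriality

variable {Y Y₁ Y₂ : Type u} [MulAction ((N × A) × (Q × A)) Y] [MulAction ((N × A) × (Q × A)) Y₁]
  [MulAction ((N × A) × (Q × A)) Y₂]

theorem BalOrb.mk_map_eq (f : Y₁ → Y) (hf : ∀ (q : (N × A) × (Q × A)) y, f (q • y) = q • f y)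
    (hi : Function.Injective f) {y z : Y₁} :
    BalOrb.mk A N Q (f y) = BalOrb.mk A N Q (f z) ↔ BalOrb.mk A N Q y = BalOrb.mk A N Q z := by
  rw [BalOrb.mk_eq, BalOrb.mk_eq]
  refine exists_congr fun n => ?_
  rw [← hf, hi.eq_iff]

theorem AFree.map_iff (f : Y₁ → Y) (hf : ∀ (q : (N × A) × (Q × A)) y, f (q • y) = q • f y)
    (hi : Function.Injective f) (y : Y₁) :
    AFree A N Q (BalOrb.mk A N Q (f y)) ↔ AFree A N Q (BalOrb.mk A N Q y) := by
  refine forall_congr' fun a => forall_congr' fun b => ?_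
  simp only [BalOrb.smul_mk, ← hf, BalOrb.mk_map_eq f hf hi]

/-- The map induced on `A`-free orbits by an injective equivariant map. -/
def FreeOrb.map (f : Y₁ → Y) (hf : ∀ (q : (N × A) × (Q × A)) y, f (q • y) = q • f y)
    (hi : Function.Injective f) (c : FreeOrb A N Q Y₁) : FreeOrb A N Q Y :=
  ⟨Quotient.map f (by rintro x _ ⟨n, rfl⟩; exact ⟨n, (hf _ _).symm⟩) c.1, by
    obtain ⟨⟨y⟩, hy⟩ := c
    exact (AFree.map_iff f hf hi y).mpr hy⟩

theorem FreeOrb.isUnion (i : Y₁ → Y) (j : Y₂ → Y)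
    (hi : ∀ (q : (N × A) × (Q × A)) y, i (q • y) = q • i y)
    (hj : ∀ (q : (N × A) × (Q × A)) y, j (q • y) = q • j y)
    (hb : Function.Bijective (Sum.elim i j)) (ii : Function.Injective i)
    (ij : Function.Injective j) :
    FibSet.IsUnion (A := A) (Q := Q) (FreeOrb.map i hi ii) (FreeOrb.map j hj ij) := by
  refine ⟨?_, ?_, ?_, ?_⟩
  · rintro q ⟨⟨y⟩, hy⟩
    exact Subtype.ext (congrArg (Quotient.mk _) (hi _ y))
  · rintro q ⟨⟨y⟩, hy⟩
    exact Subtype.ext (congrArg (Quotient.mk _) (hj _ y))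
  · rintro (⟨⟨y⟩, hy⟩ | ⟨⟨y⟩, hy⟩) (⟨⟨z⟩, hz⟩ | ⟨⟨z⟩, hz⟩) h
    · exact congrArg Sum.inl (Subtype.ext ((BalOrb.mk_map_eq i hi ii).mp (congrArg Subtype.val h)))
    · obtain ⟨n, hn⟩ := BalOrb.mk_eq.mp (show BalOrb.mk A N Q (i y) = BalOrb.mk A N Q (j z) from
        congrArg Subtype.val h)
      rw [← hi] at hn
      exact absurd (hb.1 (a₁ := Sum.inl _) (a₂ := Sum.inr _) hn) (by simp)
    · obtain ⟨n, hn⟩ := BalOrb.mk_eq.mp (show BalOrb.mk A N Q (j y) = BalOrb.mk A N Q (i z) from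
        congrArg Subtype.val h)
      rw [← hj] at hn
      exact absurd (hb.1 (a₁ := Sum.inr _) (a₂ := Sum.inl _) hn) (by simp)
    · exact congrArg Sum.inr (Subtype.ext ((BalOrb.mk_map_eq j hj ij).mp (congrArg Subtype.val h)))
  · rintro ⟨⟨y⟩, hy⟩
    obtain ⟨x | x, rfl⟩ := hb.2 y
    · exact ⟨Sum.inl ⟨BalOrb.mk A N Q x, (AFree.map_iff i hi ii x).mp hy⟩, rfl⟩
    · exact ⟨Sum.inr ⟨BalOrb.mk A N Q x, (AFree.map_iff j hj ij x).mp hy⟩, rfl⟩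

end Functoriality

end Tensor

section TensorProducts

variable {A G H K : Type u} [CommGroup A] [Group G] [Group H] [Group K]

/-- `U × V` with the action `(h, a)(u, v) = (u(ha)⁻¹, hav)` of `H × A` and the action
`(g, k, b)(u, v) = (gbu, vk⁻¹)` of `(G × K) × A`; for an `A`-fibered `(G, H)`-biset, that is a left
`A`-fibered `(G × H)`-set, one has `gubh = ((g, h⁻¹), b)u`. -/
def PairSet (U : FibSet A (G × H)) (V : FibSet A (H × K)) : Type u := U.X × V.X

instance (U : FibSet A (G × H)) (V : FibSet A (H × K)) :
    MulAction ((H × A) × ((G × K) × A)) (PairSet U V) where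
  smul q y := (((q.2.1.1, q.1.1), q.1.2⁻¹ * q.2.2) • y.1, ((q.1.1, q.2.1.2), q.1.2) • y.2)
  one_smul y := by
    refine Prod.ext ?_ ?_
    · refine Eq.trans ?_ (one_smul ((G × H) × A) y.1)
      exact congrArg (· • y.1) (by ext <;> simp)
    · exact one_smul ((H × K) × A) y.2
  mul_smul q r y := by
    refine Prod.ext ?_ ?_
    · refine Eq.trans ?_ (mul_smul _ _ y.1)
      refine congrArg (· • y.1) ?_
      ext
      · simp
      · simp
      · simp [mul_mul_mul_comm, mul_comm]
    · exact mul_smul ((q.1.1, q.2.1.2), q.1.2) ((r.1.1, r.2.1.2), r.1.2) y.2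

/-- `U × X` with the action `(h, a)(u, x) = (u(ha)⁻¹, hax)` of `H × A` and the action
`(g, b)(u, x) = (gbu, x)` of `G × A`. -/
def PairSetLeft (U : FibSet A (G × H)) (X : FibSet A H) : Type u := U.X × X.X

instance (U : FibSet A (G × H)) (X : FibSet A H) :
    MulAction ((H × A) × (G × A)) (PairSetLeft U X) where
  smul q y := (((q.2.1, q.1.1), q.1.2⁻¹ * q.2.2) • y.1, (q.1.1, q.1.2) • y.2)
  one_smul y := by
    refine Prod.ext ?_ ?_
    · refine Eq.trans ?_ (one_smul ((G × H) × A) y.1)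
      exact congrArg (· • y.1) (by ext <;> simp)
    · exact one_smul (H × A) y.2
  mul_smul q r y := by
    refine Prod.ext ?_ ?_
    · refine Eq.trans ?_ (mul_smul _ _ y.1)
      refine congrArg (· • y.1) ?_
      ext
      · simp
      · simp
      · simp [mul_mul_mul_comm, mul_comm]
    · exact mul_smul q.1 r.1 y.2

theorem exists_reps {Q : Type u} [Group Q] (X : FibSet A Q) :
    ∃ T : Set X.X, T.Finite ∧ ∀ x, ∃ t ∈ T, ∃ a : A, ((1 : Q), a) • t = x := by
  have := X.fin
  refine ⟨Set.range (fun c : X.Orb => c.out), Set.finite_range _, fun x => ?_⟩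
  exact ⟨_, ⟨(Quotient.mk _ x : X.Orb), rfl⟩,
    Quotient.exact (Quotient.out_eq (Quotient.mk _ x : X.Orb))⟩

/-- The tensor product `U ⊗_{AH} V` of an `A`-fibered `(G, H)`-biset and an `A`-fibered
`(H, K)`-biset: the `A`-free `(H × A)`-orbits of `U × V`. -/
def tensor (U : FibSet A (G × H)) (V : FibSet A (H × K)) : FibSet A (G × K) :=
  freeOrbSet A H (G × K) (PairSet U V) (by
    obtain ⟨S, hS, hS2⟩ := exists_reps U
    obtain ⟨T, hT, hT2⟩ := exists_reps V
    refine ⟨S ×ˢ T, hS.prod hT, ?_⟩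
    rintro ⟨u, v⟩
    obtain ⟨s, hs, a, rfl⟩ := hS2 u
    obtain ⟨t, ht, b, rfl⟩ := hT2 v
    refine ⟨(s, t), ⟨hs, ht⟩, (1, b), b * a, ?_⟩
    refine Prod.ext ?_ rfl
    exact congrArg (fun q : (G × H) × A => q • s) (by ext <;> simp))

/-- The tensor product `U ⊗_{AH} X` of an `A`-fibered `(G, H)`-biset and an `A`-fibered `H`-set:
the `A`-free `(H × A)`-orbits of `U × X`. -/
def tensorLeft (U : FibSet A (G × H)) (X : FibSet A H) : FibSet A G :=
  freeOrbSet A H G (PairSetLeft U X) (by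
    obtain ⟨S, hS, hS2⟩ := exists_reps U
    obtain ⟨T, hT, hT2⟩ := exists_reps X
    refine ⟨S ×ˢ T, hS.prod hT, ?_⟩
    rintro ⟨u, v⟩
    obtain ⟨s, hs, a, rfl⟩ := hS2 u
    obtain ⟨t, ht, b, rfl⟩ := hT2 v
    refine ⟨(s, t), ⟨hs, ht⟩, (1, b), b * a, ?_⟩
    refine Prod.ext ?_ rfl
    exact congrArg (fun q : (G × H) × A => q • s) (by ext <;> simp))

/-- The `(H × A)`-orbit of `(u, x)` in `U × X`. -/
def pureOrb (U : FibSet A (G × H)) (X : FibSet A H) (u : U.X) (x : X.X) :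
    BalOrb A H G (PairSetLeft U X) :=
  BalOrb.mk A H G ((u, x) : PairSetLeft U X)

theorem tensor_union_left {U₁ U₂ U : FibSet A (G × H)} (V : FibSet A (H × K))
    (i : U₁.X → U.X) (j : U₂.X → U.X) (h : FibSet.IsUnion (A := A) (Q := G × H) i j) :
    IsoClass.mk (tensor U V) = IsoClass.mk (tensor U₁ V) + IsoClass.mk (tensor U₂ V) := by
  have ii : Function.Injective i := fun x y e =>
    Sum.inl_injective (h.2.2.1 (a₁ := Sum.inl x) (a₂ := Sum.inl y) e)
  have ij : Function.Injective j := fun x y e =>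
    Sum.inr_injective (h.2.2.1 (a₁ := Sum.inr x) (a₂ := Sum.inr y) e)
  refine IsoClass.mk_union _ _ (FreeOrb.isUnion (Y := PairSet U V) (Y₁ := PairSet U₁ V)
    (Y₂ := PairSet U₂ V) (fun y => (i y.1, y.2)) (fun y => (j y.1, y.2)) ?_ ?_ ?_ ?_ ?_)
  · exact fun q y => Prod.ext (h.1 _ _) rfl
  · exact fun q y => Prod.ext (h.2.1 _ _) rfl
  · refine ⟨?_, ?_⟩
    · rintro (⟨x, v⟩ | ⟨x, v⟩) (⟨y, w⟩ | ⟨y, w⟩) e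
      · have h1 := ii (congrArg Prod.fst e)
        have h2 : v = w := congrArg Prod.snd e
        exact congrArg Sum.inl (Prod.ext h1 h2)
      · exact absurd (h.2.2.1 (a₁ := Sum.inl x) (a₂ := Sum.inr y) (congrArg Prod.fst e)) (by simp)
      · exact absurd (h.2.2.1 (a₁ := Sum.inr x) (a₂ := Sum.inl y) (congrArg Prod.fst e)) (by simp)
      · have h1 := ij (congrArg Prod.fst e)
        have h2 : v = w := congrArg Prod.snd e
        exact congrArg Sum.inr (Prod.ext h1 h2)
    · rintro ⟨u, v⟩
      obtain ⟨x | x, rfl⟩ := h.2.2.2 u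
      · exact ⟨Sum.inl (x, v), rfl⟩
      · exact ⟨Sum.inr (x, v), rfl⟩
  · exact fun x y e => Prod.ext (ii (congrArg Prod.fst e)) (congrArg Prod.snd e :)
  · exact fun x y e => Prod.ext (ij (congrArg Prod.fst e)) (congrArg Prod.snd e :)

theorem tensor_union_right (U : FibSet A (G × H)) {V₁ V₂ V : FibSet A (H × K)}
    (i : V₁.X → V.X) (j : V₂.X → V.X) (h : FibSet.IsUnion (A := A) (Q := H × K) i j) :
    IsoClass.mk (tensor U V) = IsoClass.mk (tensor U V₁) + IsoClass.mk (tensor U V₂) := by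
  have ii : Function.Injective i := fun x y e =>
    Sum.inl_injective (h.2.2.1 (a₁ := Sum.inl x) (a₂ := Sum.inl y) e)
  have ij : Function.Injective j := fun x y e =>
    Sum.inr_injective (h.2.2.1 (a₁ := Sum.inr x) (a₂ := Sum.inr y) e)
  refine IsoClass.mk_union _ _ (FreeOrb.isUnion (Y := PairSet U V) (Y₁ := PairSet U V₁)
    (Y₂ := PairSet U V₂) (fun y => (y.1, i y.2)) (fun y => (y.1, j y.2)) ?_ ?_ ?_ ?_ ?_)
  · exact fun q y => Prod.ext rfl (h.1 _ _)
  · exact fun q y => Prod.ext rfl (h.2.1 _ _)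
  · refine ⟨?_, ?_⟩
    · rintro (⟨v, x⟩ | ⟨v, x⟩) (⟨w, y⟩ | ⟨w, y⟩) e
      · have h1 := ii (congrArg Prod.snd e)
        have h2 : v = w := congrArg Prod.fst e
        exact congrArg Sum.inl (Prod.ext h2 h1)
      · exact absurd (h.2.2.1 (a₁ := Sum.inl x) (a₂ := Sum.inr y) (congrArg Prod.snd e)) (by simp)
      · exact absurd (h.2.2.1 (a₁ := Sum.inr x) (a₂ := Sum.inl y) (congrArg Prod.snd e)) (by simp)
      · have h1 := ij (congrArg Prod.snd e)
        have h2 : v = w := congrArg Prod.fst e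
        exact congrArg Sum.inr (Prod.ext h2 h1)
    · rintro ⟨u, v⟩
      obtain ⟨x | x, rfl⟩ := h.2.2.2 v
      · exact ⟨Sum.inl (u, x), rfl⟩
      · exact ⟨Sum.inr (u, x), rfl⟩
  · exact fun x y e => Prod.ext (congrArg Prod.fst e :) (ii (congrArg Prod.snd e))
  · exact fun x y e => Prod.ext (congrArg Prod.fst e :) (ij (congrArg Prod.snd e))

theorem isUnion_sum {Q : Type u} [Group Q] (X Y : FibSet A Q) :
    FibSet.IsUnion (A := A) (Q := Q) (Z := (X.sum Y).X) (Sum.inl : X.X → X.X ⊕ Y.X)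
      (Sum.inr : Y.X → X.X ⊕ Y.X) :=
  ⟨fun _ _ => rfl, fun _ _ => rfl, by
    have h : Function.Bijective (Sum.elim Sum.inl Sum.inr : X.X ⊕ Y.X → X.X ⊕ Y.X) := by
      rw [Sum.elim_inl_inr]
      exact Function.bijective_id
    exact h⟩

theorem isUnion_empty {Q : Type u} [Group Q] {X Y : FibSet A Q} (f : X.X → Y.X)
    (hf : Equivariant A Q f) (hb : Function.Bijective f) :
    FibSet.IsUnion (A := A) (Q := Q) f (fun x : (FibSet.empty A Q).X => (PEmpty.elim x : Y.X)) := by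
  refine ⟨hf, fun _ x => x.elim, ?_, fun y => ?_⟩
  · rintro (x | x) (y | y) e
    · exact congrArg _ (hb.1 e)
    · exact y.elim
    · exact x.elim
    · exact x.elim
  · obtain ⟨x, rfl⟩ := hb.2 y
    exact ⟨Sum.inl x, rfl⟩

theorem tensor_empty_left (V : FibSet A (H × K)) :
    IsoClass.mk (tensor (FibSet.empty A (G × H)) V) = 0 :=
  IsoClass.sound (fun c => (Quot.lift (fun y => y.1.elim) (by rintro ⟨x, _⟩; exact x.elim) c.1 :
    PEmpty.{u + 1})) (by rintro q ⟨⟨⟨x, _⟩⟩, _⟩; exact x.elim)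
    ⟨by rintro ⟨⟨⟨x, _⟩⟩, _⟩; exact x.elim, fun x => x.elim⟩

theorem tensor_empty_right (U : FibSet A (G × H)) :
    IsoClass.mk (tensor U (FibSet.empty A (H × K))) = 0 :=
  IsoClass.sound (fun c => (Quot.lift (fun y => y.2.elim) (by rintro ⟨_, x⟩; exact x.elim) c.1 :
    PEmpty.{u + 1})) (by rintro q ⟨⟨⟨_, x⟩⟩, _⟩; exact x.elim)
    ⟨by rintro ⟨⟨⟨_, x⟩⟩, _⟩; exact x.elim, fun x => x.elim⟩

/-- The tensor product on isomorphism classes, a biadditive map. -/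
def tensorMon : IsoClass A (G × H) →+ IsoClass A (H × K) →+ IsoClass A (G × K) where
  toFun a :=
    { toFun := fun b => Quotient.map₂ tensor (by
        rintro U U₂ ⟨f, hf, hb⟩ V V₂ ⟨g, hg, hc⟩
        apply Quotient.exact
        have e1 := tensor_union_left V _ _ (isUnion_empty f hf hb)
        have e2 := tensor_union_right U₂ _ _ (isUnion_empty g hg hc)
        rw [tensor_empty_left, add_zero] at e1
        rw [tensor_empty_right, add_zero] at e2
        exact e1.symm.trans e2.symm) a b
      map_zero' := by
        obtain ⟨U⟩ := a
        exact tensor_empty_right U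
      map_add' := by
        obtain ⟨U⟩ := a
        rintro ⟨V⟩ ⟨V₂⟩
        exact tensor_union_right U _ _ (isUnion_sum V V₂) }
  map_zero' := by
    ext ⟨V⟩
    exact tensor_empty_left V
  map_add' := by
    rintro ⟨U⟩ ⟨U₂⟩
    ext ⟨V⟩
    exact tensor_union_left V _ _ (isUnion_sum U U₂)

theorem grothendieck_hom_ext {M B : Type*} [AddCommMonoid M] [AddCommGroup B]
    {f g : Algebra.GrothendieckAddGroup M →+ B}
    (h : ∀ m, f (Algebra.GrothendieckAddGroup.of m) = g (Algebra.GrothendieckAddGroup.of m)) :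
    f = g :=
  Algebra.GrothendieckAddGroup.lift.symm.injective (AddMonoidHom.ext h)

theorem grothendieck_lift_of {M B : Type*} [AddCommMonoid M] [AddCommGroup B] (f : M →+ B)
    (m : M) :
    Algebra.GrothendieckAddGroup.lift f (Algebra.GrothendieckAddGroup.of m) = f m :=
  DFunLike.congr_fun (Algebra.GrothendieckAddGroup.lift.symm_apply_apply f) m

open Algebra in
/-- The tensor product on Grothendieck groups. -/
def tensorGrp : BGrp A (G × H) →+ BGrp A (H × K) →+ BGrp A (G × K) :=
  GrothendieckAddGroup.lift
    { toFun := fun a => GrothendieckAddGroup.lift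
        (GrothendieckAddGroup.of.comp (tensorMon (K := K) a))
      map_zero' := by
        refine grothendieck_hom_ext fun m => ?_
        rw [grothendieck_lift_of, map_zero]
        exact map_zero (GrothendieckAddGroup.of (M := IsoClass A (G × K)))
      map_add' := fun a b => by
        refine grothendieck_hom_ext fun m => ?_
        rw [AddMonoidHom.add_apply, grothendieck_lift_of, grothendieck_lift_of,
          grothendieck_lift_of, map_add]
        exact map_add (GrothendieckAddGroup.of (M := IsoClass A (G × K))) _ _ }

theorem tensorGrp_of (a : IsoClass A (G × H)) (b : IsoClass A (H × K)) :
    tensorGrp (Algebra.GrothendieckAddGroup.of a) (Algebra.GrothendieckAddGroup.of b) =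
      Algebra.GrothendieckAddGroup.of (tensorMon a b) :=
  (DFunLike.congr_fun (grothendieck_lift_of _ a) _).trans (grothendieck_lift_of _ b)

/-- The composition of the `A`-fibered biset category over `R`: the `R`-bilinear extension of
`[U] ∘ [V] = [U ⊗_{AH} V]`. -/
def compR (R : Type w) [CommRing R] :
    BR A (G × H) R →ₗ[R] BR A (H × K) R →ₗ[R] BR A (G × K) R :=
  LinearMap.liftBaseChange R
    (AddMonoidHom.toIntLinearMap
      { toFun := fun a => LinearMap.baseChange R (tensorGrp (K := K) a).toIntLinearMap
        map_zero' := by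
          ext x; simp
        map_add' := fun a b => by
          ext x; simp [TensorProduct.tmul_add] })

theorem compR_cls (R : Type w) [CommRing R] (U : FibSet A (G × H)) (V : FibSet A (H × K)) :
    compR R (cls R U) (cls R V) = cls R (tensor U V) := by
  rw [cls, cls, compR, LinearMap.liftBaseChange_tmul, one_smul]
  exact congrArg ((1 : R) ⊗ₜ[ℤ] ·) (tensorGrp_of (IsoClass.mk U) (IsoClass.mk V))

end TensorProducts

/-! ### Classes of finite groups and the data `(𝒢, 𝒮)` -/

/-- A group, presented as a subgroup of an ambient group. In this way a subgroup of a subgroup of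
`G` is again a subgroup of the same ambient group, as in set theory; an abstract group is the top
subgroup of itself. -/
structure SubGrp : Type (u + 1) where
  amb : Type u
  [inst : Group amb]
  grp : Subgroup amb

attribute [instance] SubGrp.inst

/-- A class of finite groups. -/
structure GroupClass : Type (u + 1) where
  carrier : Set SubGrp.{u}
  finite : ∀ G ∈ carrier, Finite G.grp

/-- The members of the class `𝒢`. -/
abbrev Obj (𝒢 : GroupClass.{u}) : Type (u + 1) := {G : SubGrp.{u} // G ∈ 𝒢.carrier}

/-- The underlying finite group of a member of `𝒢`. -/
abbrev Obj.grp {𝒢 : GroupClass.{u}} (G : Obj 𝒢) : Subgroup G.1.amb := G.1.grp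

/-- The condition `K ∈ 𝒢`, for a subgroup `K` of the ambient group of `G`. -/
abbrev Obj.Mem {𝒢 : GroupClass.{u}} (G : Obj 𝒢) (K : Subgroup G.1.amb) : Prop :=
  (⟨G.1.amb, K⟩ : SubGrp.{u}) ∈ 𝒢.carrier

/-- A subgroup `K ∈ 𝒢`, as a member of `𝒢`. -/
abbrev Obj.sub {𝒢 : GroupClass.{u}} (G : Obj 𝒢) (K : Subgroup G.1.amb) (h : G.Mem K) : Obj 𝒢 :=
  ⟨⟨G.1.amb, K⟩, h⟩

instance {𝒢 : GroupClass.{u}} (G : Obj 𝒢) : Finite G.grp := 𝒢.finite G.1 G.2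

section Data

variable {A : Type u} [CommGroup A] {𝒢 : GroupClass.{u}}

variable (A 𝒢) in
/-- A family `𝒮(G, H)`, for `G, H ∈ 𝒢`, of sets of pairs. -/
abbrev Family : Type (u + 1) := ∀ G H : Obj 𝒢, Set (FPair A (G.1.amb × H.1.amb))

/-- `𝒮(G, H) ⊆ ℳ(G × H)` for all `G, H ∈ 𝒢`. -/
def IsFamily (S : Family A 𝒢) : Prop :=
  ∀ (G H : Obj 𝒢), ∀ P ∈ S G H, P.dom ≤ G.grp.prod H.grp

/-- Axiom (i): `(Δ(G), 1) ∈ 𝒮(G, G)`. -/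
def AxiomI (S : Family A 𝒢) : Prop := ∀ G : Obj 𝒢, FPair.diag G.grp ∈ S G G

/-- Axiom (ii): `𝒮(G, H)` is closed under `(G × H)`-conjugation. -/
def AxiomII (S : Family A 𝒢) : Prop :=
  ∀ (G H : Obj 𝒢), ∀ P ∈ S G H, ∀ g ∈ G.grp, ∀ h ∈ H.grp, P.conj (g, h) ∈ S G H

/-- Axiom (iii): closure under the (partially defined) operation `∗`. -/
def AxiomIII (S : Family A 𝒢) : Prop :=
  ∀ (G H K : Obj 𝒢), ∀ P ∈ S G H, ∀ P₂ ∈ S H K, ∀ hc : P.Compat P₂, P.star P₂ hc ∈ S G K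

/-- Axiom (iv): for `(D, φ) ∈ 𝒮(G, H)` and `K ≤ H` in `𝒢` one has `D ∗ K ∈ 𝒢` and
`(D, φ) ∗ (Δ(K), 1) ∈ 𝒮(D ∗ K, K)`. -/
def AxiomIV (S : Family A 𝒢) : Prop :=
  ∀ (G H : Obj 𝒢), ∀ P ∈ S G H, ∀ K ≤ H.grp, ∀ hK : H.Mem K,
    ∃ h : G.Mem (starRight P.dom K),
      P.resRight K ∈ S (G.sub (starRight P.dom K) h) (H.sub K hK)

/-- Axiom (vi): for `H ≤ G` in `𝒢` one has `(Δ(H), 1) ∈ 𝒮(H, G)`. -/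
def AxiomVI (S : Family A 𝒢) : Prop :=
  ∀ G : Obj 𝒢, ∀ K ≤ G.grp, ∀ hK : G.Mem K, FPair.diag K ∈ S (G.sub K hK) G

/-- Axiom (vii): for `(D, φ) ∈ 𝒮(G, H)` one has `p₂(D) ∈ 𝒢`, and for `K ≤ p₂(D)` in `𝒢` one has
`D ∗ K ∈ 𝒢` and `(D, φ) ∗ (Δ(K), 1) ∈ 𝒮(D ∗ K, K)`. -/
def AxiomVII (S : Family A 𝒢) : Prop :=
  ∀ (G H : Obj 𝒢), ∀ P ∈ S G H, H.Mem (p2 P.dom) ∧ ∀ K ≤ p2 P.dom, ∀ hK : H.Mem K,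
    ∃ h : G.Mem (starRight P.dom K),
      P.resRight K ∈ S (G.sub (starRight P.dom K) h) (H.sub K hK)

/-- Axiom (viii): for `(D, φ) ∈ 𝒮(G, H)` one has `p₁(D) ∈ 𝒢`, and for `K ≤ p₁(D)` in `𝒢` one has
`K ∗ D ∈ 𝒢` and `(Δ(K), 1) ∗ (D, φ) ∈ 𝒮(K, K ∗ D)`. -/
def AxiomVIII (S : Family A 𝒢) : Prop :=
  ∀ (G H : Obj 𝒢), ∀ P ∈ S G H, G.Mem (p1 P.dom) ∧ ∀ K ≤ p1 P.dom, ∀ hK : G.Mem K,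
    ∃ h : H.Mem (starLeft K P.dom),
      FPair.resLeft K P ∈ S (G.sub K hK) (H.sub (starLeft K P.dom) h)

/-- The condition `k₂`: `k₂(D) = 1` for all `(D, φ) ∈ 𝒮(G, H)`. -/
def CondK2 (S : Family A 𝒢) : Prop := ∀ (G H : Obj 𝒢), ∀ P ∈ S G H, k2 P.dom = ⊥

/-- `𝒮₊(G, H) = {(D, φ) ∈ ℳ(G × H) | p₁(D) ∈ 𝒢, (D, φ) ∈ 𝒮(p₁(D), H)}`. -/
def lower (S : Family A 𝒢) : Family A 𝒢 := fun G H =>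
  {P | P.dom ≤ G.grp.prod H.grp ∧ ∃ h : G.Mem (p1 P.dom), P ∈ S (G.sub (p1 P.dom) h) H}

/-- `𝒮⁺(G, H) = {(D, φ) ∈ ℳ(G × H) | p₁(D), p₂(D) ∈ 𝒢, (D, φ) ∈ 𝒮(p₁(D), p₂(D))}`. -/
def upper (S : Family A 𝒢) : Family A 𝒢 := fun G H =>
  {P | P.dom ≤ G.grp.prod H.grp ∧ ∃ (h₁ : G.Mem (p1 P.dom)) (h₂ : H.Mem (p2 P.dom)),
    P ∈ S (G.sub (p1 P.dom) h₁) (H.sub (p2 P.dom) h₂)}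

/-! ### Fibered sets and bisets for members of `𝒢` -/

variable (A) in
/-- `A`-fibered `G`-sets. -/
abbrev GSet (G : Obj 𝒢) : Type (u + 1) := FibSet A G.grp

variable (A) in
/-- `A`-fibered `(G, H)`-bisets. -/
abbrev Biset (G H : Obj 𝒢) : Type (u + 1) := FibSet A (G.grp × H.grp)

/-- The inclusion of `G × H` into the product of the ambient groups. -/
def incl (G H : Obj 𝒢) : G.grp × H.grp →* G.1.amb × H.1.amb :=
  G.grp.subtype.prodMap H.grp.subtype

theorem incl_injective (G H : Obj 𝒢) : Function.Injective (incl G H) :=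
  Function.Injective.prodMap G.grp.subtype_injective H.grp.subtype_injective

/-- The stabilizing pair `(G_x, φ_x)` in `ℳ(G)`. -/
def setPair {G : Obj 𝒢} (X : GSet A G) (x : X.X) : FPair A G.1.amb :=
  (X.stabPair x).push G.grp.subtype G.grp.subtype_injective

/-- The stabilizing pair `((G × H)_u, φ_u)` in `ℳ(G × H)`. -/
def bisetPair {G H : Obj 𝒢} (U : Biset A G H) (u : U.X) : FPair A (G.1.amb × H.1.amb) :=
  (U.stabPair u).push (incl G H) (incl_injective G H)

/-- The relation on a `(G, H)`-biset whose classes are the `(A, H)`-orbits. -/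
def ahRel {G H : Obj 𝒢} (U : Biset A G H) : Setoid U.X where
  r u v := ∃ (h : H.grp) (a : A), (((1 : G.grp), h), a) • u = v
  iseqv :=
    { refl := fun u => ⟨1, 1, one_smul ((G.grp × H.grp) × A) u⟩
      symm := by
        rintro u _ ⟨h, a, rfl⟩
        refine ⟨h⁻¹, a⁻¹, ?_⟩
        rw [smul_smul]
        refine Eq.trans ?_ (one_smul ((G.grp × H.grp) × A) u)
        exact congrArg (· • u) (by ext <;> simp)
      trans := by
        rintro u _ _ ⟨h, a, rfl⟩ ⟨k, b, rfl⟩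
        refine ⟨k * h, b * a, ?_⟩
        rw [smul_smul]
        exact congrArg (· • u) (by ext <;> simp) }

/-- A function choosing a representative of each class. -/
def IsRep {X : Type u} (r : Setoid X) (rep : Quotient r → X) : Prop :=
  ∀ c, Quotient.mk r (rep c) = c

/-- The transitive biset `(G × H)/(D, φ)`. -/
def basic (G H : Obj 𝒢) (P : FPair A (G.1.amb × H.1.amb)) : Biset A G H :=
  FibSet.trans (P.pull (incl G H))

/-- The morphisms from `H` to `G` in the category `𝒞^A(𝒢, 𝒮)`: the `R`-span in `B^A_R(G, H)` of
the classes of `(G × H)/(D, φ)` with `(D, φ) ∈ 𝒮(G, H)`. -/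
def homR (R : Type w) [CommRing R] (S : Family A 𝒢) (G H : Obj 𝒢) :
    Submodule R (BR A (G.grp × H.grp) R) :=
  Submodule.span R {b | ∃ P ∈ S G H, b = cls R (basic G H P)}

/-- An `R`-linear functor from `𝒞^A(𝒢, 𝒮)` to `R`-modules with values `M G` on objects. (Under the
axioms (i)–(iii), `homR` contains the identities and is closed under composition.) -/
structure FibFunctor (S : Family A 𝒢) (R : Type w) [CommRing R] (M : Obj 𝒢 → Type v)
    [∀ G, AddCommGroup (M G)] [∀ G, Module R (M G)] where
  map : ∀ G H : Obj 𝒢, homR R S G H →ₗ[R] M H →ₗ[R] M G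
  map_id : ∀ (G : Obj 𝒢) (h : cls R (basic G G (FPair.diag G.grp)) ∈ homR R S G G),
    map G G ⟨_, h⟩ = LinearMap.id
  map_comp : ∀ (G H K : Obj 𝒢) (a : homR R S G H) (b : homR R S H K)
    (h : compR R a.1 b.1 ∈ homR R S G K), map G K ⟨_, h⟩ = map G H a ∘ₗ map H K b

section Functors

variable {R : Type w} [CommRing R] {S : Family A 𝒢} {M : Obj 𝒢 → Type v}
  [∀ G, AddCommGroup (M G)] [∀ G, Module R (M G)] (F : FibFunctor S R M)

open Classical in
/-- `F([(G × H)/(D, φ)]) : F(H) → F(G)`; only used when the class is a morphism of the category. -/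
def FibFunctor.ev (G H : Obj 𝒢) (P : FPair A (G.1.amb × H.1.amb)) : M H →ₗ[R] M G :=
  if h : cls R (basic G H P) ∈ homR R S G H then F.map G H ⟨_, h⟩ else 0

/-! ### The lower plus construction -/

/-- All stabilizers `G_x` lie in `𝒢`. -/
def StabMem {G : Obj 𝒢} (X : GSet A G) : Prop := ∀ x, G.Mem (setPair X x).dom

/-- The `R`-module of `(G, A)`-equivariant sections of `F` over `X`: `s(x) ∈ F(G_x)` with
`^g s(x) = s(gax)`, where `^g` is induced by the conjugation isomorphism from `G_x` to `G_{gax}`. -/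
def Sec {G : Obj 𝒢} (X : GSet A G) (hX : StabMem X) :
    Submodule R (∀ x : X.X, M (G.sub (setPair X x).dom (hX x))) where
  carrier := {s | ∀ (g : G.grp) (a : A) (x : X.X),
    F.ev (G.sub _ (hX ((g, a) • x))) (G.sub _ (hX x))
      ((FPair.diag (setPair X x).dom).conj ((g : G.1.amb), 1)) (s x) = s ((g, a) • x)}
  zero_mem' g a x := map_zero _
  add_mem' hs ht g a x := by
    rw [Pi.add_apply, Pi.add_apply, map_add, hs, ht]
  smul_mem' r s hs g a x := by
    rw [Pi.smul_apply, Pi.smul_apply, map_smul, hs]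

/-- The objects `(X, s)` of `Γ_F(G)`. -/
structure SecObj (G : Obj 𝒢) where
  X : GSet A G
  mem : StabMem X
  s : Sec F X mem

variable {F}

/-- The object `G_x` of the category. -/
abbrev SecObj.stabObj {G : Obj 𝒢} (X : SecObj F G) (x : X.X.X) : Obj 𝒢 := G.sub _ (X.mem x)

/-- `(X, r s)`. -/
def SecObj.scale {G : Obj 𝒢} (r : R) (X : SecObj F G) : SecObj F G := ⟨X.X, X.mem, r • X.s⟩

/-- The morphisms `(X, s) → (Y, t)` of `Γ_F(G)`: equivariant maps `f` with `G_x = G_{f(x)}` and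
`t(f(x)) = s(x)`. -/
def SecObj.IsHom {G : Obj 𝒢} (X Y : SecObj F G) (f : X.X.X → Y.X.X) : Prop :=
  Equivariant A G.grp f ∧ ∀ x, ∃ h : X.stabObj x = Y.stabObj (f x),
    cast (congrArg M h) (X.s.1 x) = Y.s.1 (f x)

theorem cast_smul {G H : Obj 𝒢} (h : G = H) (r : R) (m : M G) :
    cast (congrArg M h) (r • m) = r • cast (congrArg M h) m := by
  subst h; rfl

theorem SecObj.IsHom.scale {G : Obj 𝒢} {X Y : SecObj F G} {f : X.X.X → Y.X.X}
    (h : X.IsHom Y f) (r : R) : (X.scale r).IsHom (Y.scale r) f :=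
  ⟨h.1, fun x => by
    obtain ⟨e, he⟩ := h.2 x
    refine ⟨e, ?_⟩
    refine (cast_smul e r (X.s.1 x)).trans ?_
    rw [he]
    rfl⟩

/-- `(X, s) ≅ (Y, t)` in `Γ_F(G)`. -/
def SecObj.Iso {G : Obj 𝒢} (X Y : SecObj F G) : Prop :=
  ∃ f : X.X.X → Y.X.X, X.IsHom Y f ∧ Function.Bijective f

/-- `Z` is the disjoint union of `X` and `Y`, with the given sections on `X` and on `Y`. -/
def SecObj.IsCoprod {G : Obj 𝒢} (X Y Z : SecObj F G) : Prop :=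
  ∃ (i : X.X.X → Z.X.X) (j : Y.X.X → Z.X.X), X.IsHom Z i ∧ Y.IsHom Z j ∧
    Function.Bijective (Sum.elim i j)

variable (F)

/-- The isomorphism classes `{X, s}` of objects of `Γ_F(G)`. -/
def SecClass (G : Obj 𝒢) := Quot (SecObj.Iso (F := F) (G := G))

variable {F}

/-- The element `{X, s}` of the free abelian group on isomorphism classes. -/
def SecObj.gen {G : Obj 𝒢} (X : SecObj F G) : FreeAbelianGroup (SecClass F G) :=
  FreeAbelianGroup.of (Quot.mk _ X)

variable (F)

/-- The relations `{X ⊔ Y, s ⊔ t} - {X, s} - {Y, t}` and `{X, s + r} - {X, s} - {X, r}`. -/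
def lowerRel (G : Obj 𝒢) : AddSubgroup (FreeAbelianGroup (SecClass F G)) :=
  AddSubgroup.closure
    ({z | ∃ X Y Z : SecObj F G, X.IsCoprod Y Z ∧ z = Z.gen - X.gen - Y.gen} ∪
     {z | ∃ (X : GSet A G) (hX : StabMem X) (s r : Sec F X hX),
       z = SecObj.gen ⟨X, hX, s + r⟩ - SecObj.gen ⟨X, hX, s⟩ - SecObj.gen ⟨X, hX, r⟩})

/-- `F₊(G)`. -/
def LowerPlus (G : Obj 𝒢) := FreeAbelianGroup (SecClass F G) ⧸ lowerRel F G

instance (G : Obj 𝒢) : AddCommGroup (LowerPlus F G) :=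
  inferInstanceAs (AddCommGroup (FreeAbelianGroup (SecClass F G) ⧸ lowerRel F G))

variable {F}

/-- The class `[X, s]_G` in `F₊(G)`. -/
def SecObj.cl {G : Obj 𝒢} (X : SecObj F G) : LowerPlus F G := QuotientAddGroup.mk X.gen

variable (F)

/-- The action of `r ∈ R` on the free abelian group, `{X, s} ↦ {X, r s}`. -/
def scaleFree (G : Obj 𝒢) (r : R) :
    FreeAbelianGroup (SecClass F G) →+ FreeAbelianGroup (SecClass F G) :=
  FreeAbelianGroup.map (α := SecClass F G) (β := SecClass F G) (Quot.map (SecObj.scale r) (by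
    rintro X Y ⟨f, hf, hb⟩
    exact ⟨f, hf.scale r, hb⟩))

variable {F}

theorem scaleFree_gen {G : Obj 𝒢} (r : R) (X : SecObj F G) :
    scaleFree F G r X.gen = (X.scale r).gen :=
  FreeAbelianGroup.map_of_apply (α := SecClass F G) (β := SecClass F G) _

variable (F)

theorem lowerRel_le (G : Obj 𝒢) (r : R) :
    lowerRel F G ≤ (lowerRel F G).comap (scaleFree F G r) := by
  refine (AddSubgroup.closure_le _).mpr ?_
  rintro z (⟨X, Y, Z, ⟨i, j, hi, hj, hb⟩, rfl⟩ | ⟨X, hX, s, t, rfl⟩)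
  · refine AddSubgroup.subset_closure (Or.inl ⟨X.scale r, Y.scale r, Z.scale r,
      ⟨i, j, hi.scale r, hj.scale r, hb⟩, ?_⟩)
    rw [map_sub, map_sub, scaleFree_gen, scaleFree_gen, scaleFree_gen]
  · refine AddSubgroup.subset_closure (Or.inr ⟨X, hX, r • s, r • t, ?_⟩)
    rw [map_sub, map_sub, scaleFree_gen, scaleFree_gen, scaleFree_gen, ← smul_add]
    rfl

/-- The action of `r ∈ R` on `F₊(G)`, `[X, s] ↦ [X, r s]`. -/
def scalePlus (G : Obj 𝒢) (r : R) : LowerPlus F G →+ LowerPlus F G :=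
  QuotientAddGroup.map _ _ (scaleFree F G r) (lowerRel_le F G r)

variable {F}

theorem scalePlus_cl {G : Obj 𝒢} (r : R) (X : SecObj F G) :
    scalePlus F G r X.cl = (X.scale r).cl :=
  congrArg QuotientAddGroup.mk (scaleFree_gen r X)

theorem cl_add {G : Obj 𝒢} (X : GSet A G) (hX : StabMem X) (s t : Sec F X hX) :
    SecObj.cl (F := F) ⟨X, hX, s + t⟩ = SecObj.cl (F := F) ⟨X, hX, s⟩ + SecObj.cl ⟨X, hX, t⟩ := by
  rw [← sub_eq_iff_eq_add', ← sub_eq_zero]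
  refine (QuotientAddGroup.eq_zero_iff _).mpr ?_
  exact AddSubgroup.subset_closure (Or.inr ⟨X, hX, s, t, rfl⟩)

theorem lowerPlus_hom_ext {G : Obj 𝒢} {B : Type*} [AddCommGroup B] {f g : LowerPlus F G →+ B}
    (h : ∀ X : SecObj F G, f X.cl = g X.cl) : f = g := by
  refine QuotientAddGroup.addMonoidHom_ext _ (FreeAbelianGroup.lift_ext _ _ ?_)
  rintro ⟨X⟩
  exact h X

/-- `F₊(G)` is an `R`-module with `r [X, s] = [X, r s]`. -/
instance (G : Obj 𝒢) : Module R (LowerPlus F G) where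
  smul r z := scalePlus F G r z
  one_smul z := by
    refine DFunLike.congr_fun (f := scalePlus F G 1) (g := AddMonoidHom.id _)
      (lowerPlus_hom_ext fun X => ?_) z
    rw [scalePlus_cl, SecObj.scale, one_smul]
    rfl
  mul_smul r t z := by
    refine DFunLike.congr_fun (f := scalePlus F G (r * t))
      (g := (scalePlus F G r).comp (scalePlus F G t)) (lowerPlus_hom_ext fun X => ?_) z
    rw [AddMonoidHom.comp_apply, scalePlus_cl, scalePlus_cl, scalePlus_cl, SecObj.scale, mul_smul]
    rfl
  smul_zero r := map_zero (scalePlus F G r)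
  smul_add r := map_add (scalePlus F G r)
  add_smul r t z := by
    refine DFunLike.congr_fun (f := scalePlus F G (r + t))
      (g := scalePlus F G r + scalePlus F G t) (lowerPlus_hom_ext fun X => ?_) z
    rw [AddMonoidHom.add_apply, scalePlus_cl, scalePlus_cl, scalePlus_cl, SecObj.scale, add_smul]
    exact cl_add X.X X.mem _ _
  zero_smul z := by
    refine DFunLike.congr_fun (f := scalePlus F G 0) (g := 0) (lowerPlus_hom_ext fun X => ?_) z
    have h := cl_add X.X X.mem ((0 : R) • X.s) ((0 : R) • X.s)
    rw [← add_smul, add_zero] at h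
    rw [scalePlus_cl]
    exact left_eq_add.mp h

/-- The point `u ⊗ x` of `U ⊗_{AH} X`, for a pair `(u, x)` whose orbit is `A`-free. -/
def point {G H : Obj 𝒢} (U : Biset A G H) (X : GSet A H) (u : U.X) (x : X.X)
    (h : AFree A H.grp G.grp (pureOrb U X u x)) : (tensorLeft U X).X :=
  ⟨pureOrb U X u x, h⟩

variable (F)

/-- `Fp` is the functor `F₊`: for an `A`-fibered `(G, H)`-biset `U` with stabilizing pairs in
`𝒮₊(G, H)` the map `F₊([U]) : F₊(H) → F₊(G)` sends `[X, s]` to `[U ⊗_{AH} X, U(s)]`, where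
`U(s)(u ⊗ x) = F([(G_{u⊗x} × H_x)/(((G × H)_u, φ_u) ∗ (Δ(H_x), 1))])(s(x))`. -/
def IsLowerPlus (Fp : FibFunctor (lower S) R (LowerPlus F)) : Prop :=
  ∀ (G H : Obj 𝒢) (U : Biset A G H), (∀ u, bisetPair U u ∈ lower S G H) →
    ∃ hU : cls R U ∈ homR R (lower S) G H, ∀ X : SecObj F H,
      ∃ (hm : StabMem (tensorLeft U X.X)) (t : Sec F (tensorLeft U X.X) hm),
        (∀ (u : U.X) (x : X.X.X) (h : AFree A H.grp G.grp (pureOrb U X.X u x)),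
          t.1 (point U X.X u x h) =
            F.ev (G.sub _ (hm (point U X.X u x h))) (X.stabObj x)
              ((bisetPair U u).resRight (setPair X.X x).dom) (X.s.1 x)) ∧
        Fp.map G H ⟨cls R U, hU⟩ X.cl = SecObj.cl ⟨tensorLeft U X.X, hm, t⟩

/-! ### The upper plus construction -/

variable (A) in
/-- The elements `(K, κ)` of `ℳ'(G)`: `K ≤ G` with `K ∈ 𝒢`, and `κ ∈ Hom(K, A)`. -/
structure MPair (G : Obj 𝒢) where
  pair : FPair A G.1.amb
  le : pair.dom ≤ G.grp
  mem : G.Mem pair.dom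

/-- The object `K` for `(K, κ) ∈ ℳ'(G)`. -/
abbrev MPair.obj {G : Obj 𝒢} (κ : MPair A G) : Obj 𝒢 := G.sub κ.pair.dom κ.mem

/-- `F⁺(G)`: the families `(x_{(K, κ)})` in `⨁_{(K, κ) ∈ ℳ'(G)} F(K)` with
`^g x_{(K, κ)} = x_{^g(K, κ)}` for all `g ∈ G`. -/
def UpperPlus (G : Obj 𝒢) : Submodule R (⨁ κ : MPair A G, M κ.obj) where
  carrier := {x | ∀ (g : G.grp) (κ μ : MPair A G), μ.pair = κ.pair.conj (g : G.1.amb) →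
    F.ev μ.obj κ.obj ((FPair.diag κ.pair.dom).conj ((g : G.1.amb), 1)) (x κ) = x μ}
  zero_mem' g κ μ _ := map_zero _
  add_mem' hx hy g κ μ h := by
    rw [DirectSum.add_apply, DirectSum.add_apply, map_add, hx g κ μ h, hy g κ μ h]
  smul_mem' r x hx g κ μ h := by
    rw [DirectSum.smul_apply, DirectSum.smul_apply, map_smul, hx g κ μ h]

/-- The conditions under which `(K^u, λ)` contributes to the `(K, α)`-component of the image under
`F⁺([U])`, for `κ = (K, α) ∈ ℳ'(G)` and `μ = (L, λ) ∈ ℳ'(H)`: `K ≤ p₁((G × H)_u)`,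
`L = K^u = K ∗ (G × H)_u`, `φ_{u,2} = λ` on `k₂((G × H)_u) ∩ K^u`, and `φ_u ∗ λ = α` on `K`. -/
def Contributes {G H : Obj 𝒢} (U : Biset A G H) (u : U.X) (κ : MPair A G) (μ : MPair A H) : Prop :=
  κ.pair.dom ≤ p1 (bisetPair U u).dom ∧
  μ.pair.dom = starLeft κ.pair.dom (bisetPair U u).dom ∧
  (∀ (h : H.1.amb) (hu : (1, h) ∈ (bisetPair U u).dom) (hμ : h ∈ μ.pair.dom),
    ((bisetPair U u).char ⟨(1, h), hu⟩)⁻¹ = μ.pair.char ⟨h, hμ⟩) ∧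
  (∀ (k : G.1.amb) (h : H.1.amb) (hk : k ∈ κ.pair.dom) (hu : (k, h) ∈ (bisetPair U u).dom)
    (hμ : h ∈ μ.pair.dom),
    (bisetPair U u).char ⟨(k, h), hu⟩ * μ.pair.char ⟨h, hμ⟩ = κ.pair.char ⟨k, hk⟩)

open Classical in
/-- `Fu` is the functor `F⁺`: for an `A`-fibered `(G, H)`-biset `U` with stabilizing pairs in
`𝒮⁺(G, H)` the map `F⁺([U]) : F⁺(H) → F⁺(G)` sends `(x_{(L, λ)})` to `(y_{(K, α)})`, where
`y_{(K, α)}` is the sum of `F([(K × K^u)/((K × H)_u, φ_u)])(x_{(K^u, λ)})` over the `u` in a set of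
representatives of the `(A, H)`-orbits of `U` and the `λ` such that `(K^u, λ)` contributes; here
`((K × H)_u, φ_u) = (Δ(K), 1) ∗ ((G × H)_u, φ_u)`. -/
def IsUpperPlus (Fu : FibFunctor (upper S) R (fun G => UpperPlus F G)) : Prop :=
  ∀ (G H : Obj 𝒢) (U : Biset A G H), (∀ u, bisetPair U u ∈ upper S G H) →
    ∃ hU : cls R U ∈ homR R (upper S) G H,
      ∀ rep : Quotient (ahRel U) → U.X, IsRep (ahRel U) rep →
        ∀ (x : UpperPlus F H) (κ : MPair A G),
          (Fu.map G H ⟨cls R U, hU⟩ x).1 κ =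
            ∑ᶠ (c : Quotient (ahRel U)) (μ : MPair A H),
              if Contributes U (rep c) κ μ then
                F.ev κ.obj μ.obj (FPair.resLeft κ.pair.dom (bisetPair (G := G) (H := H) U (rep c))) (x.1 μ)
              else 0

/-! ### The mark morphism -/

open Classical in
/-- `m` is the family of mark maps `m_{F,G} : F₊(G) → F⁺(G)`: the `(L, λ)`-component of the image
of `[X, s]` is the sum of `F(Res^{G_x}_L)(s(x))` over the `x` in a set of representatives of the
`A`-orbits of `X` with `(L, λ) ≤ (G_x, φ_x)`. -/
def IsMark (m : ∀ G : Obj 𝒢, LowerPlus F G →ₗ[R] UpperPlus F G) : Prop :=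
  ∀ (G : Obj 𝒢) (X : SecObj F G) (rep : X.X.Orb → X.X.X), IsRep (aRel A G.grp X.X.X) rep →
    ∀ κ : MPair A G,
      (m G X.cl).1 κ =
        ∑ᶠ c : X.X.Orb,
          if κ.pair ≤ setPair X.X (rep c) then
            F.ev κ.obj (X.stabObj (rep c)) (FPair.diag κ.pair.dom) (X.s.1 (rep c))
          else 0

end Functors

end Data

end

end Fibered

/-! The condition k₂(D) = 1 makes every biset U that occurs right free: H acts freely on its
A-orbits, hence H × A acts freely on U (`RFree`). Three things follow. Every (H × A)-orbit on U × X
is A-free, so nothing is discarded in U ⊗_{AH} X, and its A-orbits correspond to pairs of an (A,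
H)-orbit of U and an A-orbit of X (`bijective_tensorLeft_orbits`). The compatibility needed to form
P ∗ P' is automatic. And the stabilizer (G × H)_u is the graph of a map from its first projection to
H, which makes the calculus of the pairs (K^u, λ) rigid: for given u and (K, α) at most one of them
contributes to F⁺([U]) (`Contributes.unique`).

F is evaluated only at transitive bisets whose pair P lies in 𝒮(G, H) and projects onto G (`Adm`).
For such pairs the Mackey formula has a single double coset, so F([P]) ∘ F([P']) = F([P ∗ P'])
(`Axioms.mk_tensor_basic`, `ev_star`). Every identity between values of F thereby becomes an
identity between pairs, and this is checked on their graphs in Q × A.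

Commutation with U is a comparison of (K, α)-components at [X, s]. Write P_u for the stabilizing
pair of u. That of u ⊗ x is P_u ∗ (H_x, φ_x), and (K, α) lies below it exactly when some
contributing μ lies below (H_x, φ_x) (`exists_contributes_le_iff`, `le_tensor_iff`). In that case
both sides contribute the value at s(x) of F at P_u restricted to K on the left (`markTerm_tensor`);
otherwise both contribute zero. Summing over the product of the two orbit sets gives
`markMap_lowerMap`.

For well-definedness, `Axioms.exists_functor` reduces the construction of a functor to linear maps
attached to bisets that are additive on disjoint unions, trivial on the identity biset and
compatible with tensor products. For F₊ the last point is associativity of the tensor product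
(`RFree.exists_assoc`); for F⁺ it is the composition law for contributing pairs
(`contributes_tensor_iff`). As Hom(K, A) may be infinite, the values in F⁺(G) need an argument for
finite support (`finite_mPair`). Uniqueness holds because classes of bisets span the morphisms and
the classes [X, s] generate F₊(G). -/

namespace Fibered

/-! ### Calculus of pairs through their graphs in Q × A. -/

namespace FPair

variable {A Q Q₁ Q₂ Q₃ : Type u} [CommGroup A] [Group Q] [Group Q₁] [Group Q₂] [Group Q₃]

/-- `P.Rel q a` says that `q` lies in the domain of `P` and that its character takes the value `a`
at `q`. -/
def Rel (P : FPair A Q) (q : Q) (a : A) : Prop := ∃ h : q ∈ P.dom, P.char ⟨q, h⟩ = a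

theorem Rel.mem {P : FPair A Q} {q : Q} {a : A} (h : P.Rel q a) : q ∈ P.dom := h.1

theorem rel_char (P : FPair A Q) {q : Q} (h : q ∈ P.dom) : P.Rel q (P.char ⟨q, h⟩) := ⟨h, rfl⟩

theorem exists_rel {P : FPair A Q} {q : Q} (h : q ∈ P.dom) : ∃ a, P.Rel q a := ⟨_, h, rfl⟩

theorem Rel.unique {P : FPair A Q} {q : Q} {a b : A} (h : P.Rel q a) (h' : P.Rel q b) : a = b := by
  obtain ⟨_, rfl⟩ := h
  obtain ⟨_, rfl⟩ := h'
  rfl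

theorem rel_one (P : FPair A Q) : P.Rel 1 1 := ⟨P.dom.one_mem, map_one P.char⟩

theorem Rel.mul {P : FPair A Q} {q r : Q} {a b : A} (h : P.Rel q a) (h' : P.Rel r b) :
    P.Rel (q * r) (a * b) := by
  obtain ⟨h, rfl⟩ := h
  obtain ⟨h', rfl⟩ := h'
  exact ⟨P.dom.mul_mem h h', map_mul P.char ⟨q, h⟩ ⟨r, h'⟩⟩

theorem Rel.inv {P : FPair A Q} {q : Q} {a : A} (h : P.Rel q a) : P.Rel q⁻¹ a⁻¹ := by
  obtain ⟨h, rfl⟩ := h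
  exact ⟨P.dom.inv_mem h, map_inv P.char ⟨q, h⟩⟩

/-- Domain and character are both recovered from the graph. Characters on two subgroups that are
only provably equal can thus be compared without transport. -/
theorem ext_rel {P P' : FPair A Q} (h : ∀ q a, P.Rel q a ↔ P'.Rel q a) : P = P' := by
  obtain ⟨D, φ⟩ := P
  obtain ⟨D', φ'⟩ := P'
  obtain rfl : D = D' := by
    ext q
    exact ⟨fun hq => ((h q _).mp ⟨hq, rfl⟩).1, fun hq => ((h q _).mpr ⟨hq, rfl⟩).1⟩
  congr 1
  ext ⟨q, hq⟩
  obtain ⟨_, e⟩ := (h q _).mp ⟨hq, rfl⟩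
  exact e.symm

theorem le_iff_rel {P P' : FPair A Q} : P ≤ P' ↔ ∀ q a, P.Rel q a → P'.Rel q a := by
  constructor
  · rintro ⟨h, h'⟩ q _ ⟨hq, rfl⟩
    exact ⟨h hq, (h' ⟨q, hq⟩).symm⟩
  · intro h
    refine ⟨fun q hq => (h q _ ⟨hq, rfl⟩).1, fun q => ?_⟩
    obtain ⟨_, e⟩ := h q _ ⟨q.2, rfl⟩
    exact e.symm

theorem eq_of_le_of_dom {P P' : FPair A Q} (h : P ≤ P') (hd : P'.dom ≤ P.dom) : P = P' := by
  rw [le_iff_rel] at h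
  refine ext_rel fun q a => ⟨h q a, fun hq => ?_⟩
  obtain ⟨b, hb⟩ := exists_rel (hd hq.mem)
  rwa [hq.unique (h _ _ hb)]

theorem rel_push {f : Q₁ →* Q₂} {hf : Function.Injective f} {P : FPair A Q₁} {y : Q₂} {a : A} :
    (P.push f hf).Rel y a ↔ ∃ x, f x = y ∧ P.Rel x a := by
  constructor
  · rintro ⟨⟨x, hx, rfl⟩, rfl⟩
    refine ⟨x, rfl, hx, ?_⟩
    refine congrArg P.char ?_
    symm
    apply (MulEquiv.symm_apply_eq (P.dom.equivMapOfInjective f hf)).mpr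
    exact Subtype.ext rfl
  · rintro ⟨x, rfl, hx, rfl⟩
    refine ⟨⟨x, hx, rfl⟩, ?_⟩
    refine congrArg P.char ?_
    apply (MulEquiv.symm_apply_eq (P.dom.equivMapOfInjective f hf)).mpr
    exact Subtype.ext rfl

theorem rel_pull {f : Q₁ →* Q₂} {P : FPair A Q₂} {x : Q₁} {a : A} :
    (P.pull f).Rel x a ↔ P.Rel (f x) a := Iff.rfl

theorem pull_push (f : Q₁ →* Q₂) (hf : Function.Injective f) (P : FPair A Q₁) :
    (P.push f hf).pull f = P := by
  refine ext_rel fun q a => ?_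
  rw [rel_pull, rel_push]
  exact ⟨fun ⟨x, e, h⟩ => hf e ▸ h, fun h => ⟨q, rfl, h⟩⟩

theorem rel_conj {P : FPair A Q} {g q : Q} {a : A} :
    (P.conj g).Rel q a ↔ P.Rel (g⁻¹ * q * g) a := by
  refine rel_push.trans ⟨?_, fun h => ⟨_, ?_, h⟩⟩
  · rintro ⟨x, rfl, h⟩
    simpa [mul_assoc] using h
  · simp [mul_assoc]

/-- By `Compat.indep` the value does not depend on the middle element chosen in `star`, so any
witness may be used. -/
theorem rel_star {P : FPair A (Q₁ × Q₂)} {P' : FPair A (Q₂ × Q₃)} {hc : P.Compat P'}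
    {x : Q₁ × Q₃} {a : A} :
    (P.star P' hc).Rel x a ↔ ∃ h b c, P.Rel (x.1, h) b ∧ P'.Rel (h, x.2) c ∧ b * c = a := by
  constructor
  · rintro ⟨hx, rfl⟩
    exact ⟨_, _, _, ⟨(exists_mid ⟨x, hx⟩).choose_spec.1, rfl⟩,
      ⟨(exists_mid ⟨x, hx⟩).choose_spec.2, rfl⟩, rfl⟩
  · rintro ⟨h, _, _, ⟨h₁, rfl⟩, ⟨h₂, rfl⟩, rfl⟩
    exact ⟨⟨h, h₁, h₂⟩, hc.indep _ _ h₁ h₂⟩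

theorem rel_diag {K : Subgroup Q} {x : Q × Q} {a : A} :
    (diag K : FPair A (Q × Q)).Rel x a ↔ x.1 = x.2 ∧ x.1 ∈ K ∧ a = 1 := by
  constructor
  · rintro ⟨⟨k, hk, rfl⟩, rfl⟩
    exact ⟨rfl, hk, rfl⟩
  · obtain ⟨x, y⟩ := x
    rintro ⟨h, hx, rfl⟩
    obtain rfl : x = y := h
    exact ⟨⟨x, hx, rfl⟩, rfl⟩

theorem rel_resRight {P : FPair A (Q₁ × Q₂)} {K : Subgroup Q₂} {x : Q₁ × Q₂} {a : A} :
    (P.resRight K).Rel x a ↔ P.Rel x a ∧ x.2 ∈ K := by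
  obtain ⟨x, y⟩ := x
  refine rel_star.trans ?_
  simp only [rel_diag]
  constructor
  · rintro ⟨h, b, c, hb, ⟨rfl, hK, rfl⟩, rfl⟩
    exact ⟨by simpa using hb, hK⟩
  · rintro ⟨h, hK⟩
    exact ⟨y, a, 1, h, ⟨rfl, hK, rfl⟩, mul_one a⟩

theorem rel_resLeft {P : FPair A (Q₁ × Q₂)} {K : Subgroup Q₁} {x : Q₁ × Q₂} {a : A} :
    (resLeft K P).Rel x a ↔ P.Rel x a ∧ x.1 ∈ K := by
  obtain ⟨x, y⟩ := x
  refine rel_star.trans ?_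
  simp only [rel_diag]
  constructor
  · rintro ⟨h, b, c, ⟨e, hK, rfl⟩, hb, rfl⟩
    obtain rfl : x = h := e
    exact ⟨by simpa using hb, hK⟩
  · rintro ⟨h, hK⟩
    exact ⟨x, 1, a, ⟨rfl, hK, rfl⟩, h, one_mul a⟩

/-- This pair is the graph of the conjugation isomorphism from K to its conjugate by g, with trivial
character. It is the form in which the action of g enters both constructions. -/
theorem rel_diag_conj {K : Subgroup Q} {g : Q} {x : Q × Q} {a : A} :
    ((diag K : FPair A (Q × Q)).conj (g, 1)).Rel x a ↔ x.1 = g * x.2 * g⁻¹ ∧ x.2 ∈ K ∧ a = 1 := by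
  rw [rel_conj, rel_diag]
  obtain ⟨x, y⟩ := x
  simp only [Prod.fst_mul, Prod.snd_mul, Prod.fst_inv, Prod.snd_inv, inv_one, one_mul, mul_one]
  constructor
  · rintro ⟨e, h, rfl⟩
    exact ⟨by rw [← e]; group, e ▸ h, rfl⟩
  · rintro ⟨rfl, h, rfl⟩
    have e : g⁻¹ * (g * y * g⁻¹) * g = y := by group
    exact ⟨e, by rwa [e], rfl⟩

/-- The restriction of a pair to a subgroup. -/
def restrict (P : FPair A Q) (K : Subgroup Q) (h : K ≤ P.dom) : FPair A Q :=
  ⟨K, P.char.comp (Subgroup.inclusion h)⟩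

theorem rel_restrict {P : FPair A Q} {K : Subgroup Q} {h : K ≤ P.dom} {q : Q} {a : A} :
    (P.restrict K h).Rel q a ↔ P.Rel q a ∧ q ∈ K :=
  ⟨fun ⟨hq, e⟩ => ⟨⟨h hq, e⟩, hq⟩, fun ⟨⟨_, e⟩, hq⟩ => ⟨hq, e⟩⟩

/-- The pair whose graph is a given subgroup of `Q × A` that meets `A` trivially. -/
noncomputable def ofGraph (T : Subgroup (Q × A)) (hT : ∀ a, ((1 : Q), a) ∈ T → a = 1) :
    FPair A Q where
  dom := T.map (MonoidHom.fst Q A)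
  char :=
    have ex : ∀ q : T.map (MonoidHom.fst Q A), ∃ a, ((q : Q), a) ∈ T := by
      rintro ⟨_, ⟨q, a⟩, h, rfl⟩
      exact ⟨a, h⟩
    have un : ∀ (q : Q) (a b : A), (q, a) ∈ T → (q, b) ∈ T → a = b := fun q a b ha hb => by
      have := hT (a * b⁻¹) (by simpa using T.mul_mem ha (T.inv_mem hb))
      exact mul_inv_eq_one.mp this
    { toFun := fun q => (ex q).choose
      map_one' := un _ _ _ (ex 1).choose_spec T.one_mem
      map_mul' := fun q r => un _ _ _ (ex (q * r)).choose_spec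
        (T.mul_mem (ex q).choose_spec (ex r).choose_spec) }

theorem rel_ofGraph {T : Subgroup (Q × A)} {hT : ∀ a, ((1 : Q), a) ∈ T → a = 1} {q : Q} {a : A} :
    (ofGraph T hT).Rel q a ↔ (q, a) ∈ T := by
  have un : ∀ (q : Q) (a b : A), (q, a) ∈ T → (q, b) ∈ T → a = b := fun q a b ha hb => by
    have := hT (a * b⁻¹) (by simpa using T.mul_mem ha (T.inv_mem hb))
    exact mul_inv_eq_one.mp this
  have ex : ∀ q : T.map (MonoidHom.fst Q A), ∃ a, ((q : Q), a) ∈ T := by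
    rintro ⟨_, ⟨q, a⟩, h, rfl⟩
    exact ⟨a, h⟩
  constructor
  · rintro ⟨h, rfl⟩
    exact (ex ⟨q, h⟩).choose_spec
  · intro h
    exact ⟨⟨_, h, rfl⟩, un _ _ _ (ex ⟨q, ⟨_, h, rfl⟩⟩).choose_spec h⟩

/-- The pair `P ∗ κ`, for `P` such that `k₂(P)` is trivial. -/
noncomputable def act (P : FPair A (Q₁ × Q₂)) (hP : ∀ h, (1, h) ∈ P.dom → h = 1) (κ : FPair A Q₂) :
    FPair A Q₁ :=
  ofGraph
    { carrier := {x | ∃ h b c, P.Rel (x.1, h) b ∧ κ.Rel h c ∧ b * c = x.2}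
      one_mem' := ⟨1, 1, 1, P.rel_one, κ.rel_one, mul_one 1⟩
      mul_mem' := by
        rintro x y ⟨h, b, c, h₁, h₂, e⟩ ⟨h', b', c', h₁', h₂', e'⟩
        exact ⟨h * h', b * b', c * c', h₁.mul h₁', h₂.mul h₂', by
          rw [mul_mul_mul_comm, e, e']; rfl⟩
      inv_mem' := by
        rintro x ⟨h, b, c, h₁, h₂, e⟩
        exact ⟨h⁻¹, b⁻¹, c⁻¹, h₁.inv, h₂.inv, by rw [← mul_inv, e]; rfl⟩ }
    (by
      -- Over 1 the middle element lies in k₂(P), hence is 1, and both characters take the value 1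
      -- there.
      rintro _ ⟨h, b, c, h₁, h₂, rfl⟩
      obtain rfl := hP h h₁.mem
      rw [h₁.unique P.rel_one, h₂.unique κ.rel_one, mul_one])

theorem rel_act {P : FPair A (Q₁ × Q₂)} {hP : ∀ h, (1, h) ∈ P.dom → h = 1} {κ : FPair A Q₂}
    {q : Q₁} {a : A} :
    (P.act hP κ).Rel q a ↔ ∃ h b c, P.Rel (q, h) b ∧ κ.Rel h c ∧ b * c = a :=
  rel_ofGraph

theorem mem_dom_iff {P : FPair A Q} {q : Q} : q ∈ P.dom ↔ ∃ a, P.Rel q a :=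
  ⟨exists_rel, fun ⟨_, h⟩ => h.mem⟩

end FPair

section Subgroups

variable {Q₁ Q₂ : Type u} [Group Q₁] [Group Q₂]

theorem mem_p1 {D : Subgroup (Q₁ × Q₂)} {g : Q₁} : g ∈ p1 D ↔ ∃ h, (g, h) ∈ D := by
  constructor
  · rintro ⟨⟨g, h⟩, hD, rfl⟩
    exact ⟨h, hD⟩
  · rintro ⟨h, hD⟩
    exact ⟨_, hD, rfl⟩

theorem mem_p2 {D : Subgroup (Q₁ × Q₂)} {h : Q₂} : h ∈ p2 D ↔ ∃ g, (g, h) ∈ D := by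
  constructor
  · rintro ⟨⟨g, h⟩, hD, rfl⟩
    exact ⟨g, hD⟩
  · rintro ⟨h, hD⟩
    exact ⟨_, hD, rfl⟩

theorem mem_starRight {D : Subgroup (Q₁ × Q₂)} {K : Subgroup Q₂} {g : Q₁} :
    g ∈ starRight D K ↔ ∃ k ∈ K, (g, k) ∈ D := Iff.rfl

end Subgroups

theorem one_mk_one_smul {A Q Y : Type*} [Monoid A] [Monoid Q] [MulAction (Q × A) Y] (y : Y) :
    ((1 : Q), (1 : A)) • y = y := one_smul (Q × A) y

/-! ### Stabilizing pairs, fibered subsets and transitive fibered sets. -/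

namespace FibSet

variable {A Q : Type u} [CommGroup A] [Group Q]

theorem rel_stabPair {X : FibSet A Q} {x : X.X} {q : Q} {a : A} :
    (X.stabPair x).Rel q a ↔ (q, (1 : A)) • x = ((1 : Q), a) • x := by
  constructor
  · rintro ⟨h, rfl⟩
    exact X.weight_spec x ⟨q, h⟩
  · intro h
    exact ⟨⟨a, h⟩, X.free _ _ x ((X.weight_spec x ⟨q, a, h⟩).symm.trans h)⟩

theorem rel_stabPair_of_smul_eq {X : FibSet A Q} {x : X.X} {q : Q} {a b : A}
    (h : (q, b) • x = ((1 : Q), a) • x) : (X.stabPair x).Rel q (a * b⁻¹) := by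
  rw [rel_stabPair]
  have := congrArg (fun y => ((1 : Q), b⁻¹) • y) h
  simpa [smul_smul, mul_comm] using this

theorem smul_eq_of_rel {X : FibSet A Q} {x : X.X} {q : Q} {a : A}
    (h : (X.stabPair x).Rel q a) (b : A) : (q, b) • x = ((1 : Q), a * b) • x := by
  have := congrArg (fun y => ((1 : Q), b) • y) (rel_stabPair.mp h)
  simpa [smul_smul, mul_comm] using this

theorem stabPair_smul (X : FibSet A Q) (r : Q × A) (x : X.X) :
    X.stabPair (r • x) = (X.stabPair x).conj r.1 := by
  obtain ⟨r, b⟩ := r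
  refine FPair.ext_rel fun q a => ?_
  rw [FPair.rel_conj, rel_stabPair, rel_stabPair]
  constructor
  · intro h
    have := congrArg (fun y => (r⁻¹, b⁻¹) • y) h
    simpa [smul_smul, mul_comm, mul_assoc] using this
  · intro h
    have := congrArg (fun y => (r, b) • y) h
    simpa [smul_smul, mul_comm, mul_assoc] using this

theorem stabPair_le_map {X Y : FibSet A Q} {f : X.X → Y.X} (hf : Equivariant A Q f) (x : X.X) :
    X.stabPair x ≤ Y.stabPair (f x) :=
  FPair.le_iff_rel.mpr fun q a h => by
    rw [rel_stabPair] at h ⊢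
    rw [← hf, h, hf]

theorem stabPair_map {X Y : FibSet A Q} {f : X.X → Y.X} (hf : Equivariant A Q f)
    (hi : Function.Injective f) (x : X.X) : X.stabPair x = Y.stabPair (f x) :=
  FPair.ext_rel fun q a => by
    rw [rel_stabPair, rel_stabPair, ← hf, ← hf, hi.eq_iff]

/-- The fibered subset of the points with a given invariant property. -/
def restrict (X : FibSet A Q) (p : X.X → Prop) (hp : ∀ (q : Q × A) x, p x → p (q • x)) :
    FibSet A Q where
  X := {x : X.X // p x}
  act :=
    { smul := fun q x => ⟨q • x.1, hp q x.1 x.2⟩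
      one_smul := fun x => Subtype.ext (one_smul (Q × A) x.1)
      mul_smul := fun q r x => Subtype.ext (mul_smul q r x.1) }
  free a b x h := X.free a b x.1 (congrArg Subtype.val h)
  fin := by
    let _ : MulAction (Q × A) {x : X.X // p x} :=
      { smul := fun q x => ⟨q • x.1, hp q x.1 x.2⟩
        one_smul := fun x => Subtype.ext (one_smul (Q × A) x.1)
        mul_smul := fun q r x => Subtype.ext (mul_smul q r x.1) }
    have := X.fin
    refine Finite.of_injective
      (Quotient.map' (s₂ := aRel A Q X.X) Subtype.val ?_ :
        Quotient (aRel A Q {x : X.X // p x}) → X.Orb) ?_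
    · rintro x _ ⟨a, rfl⟩
      exact ⟨a, rfl⟩
    · rintro ⟨x⟩ ⟨y⟩ h
      obtain ⟨a, ha⟩ := Quotient.exact h
      exact Quotient.sound ⟨a, Subtype.ext ha⟩

/-- The inclusion of a fibered subset. -/
def restrictVal (X : FibSet A Q) (p : X.X → Prop) (hp : ∀ (q : Q × A) x, p x → p (q • x))
    (x : (X.restrict p hp).X) : X.X := x.1

theorem restrict_equivariant (X : FibSet A Q) (p : X.X → Prop)
    (hp : ∀ (q : Q × A) x, p x → p (q • x)) :
    Equivariant A Q (X.restrictVal p hp) := fun _ _ => rfl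

theorem restrictVal_injective (X : FibSet A Q) (p : X.X → Prop)
    (hp : ∀ (q : Q × A) x, p x → p (q • x)) : Function.Injective (X.restrictVal p hp) :=
  Subtype.val_injective

theorem restrict_isUnion (X : FibSet A Q) (p : X.X → Prop)
    (hp : ∀ (q : Q × A) x, p x → p (q • x)) (hn : ∀ (q : Q × A) x, ¬ p x → ¬ p (q • x)) :
    IsUnion (A := A) (Q := Q) (X.restrictVal p hp)
      (X.restrictVal (fun x => ¬ p x) hn) := by
  refine ⟨fun _ _ => rfl, fun _ _ => rfl, ?_, ?_⟩
  · rintro (⟨x, hx⟩ | ⟨x, hx⟩) (⟨y, hy⟩ | ⟨y, hy⟩) (e : x = y)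
    · exact congrArg Sum.inl (Subtype.ext e)
    · exact absurd (e ▸ hx) hy
    · exact absurd hy (e ▸ hx)
    · exact congrArg Sum.inr (Subtype.ext e)
  · intro x
    by_cases h : p x
    · exact ⟨Sum.inl ⟨x, h⟩, rfl⟩
    · exact ⟨Sum.inr ⟨x, h⟩, rfl⟩

theorem IsUnion.inj_left {X Y Z : Type u} [MulAction (Q × A) X] [MulAction (Q × A) Y]
    [MulAction (Q × A) Z] {i : X → Z} {j : Y → Z} (h : IsUnion (A := A) (Q := Q) i j) :
    Function.Injective i := fun x y e =>
  Sum.inl_injective (h.2.2.1 (a₁ := Sum.inl x) (a₂ := Sum.inl y) e)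

theorem IsUnion.inj_right {X Y Z : Type u} [MulAction (Q × A) X] [MulAction (Q × A) Y]
    [MulAction (Q × A) Z] {i : X → Z} {j : Y → Z} (h : IsUnion (A := A) (Q := Q) i j) :
    Function.Injective j := fun x y e =>
  Sum.inr_injective (h.2.2.1 (a₁ := Sum.inr x) (a₂ := Sum.inr y) e)

variable [Finite Q]

/-- The class of an element of `Q × A` in the transitive fibered set. -/
def transMk (P : FPair A Q) (q : Q × A) : (trans P).X := QuotientGroup.mk q

theorem smul_transMk (P : FPair A Q) (q r : Q × A) : q • transMk P r = transMk P (q * r) := rfl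

theorem exists_transMk {P : FPair A Q} (x : (trans P).X) : ∃ q, transMk P q = x :=
  QuotientGroup.mk_surjective x

/-- The subgroup divided out is the graph of φ⁻¹. Hence q⁻¹r lies in it when φ takes at `q.1⁻¹ *
r.1` the value inverse to `q.2⁻¹ * r.2`. -/
theorem transMk_eq {P : FPair A Q} {q r : Q × A} :
    transMk P q = transMk P r ↔ P.Rel (q.1⁻¹ * r.1) (q.2 * r.2⁻¹) := by
  refine QuotientGroup.eq.trans ?_
  constructor
  · rintro ⟨d, hd⟩
    have e1 := congrArg Prod.fst hd
    have e2 := congrArg Prod.snd hd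
    simp at e1 e2
    refine ⟨e1 ▸ d.2, ?_⟩
    rw [← inv_inj, mul_inv_rev, inv_inv, mul_comm, ← e2]
    simp only [← e1]
  · rintro ⟨hq, e⟩
    refine ⟨⟨_, hq⟩, ?_⟩
    ext
    · rfl
    · simp [e, mul_comm]

theorem stabPair_trans (P : FPair A Q) (q : Q × A) :
    (trans P).stabPair (transMk P q) = P.conj q.1 := by
  have h1 : (trans P).stabPair (transMk P 1) = P := by
    refine FPair.ext_rel fun q a => ?_
    rw [rel_stabPair, smul_transMk, smul_transMk, eq_comm, transMk_eq]
    simp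
  have h2 : transMk P q = q • transMk P 1 := by rw [smul_transMk, mul_one]
  rw [h2, stabPair_smul, h1]

/-- Orbit–stabilizer: the stabilizer of x in Q × A is the graph of the inverse of φ_x on Q_x. -/
theorem mk_eq_trans (X : FibSet A Q) (x : X.X) (h : ∀ y : X.X, ∃ q : Q × A, q • x = y) :
    IsoClass.mk X = IsoClass.mk (trans (X.stabPair x)) := by
  symm
  have key : ∀ q : Q × A, q ∈ ((X.stabPair x).dom.subtype.prod (X.stabPair x).char⁻¹).range ↔
      q • x = x := by
    rintro ⟨q, a⟩
    constructor
    · rintro ⟨d, hd⟩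
      have e1 := congrArg Prod.fst hd
      have e2 := congrArg Prod.snd hd
      simp at e1 e2
      subst e1 e2
      rw [smul_eq_of_rel ((X.stabPair x).rel_char d.2), mul_inv_cancel]
      exact one_smul _ _
    · intro e
      have hr := rel_stabPair_of_smul_eq (X := X) (x := x) (q := q) (a := 1) (b := a)
        (e.trans (one_smul (Q × A) x).symm)
      rw [one_mul] at hr
      obtain ⟨hq, e⟩ := hr
      refine ⟨⟨q, hq⟩, ?_⟩
      ext
      · rfl
      · simp [e]
  refine IsoClass.sound (X := trans (X.stabPair x))
    (fun c => Quotient.liftOn' c (fun q => q • x) ?_) ?_ ⟨?_, ?_⟩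
  · intro q r hqr
    rw [QuotientGroup.leftRel_apply, key, mul_smul, inv_smul_eq_iff] at hqr
    exact hqr.symm
  · rintro q ⟨r⟩
    exact mul_smul q r x
  · rintro ⟨q⟩ ⟨r⟩ (e : q • x = r • x)
    refine QuotientGroup.eq.mpr ((key _).mpr ?_)
    rw [mul_smul, ← e, inv_smul_smul]
  · intro y
    obtain ⟨q, rfl⟩ := h y
    exact ⟨QuotientGroup.mk q, rfl⟩

end FibSet

/-! ### Classes in B^A_R(Q) and linear extension of additive functions. -/

section Classes

variable {A Q : Type u} [CommGroup A] [Group Q] (R : Type w) [CommRing R]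

theorem cls_eq_of_mk_eq {X Y : FibSet A Q} (h : IsoClass.mk X = IsoClass.mk Y) :
    cls R X = cls R Y := by rw [cls, cls, h]

theorem cls_union {X Y Z : FibSet A Q} {i : X.X → Z.X} {j : Y.X → Z.X}
    (h : FibSet.IsUnion (A := A) (Q := Q) i j) : cls R Z = cls R X + cls R Y := by
  rw [cls, cls, cls, IsoClass.mk_union i j h, map_add, TensorProduct.tmul_add]

theorem cls_of_isEmpty (X : FibSet A Q) [h : IsEmpty X.X] : cls R X = 0 := by
  have : IsoClass.mk X = 0 := IsoClass.sound (Y := FibSet.empty A Q) (fun x => h.elim x)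
    (fun _ x => h.elim x) ⟨fun x => h.elim x, fun x => PEmpty.elim x⟩
  rw [cls, this, map_zero, TensorProduct.tmul_zero]

/-- A fibered set is a finite disjoint union of transitive ones. The induction is on the number of
A-orbits and splits off the (Q × A)-orbit of one point. -/
theorem cls_mem_of_trans_mem [Finite Q] (N : Submodule R (BR A Q R)) (X : FibSet A Q)
    (h : ∀ x, cls R (FibSet.trans (X.stabPair x)) ∈ N) : cls R X ∈ N := by
  induction hn : Nat.card X.Orb using Nat.strong_induction_on generalizing X with
  | _ n ih =>
  rcases isEmpty_or_nonempty X.X with he | ⟨⟨x⟩⟩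
  · rw [cls_of_isEmpty]
    exact N.zero_mem
  let p : X.X → Prop := fun y => ∃ q : Q × A, q • x = y
  have hp : ∀ (q : Q × A) y, p y → p (q • y) := by
    rintro q _ ⟨r, rfl⟩
    exact ⟨q * r, mul_smul _ _ _⟩
  have hq : ∀ (q : Q × A) y, ¬ p y → ¬ p (q • y) := by
    intro q y hy hqy
    apply hy
    have := hp q⁻¹ _ hqy
    rwa [inv_smul_smul] at this
  have hx : p x := ⟨1, one_smul _ _⟩
  have h' : ∀ (p : X.X → Prop) (hp : ∀ (q : Q × A) x, p x → p (q • x)) (y : (X.restrict p hp).X),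
      cls R (FibSet.trans ((X.restrict p hp).stabPair y)) ∈ N := fun p hp y => by
    rw [FibSet.stabPair_map (X.restrict_equivariant p hp) (X.restrictVal_injective p hp)]
    exact h _
  rw [cls_union R (X.restrict_isUnion p hp hq)]
  refine N.add_mem ?_ (ih _ ?_ _ (h' _ hq) rfl)
  · have e := (X.restrict p hp).mk_eq_trans ⟨x, hx⟩ (by
      rintro ⟨_, q, rfl⟩
      exact ⟨q, rfl⟩)
    rw [cls_eq_of_mk_eq R e]
    exact h' _ _ _
  · rw [← hn]
    have := X.fin
    have := (X.restrict (fun y => ¬ p y) hq).fin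
    let f : (X.restrict (fun y => ¬ p y) hq).Orb → X.Orb :=
      Quotient.map' Subtype.val (by
        rintro x _ ⟨a, rfl⟩
        exact ⟨a, rfl⟩)
    have := Fintype.ofFinite X.Orb
    have := Fintype.ofFinite (X.restrict (fun y => ¬ p y) hq).Orb
    rw [Nat.card_eq_fintype_card, Nat.card_eq_fintype_card]
    -- The complement has strictly fewer A-orbits, since that of x is missing.
    refine Fintype.card_lt_of_injective_of_notMem (b := Quotient.mk _ x) f ?_ ?_
    · rintro ⟨x⟩ ⟨y⟩ h
      obtain ⟨a, ha⟩ := Quotient.exact h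
      exact Quotient.sound ⟨a, Subtype.ext ha⟩
    · rintro ⟨⟨⟨y, hy⟩⟩, e⟩
      obtain ⟨a, ha⟩ := Quotient.exact e
      apply hy
      refine ⟨(1, a⁻¹), ?_⟩
      have := congrArg (fun z => ((1 : Q), a⁻¹) • z) ha
      simpa [smul_smul, one_mk_one_smul] using this.symm

/-- A function on the fibered sets with stabilizing pairs in a conjugation-invariant set that is
additive on disjoint unions extends to a linear map on `B^A_R(Q)`. -/
theorem exists_linear_extension {N : Type*} [AddCommGroup N] [Module R N] (p : FPair A Q → Prop)
    (hp : ∀ q P, p P → p (P.conj q)) (Ψ : ∀ U : FibSet A Q, (∀ u, p (U.stabPair u)) → N)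
    (hΨ : ∀ (U V W : FibSet A Q) (hU : ∀ u, p (U.stabPair u)) (hV : ∀ u, p (V.stabPair u))
      (hW : ∀ u, p (W.stabPair u)) (i : U.X → W.X) (j : V.X → W.X),
      FibSet.IsUnion (A := A) (Q := Q) i j → Ψ W hW = Ψ U hU + Ψ V hV) :
    ∃ Φ : BR A Q R →ₗ[R] N, ∀ (U : FibSet A Q) (hU : ∀ u, p (U.stabPair u)),
      Φ (cls R U) = Ψ U hU := by
  have hinv : ∀ (U : FibSet A Q) (q : Q × A) (u : U.X), p (U.stabPair u) →
      p (U.stabPair (q • u)) := fun U q u h => by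
    rw [FibSet.stabPair_smul]
    exact hp _ _ h
  -- `Ψ` is given only on fibered sets all of whose pairs satisfy `p`, while the Grothendieck group
  -- is generated by all fibered sets. The extension discards the points whose pair violates `p`;
  -- these form a union of orbits because `p` is invariant under conjugation.
  let res : FibSet A Q → FibSet A Q := fun U => U.restrict (fun u => p (U.stabPair u)) (hinv U)
  have hres : ∀ (U : FibSet A Q) (u : (res U).X), p ((res U).stabPair u) := fun U u => by
    have e := FibSet.stabPair_map (U.restrict_equivariant _ (hinv U))
      (U.restrictVal_injective _ (hinv U)) u
    exact e ▸ u.2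
  have hE : ∀ u, p ((FibSet.empty A Q).stabPair u) := fun u => PEmpty.elim u
  have h0 : Ψ (FibSet.empty A Q) hE = 0 := by
    have := hΨ _ _ _ hE hE hE id PEmpty.elim
      (isUnion_empty (X := FibSet.empty A Q) id (fun _ _ => rfl) Function.bijective_id)
    exact left_eq_add.mp this
  -- An isomorphism exhibits its target as the disjoint union of its source and the empty set, so
  -- invariance is a case of additivity.
  have hiso : ∀ (U V : FibSet A Q) (hU : ∀ u, p (U.stabPair u)) (hV : ∀ u, p (V.stabPair u))
      (f : U.X → V.X), Equivariant A Q f → Function.Bijective f → Ψ U hU = Ψ V hV :=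
    fun U V hU hV f hf hb => by
      rw [hΨ _ _ _ hU hE hV f _ (isUnion_empty f hf hb), h0, add_zero]
  have hunion : ∀ (U V W : FibSet A Q) (i : U.X → W.X) (j : V.X → W.X),
      FibSet.IsUnion (A := A) (Q := Q) i j →
      Ψ (res W) (hres W) = Ψ (res U) (hres U) + Ψ (res V) (hres V) := by
    intro U V W i j h
    have ei := FibSet.stabPair_map h.1 h.inj_left
    have ej := FibSet.stabPair_map h.2.1 h.inj_right
    refine hΨ _ _ _ _ _ _ (fun u => ⟨i u.1, (congrArg p (ei u.1)).mp u.2⟩)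
      (fun u => ⟨j u.1, (congrArg p (ej u.1)).mp u.2⟩)
      ⟨fun q u => Subtype.ext (h.1 q u.1), fun q u => Subtype.ext (h.2.1 q u.1), ?_, ?_⟩
    · rintro (u | u) (v | v) e
      · exact congrArg Sum.inl (Subtype.ext (h.inj_left (congrArg Subtype.val e)))
      · exact absurd (h.2.2.1 (a₁ := Sum.inl u.1) (a₂ := Sum.inr v.1) (congrArg Subtype.val e))
          (by simp)
      · exact absurd (h.2.2.1 (a₁ := Sum.inr u.1) (a₂ := Sum.inl v.1) (congrArg Subtype.val e))
          (by simp)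
      · exact congrArg Sum.inr (Subtype.ext (h.inj_right (congrArg Subtype.val e)))
    · rintro ⟨w, hw⟩
      obtain ⟨u | u, rfl⟩ := h.2.2.2 w
      · exact ⟨Sum.inl ⟨u, (congrArg p (ei u)).mpr hw⟩, rfl⟩
      · exact ⟨Sum.inr ⟨u, (congrArg p (ej u)).mpr hw⟩, rfl⟩
  have hresE : ∀ U : FibSet A Q, IsEmpty U.X → Ψ (res U) (hres U) = 0 := fun U hU => by
    rw [← h0]
    exact hiso _ _ _ _ (fun u => hU.elim u.1) (fun _ u => hU.elim u.1)
      ⟨fun u => hU.elim u.1, fun u => PEmpty.elim u⟩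
  let φ : IsoClass A Q →+ N :=
    { toFun := Quotient.lift (fun U => Ψ (res U) (hres U)) (by
        rintro U V ⟨f, hf, hb⟩
        have e := hunion _ _ _ _ _ (isUnion_empty f hf hb)
        rw [hresE (FibSet.empty A Q) (inferInstanceAs (IsEmpty PEmpty)), add_zero] at e
        exact e.symm)
      map_zero' := hresE (FibSet.empty A Q) (inferInstanceAs (IsEmpty PEmpty))
      map_add' := by
        rintro ⟨U⟩ ⟨V⟩
        exact hunion _ _ _ _ _ (isUnion_sum U V) }
  refine ⟨LinearMap.liftBaseChange R
    (Algebra.GrothendieckAddGroup.lift φ).toIntLinearMap, fun U hU => ?_⟩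
  rw [cls, LinearMap.liftBaseChange_tmul, one_smul]
  refine (grothendieck_lift_of φ _).trans ?_
  exact hiso (res U) U _ _ (U.restrictVal _ (hinv U)) (fun _ _ => rfl)
    ⟨Subtype.val_injective, fun u => ⟨⟨u, hU u⟩, rfl⟩⟩

end Classes

theorem mk_one_one_smul {A G H Y : Type*} [Monoid A] [Monoid G] [Monoid H]
    [MulAction ((G × H) × A) Y] (y : Y) : (((1 : G), (1 : H)), (1 : A)) • y = y :=
  one_smul ((G × H) × A) y

/-! ### Tensor products with right-free bisets. -/

section RightFree

variable {A G H K : Type u} [CommGroup A] [Group G] [Group H] [Group K]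

/-- The right action of `H` on the set of `A`-orbits is free. -/
def RFree (U : FibSet A (G × H)) : Prop :=
  ∀ (u : U.X) (h : H), ((1 : G), h) ∈ (U.stabPair u).dom → h = 1

/-- Freeness of H on A-orbits gives h = 1, and then freeness over A gives a = 1; so H × A acts
freely on U itself. -/
theorem RFree.eq_one {U : FibSet A (G × H)} (hU : RFree U) {u : U.X} {h : H} {a : A}
    (e : (((1 : G), h), a) • u = u) : h = 1 ∧ a = 1 := by
  have hr := FibSet.rel_stabPair_of_smul_eq (X := U) (x := u) (q := ((1 : G), h)) (a := 1) (b := a)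
    (e.trans (one_mk_one_smul u).symm)
  have h1 := hU u h hr.mem
  subst h1
  refine ⟨rfl, ?_⟩
  exact U.free _ _ u (e.trans (one_mk_one_smul u).symm)

theorem RFree.eq {U : FibSet A (G × H)} (hU : RFree U) {u : U.X} {h h' : H} {a a' : A}
    (e : (((1 : G), h), a) • u = (((1 : G), h'), a') • u) : h = h' ∧ a = a' := by
  have e' : (((1 : G), h'⁻¹ * h), a'⁻¹ * a) • u = u := by
    have := congrArg (fun w => (((1 : G), h'⁻¹), a'⁻¹) • w) e
    simpa [smul_smul, mk_one_one_smul] using this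
  obtain ⟨h1, h2⟩ := hU.eq_one e'
  exact ⟨(inv_mul_eq_one.mp h1).symm, (inv_mul_eq_one.mp h2).symm⟩

/-- The `(H × A)`-orbit of `(u, v)` in `U × V`. -/
def pairOrb (U : FibSet A (G × H)) (V : FibSet A (H × K)) (u : U.X) (v : V.X) :
    BalOrb A H (G × K) (PairSet U V) :=
  BalOrb.mk A H (G × K) ((u, v) : PairSet U V)

theorem pairMk_eq {U : FibSet A (G × H)} {V : FibSet A (H × K)} {u u' : U.X} {v v' : V.X} :
    pairOrb U V u v = pairOrb U V u' v' ↔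
      ∃ (h : H) (a : A), (((1 : G), h), a⁻¹) • u = u' ∧ ((h, (1 : K)), a) • v = v' := by
  refine BalOrb.mk_eq.trans ?_
  constructor
  · rintro ⟨⟨h, a⟩, e⟩
    refine ⟨h, a, ?_, congrArg Prod.snd e⟩
    have := congrArg Prod.fst e
    rw [← mul_one a⁻¹]
    exact this
  · rintro ⟨h, a, e₁, e₂⟩
    refine ⟨(h, a), Prod.ext ?_ e₂⟩
    rw [← mul_one a⁻¹] at e₁
    exact e₁

theorem pairMkLeft_eq {U : FibSet A (G × H)} {X : FibSet A H} {u u' : U.X} {x x' : X.X} :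
    pureOrb U X u x = pureOrb U X u' x' ↔
      ∃ (h : H) (a : A), (((1 : G), h), a⁻¹) • u = u' ∧ (h, a) • x = x' := by
  refine BalOrb.mk_eq.trans ?_
  constructor
  · rintro ⟨⟨h, a⟩, e⟩
    refine ⟨h, a, ?_, congrArg Prod.snd e⟩
    have := congrArg Prod.fst e
    rw [← mul_one a⁻¹]
    exact this
  · rintro ⟨h, a, e₁, e₂⟩
    refine ⟨(h, a), Prod.ext ?_ e₂⟩
    rw [← mul_one a⁻¹] at e₁
    exact e₁

/-- If a and b move the orbit to the same place, a balancing element (h, d) relates the two pairs.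
Right freeness of U gives h = 1 and `d⁻¹ * a = b`; freeness of V over A gives d = 1. Hence the
tensor product consists of all orbits. -/
theorem RFree.aFree {U : FibSet A (G × H)} (hU : RFree U) (V : FibSet A (H × K)) (u : U.X)
    (v : V.X) : AFree A H (G × K) (pairOrb U V u v) := by
  intro a b e
  have e : pairOrb U V ((((1 : G), (1 : H)), 1⁻¹ * a) • u) ((((1 : H), (1 : K)), (1 : A)) • v) =
      pairOrb U V ((((1 : G), (1 : H)), 1⁻¹ * b) • u) ((((1 : H), (1 : K)), (1 : A)) • v) := e
  obtain ⟨h, d, e₁, e₂⟩ := pairMk_eq.mp e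
  simp only [smul_smul, Prod.mk_mul_mk, mul_one, one_mul, inv_one] at e₁ e₂
  obtain ⟨rfl, e₃⟩ := hU.eq e₁
  have := V.free _ _ v e₂
  rw [← e₃, this]
  simp

theorem RFree.aFree_left {U : FibSet A (G × H)} (hU : RFree U) (X : FibSet A H) (u : U.X)
    (x : X.X) : AFree A H G (pureOrb U X u x) := by
  intro a b e
  have e : pureOrb U X ((((1 : G), (1 : H)), 1⁻¹ * a) • u) (((1 : H), (1 : A)) • x) =
      pureOrb U X ((((1 : G), (1 : H)), 1⁻¹ * b) • u) (((1 : H), (1 : A)) • x) := e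
  obtain ⟨h, d, e₁, e₂⟩ := pairMkLeft_eq.mp e
  simp only [smul_smul, Prod.mk_mul_mk, mul_one, one_mul, inv_one] at e₁ e₂
  obtain ⟨rfl, e₃⟩ := hU.eq e₁
  have := X.free _ _ x e₂
  rw [← e₃, this]
  simp

/-- The point `u ⊗ v` of `U ⊗_{AH} V`. -/
def RFree.tmk {U : FibSet A (G × H)} (hU : RFree U) {V : FibSet A (H × K)} (u : U.X) (v : V.X) :
    (tensor U V).X := ⟨pairOrb U V u v, hU.aFree V u v⟩

/-- The point `u ⊗ x` of `U ⊗_{AH} X`. -/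
def RFree.tmkL {U : FibSet A (G × H)} (hU : RFree U) {X : FibSet A H} (u : U.X) (x : X.X) :
    (tensorLeft U X).X := ⟨pureOrb U X u x, hU.aFree_left X u x⟩

variable {U : FibSet A (G × H)} (hU : RFree U) {V : FibSet A (H × K)} {X : FibSet A H}

include hU

theorem RFree.exists_tmk (w : (tensor U V).X) : ∃ u v, hU.tmk u v = w := by
  obtain ⟨⟨⟨u, v⟩⟩, h⟩ := w
  exact ⟨u, v, rfl⟩

theorem RFree.exists_tmkL (w : (tensorLeft U X).X) : ∃ u x, hU.tmkL u x = w := by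
  obtain ⟨⟨⟨u, v⟩⟩, h⟩ := w
  exact ⟨u, v, rfl⟩

theorem RFree.tmk_eq {u u' : U.X} {v v' : V.X} : hU.tmk u v = hU.tmk u' v' ↔
    ∃ (h : H) (a : A), (((1 : G), h), a⁻¹) • u = u' ∧ ((h, (1 : K)), a) • v = v' :=
  Subtype.ext_iff.trans pairMk_eq

theorem RFree.tmkL_eq {u u' : U.X} {x x' : X.X} : hU.tmkL u x = hU.tmkL u' x' ↔
    ∃ (h : H) (a : A), (((1 : G), h), a⁻¹) • u = u' ∧ (h, a) • x = x' :=
  Subtype.ext_iff.trans pairMkLeft_eq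

theorem RFree.smul_tmk (g : G) (k : K) (b : A) (u : U.X) (v : V.X) :
    ((g, k), b) • hU.tmk u v = hU.tmk (((g, (1 : H)), b) • u) ((((1 : H), k), (1 : A)) • v) := by
  refine Subtype.ext ?_
  refine (BalOrb.smul_mk A H (G × K) _ _).trans ?_
  refine congrArg (BalOrb.mk A H (G × K)) (Prod.ext ?_ rfl)
  change ((g, (1 : H)), 1⁻¹ * b) • u = _
  rw [inv_one, one_mul]

theorem RFree.smul_tmkL (g : G) (b : A) (u : U.X) (x : X.X) :
    (g, b) • hU.tmkL u x = hU.tmkL (((g, (1 : H)), b) • u) x := by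
  refine Subtype.ext ?_
  refine (BalOrb.smul_mk A H G _ _).trans ?_
  refine congrArg (BalOrb.mk A H G) (Prod.ext ?_ ?_)
  · change ((g, (1 : H)), 1⁻¹ * b) • u = _
    rw [inv_one, one_mul]
  · exact one_mk_one_smul x

theorem RFree.tmk_smul (h : H) (a : A) (u : U.X) (v : V.X) :
    hU.tmk ((((1 : G), h), a) • u) v = hU.tmk u (((h⁻¹, (1 : K)), a) • v) :=
  hU.tmk_eq.mpr ⟨h⁻¹, a, by simp [smul_smul, mk_one_one_smul], rfl⟩

theorem RFree.tmkL_smul (h : H) (a : A) (u : U.X) (x : X.X) :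
    hU.tmkL ((((1 : G), h), a) • u) x = hU.tmkL u ((h⁻¹, a) • x) :=
  hU.tmkL_eq.mpr ⟨h⁻¹, a, by simp [smul_smul, mk_one_one_smul], rfl⟩

/-- An element (g, k) fixes the A-orbit of u ⊗ v when some balancing element, here called h⁻¹,
brings (gu, vk⁻¹) back to (u, v) up to A. Then (g, h) fixes the A-orbit of u, (h, k) that of v, and
the weights multiply: the stabilizing pair is the ∗-product. -/
theorem RFree.rel_tmk {u : U.X} {v : V.X} {x : G × K} {a : A} :
    ((tensor U V).stabPair (hU.tmk u v)).Rel x a ↔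
      ∃ h b c, (U.stabPair u).Rel (x.1, h) b ∧ (V.stabPair v).Rel (h, x.2) c ∧ b * c = a := by
  obtain ⟨g, k⟩ := x
  rw [FibSet.rel_stabPair]
  have e : (((1 : G × K), a) : (G × K) × A) = (((1 : G), (1 : K)), a) := rfl
  rw [e, hU.smul_tmk, hU.smul_tmk, eq_comm, hU.tmk_eq]
  constructor
  · rintro ⟨h, d, e₁, e₂⟩
    simp only [smul_smul, Prod.mk_mul_mk, mul_one] at e₁ e₂
    have e₃ : ((g, h⁻¹), (1 : A)) • u = (((1 : G), (1 : H)), d⁻¹ * a) • u := by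
      have := congrArg (fun w => (((1 : G), h⁻¹), (1 : A)) • w) e₁
      simpa [smul_smul] using this.symm
    have e₄ : ((h⁻¹, k), (1 : A)) • v = (((1 : H), (1 : K)), d) • v := by
      have := congrArg (fun w => ((h⁻¹, (1 : K)), (1 : A)) • w) e₂
      simpa [smul_smul] using this.symm
    exact ⟨h⁻¹, d⁻¹ * a, d, FibSet.rel_stabPair.mpr e₃, FibSet.rel_stabPair.mpr e₄, by
      rw [mul_comm, mul_inv_cancel_left]⟩
  · rintro ⟨h, b, c, h₁, h₂, rfl⟩
    rw [FibSet.rel_stabPair] at h₁ h₂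
    refine ⟨h⁻¹, c, ?_, ?_⟩
    · have := congrArg (fun w => (((1 : G), h⁻¹), (1 : A)) • w) h₁
      simpa [smul_smul, mul_comm b c] using this.symm
    · have := congrArg (fun w => ((h⁻¹, (1 : K)), (1 : A)) • w) h₂
      simpa [smul_smul] using this.symm

theorem RFree.rel_tmkL {u : U.X} {x : X.X} {g : G} {a : A} :
    ((tensorLeft U X).stabPair (hU.tmkL u x)).Rel g a ↔
      ∃ h b c, (U.stabPair u).Rel (g, h) b ∧ (X.stabPair x).Rel h c ∧ b * c = a := by
  rw [FibSet.rel_stabPair, hU.smul_tmkL, hU.smul_tmkL, eq_comm, hU.tmkL_eq]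
  constructor
  · rintro ⟨h, d, e₁, e₂⟩
    simp only [smul_smul, Prod.mk_mul_mk, mul_one] at e₁ e₂
    have e₃ : ((g, h⁻¹), (1 : A)) • u = (((1 : G), (1 : H)), d⁻¹ * a) • u := by
      have := congrArg (fun w => (((1 : G), h⁻¹), (1 : A)) • w) e₁
      simpa [smul_smul] using this.symm
    have e₄ : (h⁻¹, (1 : A)) • x = ((1 : H), d) • x := by
      have := congrArg (fun w => (h⁻¹, (1 : A)) • w) e₂
      simpa [smul_smul] using this.symm
    exact ⟨h⁻¹, d⁻¹ * a, d, FibSet.rel_stabPair.mpr e₃, FibSet.rel_stabPair.mpr e₄, by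
      rw [mul_comm, mul_inv_cancel_left]⟩
  · rintro ⟨h, b, c, h₁, h₂, rfl⟩
    rw [FibSet.rel_stabPair] at h₁ h₂
    refine ⟨h⁻¹, c, ?_, ?_⟩
    · have := congrArg (fun w => (((1 : G), h⁻¹), (1 : A)) • w) h₁
      simpa [smul_smul, mul_comm b c] using this.symm
    · have := congrArg (fun w => (h⁻¹, (1 : A)) • w) h₂
      simpa [smul_smul, one_mk_one_smul] using this.symm

theorem RFree.tensor (hV : RFree V) : RFree (tensor U V) := by
  intro w k hk
  obtain ⟨u, v, rfl⟩ := hU.exists_tmk w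
  obtain ⟨a, ha⟩ := FPair.exists_rel hk
  obtain ⟨h, b, c, h₁, h₂, -⟩ := hU.rel_tmk.mp ha
  obtain rfl := hU u h h₁.mem
  exact hV v k h₂.mem

/-- As every orbit is A-free, both sides are the same quotient of U × V × X, by the balancing
actions of H × A and K × A. -/
theorem RFree.exists_assoc (hV : RFree V) (X : FibSet A K) :
    ∃ f : (tensorLeft (Fibered.tensor U V) X).X → (tensorLeft U (tensorLeft V X)).X,
      Equivariant A G f ∧ Function.Bijective f ∧
      ∀ u v (x : X.X), f ((hU.tensor hV).tmkL (hU.tmk u v) x) = hU.tmkL u (hV.tmkL v x) := by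
  have ex : ∀ w : (tensorLeft (Fibered.tensor U V) X).X, ∃ u v x,
      (hU.tensor hV).tmkL (hU.tmk u v) x = w := by
    intro w
    obtain ⟨y, x, rfl⟩ := (hU.tensor hV).exists_tmkL w
    obtain ⟨u, v, rfl⟩ := hU.exists_tmk y
    exact ⟨u, v, x, rfl⟩
  -- This equivalence makes the map, defined through chosen representatives, both independent of the
  -- choice and injective.
  have key : ∀ u v x u' v' (x' : X.X), (hU.tensor hV).tmkL (hU.tmk u v) x =
      (hU.tensor hV).tmkL (hU.tmk u' v') x' ↔
      hU.tmkL u (hV.tmkL v x) = hU.tmkL u' (hV.tmkL v' x') := by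
    intro u v x u' v' x'
    rw [RFree.tmkL_eq, RFree.tmkL_eq]
    constructor
    · rintro ⟨k, b, e₁, e₂⟩
      have e₀ : (((1 : G × H), b⁻¹) : (G × H) × A) = (((1 : G), (1 : H)), b⁻¹) := rfl
      rw [hU.smul_tmk, hU.tmk_eq] at e₁
      obtain ⟨h, a, e₃, e₄⟩ := e₁
      simp only [smul_smul, Prod.mk_mul_mk, one_mul, mul_one] at e₃ e₄
      refine ⟨h, a * b, by rw [mul_inv]; exact e₃, ?_⟩
      rw [hV.smul_tmkL, hV.tmkL_eq]
      refine ⟨k, b, ?_, e₂⟩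
      simpa [smul_smul] using e₄
    · rintro ⟨h, a, e₁, e₂⟩
      rw [hV.smul_tmkL, hV.tmkL_eq] at e₂
      obtain ⟨k, b, e₃, e₄⟩ := e₂
      refine ⟨k, b, ?_, e₄⟩
      rw [hU.smul_tmk, hU.tmk_eq]
      refine ⟨h, a * b⁻¹, ?_, ?_⟩
      · simpa [smul_smul] using e₁
      · simpa [smul_smul, mul_comm a] using e₃
  choose fu fv fx hf using ex
  have hfm : ∀ u v (x : X.X), hU.tmkL (fu ((hU.tensor hV).tmkL (hU.tmk u v) x))
      (hV.tmkL (fv ((hU.tensor hV).tmkL (hU.tmk u v) x))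
        (fx ((hU.tensor hV).tmkL (hU.tmk u v) x))) = hU.tmkL u (hV.tmkL v x) := fun u v x =>
    (key _ _ _ _ _ _).mp (hf _)
  refine ⟨fun w => hU.tmkL (fu w) (hV.tmkL (fv w) (fx w)), ?_, ⟨?_, ?_⟩, hfm⟩
  · rintro ⟨g, b⟩ w
    dsimp only
    obtain ⟨y, x, rfl⟩ := (hU.tensor hV).exists_tmkL w
    obtain ⟨u, v, rfl⟩ := hU.exists_tmk y
    rw [hfm, hU.smul_tmkL, (hU.tensor hV).smul_tmkL, hU.smul_tmk, hfm]
    exact congrArg (fun v => hU.tmkL _ (hV.tmkL v x)) (one_smul ((H × K) × A) v)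
  · intro w w' e
    rw [← hf w, ← hf w']
    exact (key _ _ _ _ _ _).mpr e
  · intro y
    obtain ⟨u, z, rfl⟩ := hU.exists_tmkL y
    obtain ⟨v, x, rfl⟩ := hV.exists_tmkL z
    exact ⟨_, hfm u v x⟩

end RightFree

/-! ### Stabilizing pairs inside the ambient groups, and the axioms. -/

section Data

variable {A : Type u} [CommGroup A] {𝒢 : GroupClass.{u}}

/-- The axioms on the data `(𝒢, 𝒮)`. -/
structure Axioms (S : Family A 𝒢) : Prop where
  fam : IsFamily S
  i : AxiomI S
  ii : AxiomII S
  iii : AxiomIII S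
  iv : AxiomIV S
  vi : AxiomVI S
  vii : AxiomVII S
  viii : AxiomVIII S
  condK2 : CondK2 S

/-- All stabilizing pairs of the biset `U` lie in the family. -/
def Good (T : Family A 𝒢) {G H : Obj 𝒢} (U : Biset A G H) : Prop := ∀ u, bisetPair U u ∈ T G H

theorem rel_bisetPair {G H : Obj 𝒢} {U : Biset A G H} {u : U.X} {x : G.1.amb × H.1.amb} {a : A} :
    (bisetPair U u).Rel x a ↔
      ∃ y : G.grp × H.grp, incl G H y = x ∧ (U.stabPair u).Rel y a := FPair.rel_push

theorem rel_setPair {G : Obj 𝒢} {X : GSet A G} {x : X.X} {g : G.1.amb} {a : A} :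
    (setPair X x).Rel g a ↔ ∃ y : G.grp, (y : G.1.amb) = g ∧ (X.stabPair x).Rel y a :=
  FPair.rel_push

theorem rel_bisetPair_coe {G H : Obj 𝒢} {U : Biset A G H} {u : U.X} {g : G.grp} {h : H.grp}
    {a : A} : (bisetPair U u).Rel ((g : G.1.amb), (h : H.1.amb)) a ↔
      (U.stabPair u).Rel (g, h) a := by
  rw [rel_bisetPair]
  exact ⟨fun ⟨y, e, hy⟩ => incl_injective G H (a₂ := (g, h)) e ▸ hy, fun h => ⟨_, rfl, h⟩⟩

theorem rel_setPair_coe {G : Obj 𝒢} {X : GSet A G} {x : X.X} {g : G.grp} {a : A} :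
    (setPair X x).Rel (g : G.1.amb) a ↔ (X.stabPair x).Rel g a := by
  rw [rel_setPair]
  exact ⟨fun ⟨y, e, hy⟩ => Subtype.ext e ▸ hy, fun h => ⟨_, rfl, h⟩⟩

theorem bisetPair_dom_le {G H : Obj 𝒢} (U : Biset A G H) (u : U.X) :
    (bisetPair U u).dom ≤ G.grp.prod H.grp := by
  intro x hx
  obtain ⟨a, ha⟩ := FPair.exists_rel hx
  obtain ⟨y, rfl, -⟩ := rel_bisetPair.mp ha
  exact ⟨y.1.2, y.2.2⟩

theorem setPair_dom_le {G : Obj 𝒢} (X : GSet A G) (x : X.X) : (setPair X x).dom ≤ G.grp := by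
  intro g hg
  obtain ⟨a, ha⟩ := FPair.exists_rel hg
  obtain ⟨y, rfl, -⟩ := rel_setPair.mp ha
  exact y.2

theorem bisetPair_smul {G H : Obj 𝒢} (U : Biset A G H) (g : G.grp) (h : H.grp) (a : A) (u : U.X) :
    bisetPair U (((g, h), a) • u) = (bisetPair U u).conj ((g : G.1.amb), (h : H.1.amb)) := by
  refine FPair.ext_rel fun x b => ?_
  rw [FPair.rel_conj, rel_bisetPair, rel_bisetPair, U.stabPair_smul]
  constructor
  · rintro ⟨y, rfl, hy⟩
    rw [FPair.rel_conj] at hy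
    exact ⟨_, rfl, hy⟩
  · rintro ⟨y, e, hy⟩
    refine ⟨(g, h) * y * (g, h)⁻¹, ?_, ?_⟩
    · rw [map_mul, map_mul, e, map_inv]
      change ((g : G.1.amb), (h : H.1.amb)) * _ * ((g : G.1.amb), (h : H.1.amb))⁻¹ = x
      group
    · rw [FPair.rel_conj]
      convert hy using 1
      group

theorem setPair_smul {G : Obj 𝒢} (X : GSet A G) (g : G.grp) (a : A) (x : X.X) :
    setPair X ((g, a) • x) = (setPair X x).conj (g : G.1.amb) := by
  refine FPair.ext_rel fun q b => ?_
  rw [FPair.rel_conj, rel_setPair, rel_setPair, X.stabPair_smul]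
  constructor
  · rintro ⟨y, rfl, hy⟩
    rw [FPair.rel_conj] at hy
    exact ⟨_, rfl, hy⟩
  · rintro ⟨y, e, hy⟩
    refine ⟨g * y * g⁻¹, ?_, ?_⟩
    · push_cast
      rw [e]
      group
    · rw [FPair.rel_conj]
      convert hy using 1
      group

theorem setPair_le_map {G : Obj 𝒢} {X Y : GSet A G} {f : X.X → Y.X} (hf : Equivariant A G.grp f)
    (x : X.X) : setPair X x ≤ setPair Y (f x) :=
  FPair.le_iff_rel.mpr fun g a h => by
    rw [rel_setPair] at h ⊢
    obtain ⟨y, e, hy⟩ := h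
    exact ⟨y, e, FPair.le_iff_rel.mp (FibSet.stabPair_le_map hf x) _ _ hy⟩

theorem setPair_map {G : Obj 𝒢} {X Y : GSet A G} {f : X.X → Y.X} (hf : Equivariant A G.grp f)
    (hi : Function.Injective f) (x : X.X) : setPair X x = setPair Y (f x) := by
  rw [setPair, setPair, FibSet.stabPair_map hf hi]

theorem bisetPair_map {G H : Obj 𝒢} {U V : Biset A G H} {f : U.X → V.X}
    (hf : Equivariant A (G.grp × H.grp) f) (hi : Function.Injective f) (u : U.X) :
    bisetPair U u = bisetPair V (f u) := by
  rw [bisetPair, bisetPair, FibSet.stabPair_map hf hi]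

/-- The class of an element of `(G × H) × A` in the transitive biset `(G × H)/(D, φ)`. -/
def basicMk (G H : Obj 𝒢) (P : FPair A (G.1.amb × H.1.amb)) (q : (G.grp × H.grp) × A) :
    (basic G H P).X := FibSet.transMk _ q

theorem smul_basicMk {G H : Obj 𝒢} (P : FPair A (G.1.amb × H.1.amb))
    (q r : (G.grp × H.grp) × A) : q • basicMk G H P r = basicMk G H P (q * r) := rfl

theorem exists_basicMk {G H : Obj 𝒢} {P : FPair A (G.1.amb × H.1.amb)} (u : (basic G H P).X) :
    ∃ q, basicMk G H P q = u := FibSet.exists_transMk u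

theorem basicMk_eq {G H : Obj 𝒢} {P : FPair A (G.1.amb × H.1.amb)} {q r : (G.grp × H.grp) × A} :
    basicMk G H P q = basicMk G H P r ↔ P.Rel (incl G H (q.1⁻¹ * r.1)) (q.2 * r.2⁻¹) :=
  FibSet.transMk_eq

/-- `basic` pulls P back to G × H and `bisetPair` pushes forward again; the bound on the domain
ensures that nothing is lost. -/
theorem bisetPair_basic {G H : Obj 𝒢} {P : FPair A (G.1.amb × H.1.amb)}
    (hP : P.dom ≤ G.grp.prod H.grp) (q : (G.grp × H.grp) × A) :
    bisetPair (basic G H P) (basicMk G H P q) = P.conj (incl G H q.1) := by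
  have h0 : (basic G H P).stabPair (basicMk G H P 1) = (P.pull (incl G H)).conj 1 :=
    FibSet.stabPair_trans _ 1
  have h1 : bisetPair (basic G H P) (basicMk G H P 1) = P := by
    refine FPair.ext_rel fun x a => ?_
    rw [rel_bisetPair, h0]
    simp only [FPair.rel_conj, FPair.rel_pull]
    constructor
    · rintro ⟨y, rfl, hy⟩
      simpa using hy
    · intro h
      exact ⟨(⟨x.1, (hP h.mem).1⟩, ⟨x.2, (hP h.mem).2⟩), rfl, by simpa [incl] using h⟩
  obtain ⟨⟨g, h⟩, a⟩ := q
  have h2 : basicMk G H P ((g, h), a) = ((g, h), a) • basicMk G H P 1 := by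
    rw [smul_basicMk, mul_one]
  rw [h2, bisetPair_smul, h1]
  rfl

theorem basic_bisetPair {G H : Obj 𝒢} (U : Biset A G H) (u : U.X) :
    basic G H (bisetPair U u) = FibSet.trans (U.stabPair u) := by
  rw [basic, bisetPair, FPair.pull_push]

theorem cls_mem_homR (R : Type w) [CommRing R] {T : Family A 𝒢} {G H : Obj 𝒢} {U : Biset A G H}
    (hU : Good T U) : cls R U ∈ homR R T G H :=
  cls_mem_of_trans_mem R _ U fun u => Submodule.subset_span ⟨_, hU u, by rw [basic_bisetPair]⟩

theorem rFree_of_good {T : Family A 𝒢} {G H : Obj 𝒢}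
    (hT : ∀ P ∈ T G H, ∀ h, ((1 : G.1.amb), h) ∈ P.dom → h = 1) {U : Biset A G H} (hU : Good T U) :
    RFree U := by
  intro u h hh
  obtain ⟨a, ha⟩ := FPair.exists_rel hh
  exact Subtype.ext (hT _ (hU u) h (rel_bisetPair_coe.mpr ha).mem)

theorem rel_bisetPair_tensor {G H K : Obj 𝒢} {U : Biset A G H} (hU : RFree U) {V : Biset A H K}
    {u : U.X} {v : V.X} {x : G.1.amb × K.1.amb} {a : A} :
    (bisetPair (G := G) (H := K) (tensor U V) (hU.tmk u v)).Rel x a ↔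
      ∃ h b c, (bisetPair U u).Rel (x.1, h) b ∧ (bisetPair V v).Rel (h, x.2) c ∧ b * c = a := by
  rw [rel_bisetPair]
  constructor
  · rintro ⟨y, rfl, hy⟩
    obtain ⟨h, b, c, h₁, h₂, e⟩ := hU.rel_tmk.mp hy
    exact ⟨h, b, c, rel_bisetPair_coe.mpr h₁, rel_bisetPair_coe.mpr h₂, e⟩
  · obtain ⟨g, k⟩ := x
    rintro ⟨h, b, c, h₁, h₂, e⟩
    have m₁ := bisetPair_dom_le _ _ h₁.mem
    have m₂ := bisetPair_dom_le _ _ h₂.mem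
    refine ⟨(⟨g, m₁.1⟩, ⟨k, m₂.2⟩), rfl, hU.rel_tmk.mpr ⟨⟨h, m₁.2⟩, b, c, ?_, ?_, e⟩⟩
    · exact rel_bisetPair_coe.mp h₁
    · exact rel_bisetPair_coe.mp h₂

theorem rel_setPair_tensor {G H : Obj 𝒢} {U : Biset A G H} (hU : RFree U) {X : GSet A H}
    {u : U.X} {x : X.X} {g : G.1.amb} {a : A} :
    (setPair (tensorLeft U X) (hU.tmkL u x)).Rel g a ↔
      ∃ h b c, (bisetPair U u).Rel (g, h) b ∧ (setPair X x).Rel h c ∧ b * c = a := by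
  rw [rel_setPair]
  constructor
  · rintro ⟨y, rfl, hy⟩
    obtain ⟨h, b, c, h₁, h₂, e⟩ := hU.rel_tmkL.mp hy
    exact ⟨h, b, c, rel_bisetPair_coe.mpr h₁, rel_setPair_coe.mpr h₂, e⟩
  · rintro ⟨h, b, c, h₁, h₂, e⟩
    have m₁ := bisetPair_dom_le _ _ h₁.mem
    refine ⟨⟨g, m₁.1⟩, rfl, hU.rel_tmkL.mpr ⟨⟨h, m₁.2⟩, b, c, ?_, ?_, e⟩⟩
    · exact rel_bisetPair_coe.mp h₁
    · exact rel_setPair_coe.mp h₂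

/-! ### Consequences of the axioms -/

theorem mem_sub_left_iff {S : Family A 𝒢} {G H : Obj 𝒢} {K K' : Subgroup G.1.amb} (e : K = K')
    {hK : G.Mem K} {hK' : G.Mem K'} {P : FPair A (G.1.amb × H.1.amb)} :
    P ∈ S (G.sub K hK) H ↔ P ∈ S (G.sub K' hK') H := by
  subst e; rfl

/-- The pair `P` lies in `𝒮(G, H)` and `p₁(P) = G`. -/
def Adm (S : Family A 𝒢) (G H : Obj 𝒢) (P : FPair A (G.1.amb × H.1.amb)) : Prop :=
  P ∈ S G H ∧ ∀ g ∈ G.grp, ∃ h, (g, h) ∈ P.dom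

namespace Axioms

variable {S : Family A 𝒢} (ax : Axioms S)

include ax

theorem eq_one {G H : Obj 𝒢} {P : FPair A (G.1.amb × H.1.amb)} (hP : P ∈ S G H) {h : H.1.amb}
    (h1 : (1, h) ∈ P.dom) : h = 1 := by
  have : h ∈ k2 P.dom := h1
  rwa [ax.condK2 G H P hP, Subgroup.mem_bot] at this

theorem adm_diag (G : Obj 𝒢) {K L : Subgroup G.1.amb} (hKL : K ≤ L) (hK : G.Mem K) (hL : G.Mem L) :
    Adm S (G.sub K hK) (G.sub L hL) (FPair.diag K) :=
  ⟨ax.vi (G.sub L hL) K hKL hK, fun g hg => ⟨g, ⟨g, hg, rfl⟩⟩⟩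

theorem adm_diag_of_eq {G : Obj 𝒢} {K K' : Subgroup G.1.amb} (e : K = K') (hK : G.Mem K)
    (hK' : G.Mem K') : Adm S (G.sub K' hK') (G.sub K hK) (FPair.diag K) := by
  subst e
  exact ax.adm_diag G le_rfl hK hK

/-- Only h = 1 lies in k₂(P), so there is nothing to compare. -/
theorem compat {G H K : Obj 𝒢} {P : FPair A (G.1.amb × H.1.amb)} {P' : FPair A (H.1.amb × K.1.amb)}
    (hP : P ∈ S G H) : P.Compat P' := by
  intro h hU hV
  obtain rfl := ax.eq_one hP hU
  rw [show (⟨(1, 1), hU⟩ : P.dom) = 1 from rfl, show (⟨(1, 1), hV⟩ : P'.dom) = 1 from rfl,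
    map_one, map_one, inv_one]

/-- Axiom (iii), with the product described by its graph. In this form T can be any presentation of
P ∗ P', and no proof of compatibility has to be carried along. -/
theorem star_mem {G H K : Obj 𝒢} {P : FPair A (G.1.amb × H.1.amb)}
    {P' : FPair A (H.1.amb × K.1.amb)} (hP : P ∈ S G H) (hP' : P' ∈ S H K)
    {T : FPair A (G.1.amb × K.1.amb)} (hT : ∀ x a, T.Rel x a ↔
      ∃ h b c, P.Rel (x.1, h) b ∧ P'.Rel (h, x.2) c ∧ b * c = a) : T ∈ S G K := by
  have e : T = P.star P' (ax.compat (K := K) hP) :=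
    FPair.ext_rel fun x a => (hT x a).trans FPair.rel_star.symm
  rw [e]
  exact ax.iii G H K P hP P' hP' _

/-- Axiom (ii) conjugates (Δ(G), 1) by (g, 1), and axiom (iv) cuts the result down to K. This puts
the conjugation isomorphisms between subgroups in 𝒢 into 𝒮. -/
theorem conj_diag {G : Obj 𝒢} {K K' : Subgroup G.1.amb} (hK : G.Mem K) (hKG : K ≤ G.grp)
    {g : G.1.amb} (hg : g ∈ G.grp) (hK' : ∀ x, x ∈ K' ↔ g⁻¹ * x * g ∈ K) :
    ∃ h : G.Mem K', Adm S (G.sub K' h) (G.sub K hK) ((FPair.diag K).conj (g, 1)) := by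
  have h1 := ax.ii G G _ (ax.i G) g hg 1 G.grp.one_mem
  obtain ⟨h2, h3⟩ := ax.iv G G _ h1 K hKG hK
  have e : starRight ((FPair.diag G.grp : FPair A _).conj (g, 1)).dom K = K' := by
    ext x
    rw [hK', mem_starRight]
    simp only [FPair.mem_dom_iff, FPair.rel_diag_conj]
    constructor
    · rintro ⟨k, hk, _, rfl, _, _⟩
      simpa [mul_assoc] using hk
    · intro h
      exact ⟨_, h, 1, by simp [mul_assoc], hKG h, rfl⟩
  have e' : ((FPair.diag G.grp : FPair A _).conj (g, 1)).resRight K =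
      (FPair.diag K).conj (g, 1) := by
    refine FPair.ext_rel fun x a => ?_
    rw [FPair.rel_resRight, FPair.rel_diag_conj, FPair.rel_diag_conj]
    exact ⟨fun ⟨⟨h, _, h'⟩, h''⟩ => ⟨h, h'', h'⟩, fun ⟨h, h', h''⟩ => ⟨⟨h, hKG h', h''⟩, h'⟩⟩
  subst e
  rw [e'] at h3
  refine ⟨h2, h3, fun x hx => ⟨g⁻¹ * x * g, ?_⟩⟩
  rw [FPair.mem_dom_iff]
  exact ⟨1, FPair.rel_diag_conj.mpr ⟨by simp [mul_assoc], (hK' x).mp hx, rfl⟩⟩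

theorem lower_eq_one {G H : Obj 𝒢} {P : FPair A (G.1.amb × H.1.amb)} (hP : P ∈ lower S G H)
    {h : H.1.amb} (h1 : (1, h) ∈ P.dom) : h = 1 := by
  obtain ⟨_, h, hP⟩ := hP
  exact ax.eq_one hP h1

theorem rFree {G H : Obj 𝒢} {U : Biset A G H} (hU : Good (lower S) U) : RFree U :=
  rFree_of_good (fun _ hP _ h => ax.lower_eq_one hP h) hU

/-- From left to right, axiom (vii) is applied with p₂(D) itself as the subgroup: the restriction
changes nothing and D ∗ p₂(D) = p₁(D). Conversely, (D, φ) is composed by (iii) with the inclusion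
(Δ(p₂(D)), 1), which lies in 𝒮(p₂(D), H) by (vi). -/
theorem lower_eq_upper : lower S = upper S := by
  funext G H
  ext P
  constructor
  · rintro ⟨h1, h, hP⟩
    obtain ⟨h2, h3⟩ := ax.vii (G.sub _ h) H P hP
    refine ⟨h1, h, h2, ?_⟩
    obtain ⟨h4, h5⟩ := h3 _ le_rfl h2
    have e : starRight P.dom (p2 P.dom) = p1 P.dom := by
      ext g
      rw [mem_starRight, mem_p1]
      exact ⟨fun ⟨k, _, hk⟩ => ⟨k, hk⟩, fun ⟨k, hk⟩ => ⟨k, mem_p2.mpr ⟨g, hk⟩, hk⟩⟩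
    have e' : P.resRight (p2 P.dom) = P := by
      refine FPair.ext_rel fun x a => ?_
      rw [FPair.rel_resRight]
      exact ⟨fun h => h.1, fun h => ⟨h, mem_p2.mpr ⟨_, h.mem⟩⟩⟩
    rw [e'] at h5
    exact (mem_sub_left_iff (S := S) (G := G) e).mp h5
  · rintro ⟨h1, h, h2, hP⟩
    refine ⟨h1, h, ?_⟩
    have hle : p2 P.dom ≤ H.grp := fun y hy => by
      obtain ⟨x, hx⟩ := mem_p2.mp hy
      exact (h1 hx).2
    refine ax.star_mem (G := G.sub _ h) (H := H.sub _ h2) (K := H) hP (ax.vi H _ hle h2) ?_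
    rintro ⟨x, z⟩ a
    simp only [FPair.rel_diag]
    constructor
    · intro hx
      exact ⟨z, a, 1, hx, ⟨rfl, mem_p2.mpr ⟨_, hx.mem⟩, rfl⟩, mul_one a⟩
    · rintro ⟨y, b, c, hb, ⟨e, _, rfl⟩, rfl⟩
      obtain rfl : y = z := e
      rwa [mul_one]

omit ax in
theorem p1_le {G H : Obj 𝒢} {P : FPair A (G.1.amb × H.1.amb)} (hP : P ∈ lower S G H) :
    p1 P.dom ≤ G.grp := fun g hg => by
  obtain ⟨h, hh⟩ := mem_p1.mp hg
  exact (hP.1 hh).1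

/-- Axiom (ii) for 𝒮(p₁(P), H) handles h, but g need not lie in p₁(P). The conjugation by g is
obtained by composing with the isomorphism of `conj_diag`. -/
theorem lower_conj {G H : Obj 𝒢} {P : FPair A (G.1.amb × H.1.amb)} (hP : P ∈ lower S G H)
    (g : G.grp) (h : H.grp) : P.conj ((g : G.1.amb), (h : H.1.amb)) ∈ lower S G H := by
  have hP0 := hP
  obtain ⟨h1, h2, hP⟩ := hP
  have hP' := ax.ii _ _ _ hP 1 (one_mem _) h h.2
  have hp : ∀ x, x ∈ p1 (P.conj ((g : G.1.amb), (h : H.1.amb))).dom ↔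
      (g : G.1.amb)⁻¹ * x * g ∈ p1 P.dom := by
    intro x
    rw [mem_p1, mem_p1]
    simp only [FPair.mem_dom_iff, FPair.rel_conj]
    constructor
    · rintro ⟨y, a, hy⟩
      exact ⟨_, a, hy⟩
    · rintro ⟨y, a, hy⟩
      exact ⟨h * y * (h : H.1.amb)⁻¹, a, by simpa [mul_assoc] using hy⟩
  obtain ⟨h3, h4⟩ := ax.conj_diag h2 (p1_le hP0) g.2 hp
  refine ⟨?_, h3, ?_⟩
  · intro x hx
    obtain ⟨a, ha⟩ := FPair.exists_rel hx
    have := h1 (FPair.rel_conj.mp ha).mem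
    constructor
    · exact (Subgroup.mul_mem_cancel_left _ (G.grp.inv_mem g.2)).mp
        ((Subgroup.mul_mem_cancel_right _ g.2).mp this.1)
    · exact (Subgroup.mul_mem_cancel_left _ (H.grp.inv_mem h.2)).mp
        ((Subgroup.mul_mem_cancel_right _ h.2).mp this.2)
  · refine ax.star_mem (G := G.sub _ h3) (H := G.sub _ h2) (K := H) h4.1 hP'
      (show ∀ (x : G.1.amb × H.1.amb) (a : A), _ from ?_)
    rintro ⟨x, z⟩ a
    simp only [FPair.rel_diag_conj]
    simp only [FPair.rel_conj, Prod.mk_mul_mk, Prod.inv_mk]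
    constructor
    · intro hx
      exact ⟨(g : G.1.amb)⁻¹ * x * g, 1, a, ⟨by simp [mul_assoc], mem_p1.mpr ⟨_, hx.mem⟩, rfl⟩,
        by simpa [mul_assoc] using hx, one_mul a⟩
    · rintro ⟨y, b, c, ⟨rfl, _, rfl⟩, hy, rfl⟩
      rw [one_mul]
      simpa [mul_assoc] using hy

theorem lower_diag (G : Obj 𝒢) : FPair.diag G.grp ∈ lower S G G := by
  have e : p1 (FPair.diag G.grp : FPair A _).dom = G.grp := by
    ext g
    rw [mem_p1]
    simp only [FPair.mem_dom_iff, FPair.rel_diag]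
    exact ⟨fun ⟨_, _, _, h, _⟩ => h, fun h => ⟨g, 1, rfl, h, rfl⟩⟩
  have h : G.Mem (p1 (FPair.diag G.grp : FPair A _).dom) := by
    rw [e]
    exact G.2
  refine ⟨ax.fam G G _ (ax.i G), h, ?_⟩
  exact (mem_sub_left_iff (S := S) (G := G) (K := G.grp) (hK := G.2) (hK' := h) e.symm).mp
    (ax.i G)

/-- Axiom (iv) over the group p₁(P). The left group is by definition the image of L, so the
restricted pair projects onto it; `resLeft_adm` is the mirror image and rests on axiom (viii). -/
theorem resRight_adm {G H : Obj 𝒢} {P : FPair A (G.1.amb × H.1.amb)} (hP : P ∈ lower S G H)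
    {L : Subgroup H.1.amb} (hLH : L ≤ H.grp) (hL : H.Mem L) {K : Subgroup G.1.amb}
    (hK : ∀ g, g ∈ K ↔ ∃ h ∈ L, (g, h) ∈ P.dom) :
    ∃ h : G.Mem K, Adm S (G.sub K h) (H.sub L hL) (P.resRight L) := by
  obtain ⟨h1, h2, hP⟩ := hP
  obtain ⟨h3, h4⟩ := ax.iv (G.sub _ h2) H P hP L hLH hL
  have e : starRight P.dom L = K := Subgroup.ext fun g => (hK g).symm
  subst e
  refine ⟨h3, h4, fun g hg => ?_⟩
  obtain ⟨h, hh, hg⟩ := hg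
  refine ⟨h, ?_⟩
  obtain ⟨a, ha⟩ := FPair.exists_rel hg
  exact (FPair.rel_resRight.mpr ⟨ha, hh⟩).mem

theorem resLeft_adm {G H : Obj 𝒢} {P : FPair A (G.1.amb × H.1.amb)} (hP : P ∈ lower S G H)
    {K : Subgroup G.1.amb} (hKP : K ≤ p1 P.dom) (hK : G.Mem K) {L : Subgroup H.1.amb}
    (hL : ∀ h, h ∈ L ↔ ∃ g ∈ K, (g, h) ∈ P.dom) :
    ∃ h : H.Mem L, Adm S (G.sub K hK) (H.sub L h) (FPair.resLeft K P) := by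
  obtain ⟨h1, h2, hP⟩ := hP
  obtain ⟨h3, h4⟩ := (ax.viii (G.sub _ h2) H P hP).2 K hKP hK
  have e : starLeft K P.dom = L := Subgroup.ext fun g => (hL g).symm
  subst e
  refine ⟨h3, h4, fun g hg => ?_⟩
  obtain ⟨h, hh⟩ := mem_p1.mp (hKP hg)
  obtain ⟨a, ha⟩ := FPair.exists_rel hh
  exact ⟨h, (FPair.rel_resLeft.mpr ⟨ha, hg⟩).mem⟩

/-- Since p₁(P ∗ P') = P ∗ p₁(P'), the pair P is first restricted to p₁(P') and then composed by
(iii). -/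
theorem lower_star {G H K : Obj 𝒢} {P : FPair A (G.1.amb × H.1.amb)}
    {P' : FPair A (H.1.amb × K.1.amb)} (hP : P ∈ lower S G H) (hP' : P' ∈ lower S H K)
    {T : FPair A (G.1.amb × K.1.amb)} (hT : ∀ x a, T.Rel x a ↔
      ∃ h b c, P.Rel (x.1, h) b ∧ P'.Rel (h, x.2) c ∧ b * c = a) : T ∈ lower S G K := by
  obtain ⟨h1', h2', hP2⟩ := id hP'
  have hp : ∀ g, g ∈ p1 T.dom ↔ ∃ h ∈ p1 P'.dom, (g, h) ∈ P.dom := by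
    intro g
    simp only [mem_p1, FPair.mem_dom_iff, hT]
    constructor
    · rintro ⟨k, _, h, b, c, h₁, h₂, _⟩
      exact ⟨h, ⟨k, c, h₂⟩, b, h₁⟩
    · rintro ⟨h, ⟨k, c, h₂⟩, b, h₁⟩
      exact ⟨k, _, h, b, c, h₁, h₂, rfl⟩
  obtain ⟨h3, h4⟩ := ax.resRight_adm hP (p1_le hP') h2' hp
  refine ⟨?_, h3, ?_⟩
  · intro x hx
    obtain ⟨a, ha⟩ := FPair.exists_rel hx
    obtain ⟨h, b, c, h₁, h₂, _⟩ := (hT _ _).mp ha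
    exact ⟨(hP.1 h₁.mem).1, (hP'.1 h₂.mem).2⟩
  · refine ax.star_mem h4.1 hP2 fun x a => ?_
    rw [hT]
    simp only [FPair.rel_resRight]
    constructor
    · rintro ⟨h, b, c, h₁, h₂, e⟩
      exact ⟨h, b, c, ⟨h₁, mem_p1.mpr ⟨_, h₂.mem⟩⟩, h₂, e⟩
    · rintro ⟨h, b, c, ⟨h₁, _⟩, h₂, e⟩
      exact ⟨h, b, c, h₁, h₂, e⟩

theorem good_tensor {G H K : Obj 𝒢} {U : Biset A G H} {V : Biset A H K} (hU : Good (lower S) U)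
    (hV : Good (lower S) V) : Good (G := G) (H := K) (lower S) (tensor U V) := by
  intro w
  obtain ⟨u, v, rfl⟩ := (ax.rFree hU).exists_tmk w
  exact ax.lower_star (hU u) (hV v) fun x a => rel_bisetPair_tensor _

theorem good_basic {G H : Obj 𝒢} {P : FPair A (G.1.amb × H.1.amb)} (hP : P ∈ lower S G H) :
    Good (lower S) (basic G H P) := by
  intro u
  obtain ⟨q, rfl⟩ := exists_basicMk u
  rw [bisetPair_basic hP.1]
  exact ax.lower_conj hP q.1.1 q.1.2

/-- The Mackey formula with a single double coset: because P' projects onto H, the tensor product is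
transitive, and the stabilizing pair of the base point 1 ⊗ 1 is P ∗ P'. -/
theorem mk_tensor_basic {G H K : Obj 𝒢} {P : FPair A (G.1.amb × H.1.amb)}
    {P' : FPair A (H.1.amb × K.1.amb)} (hP : Adm S G H P) (hP' : Adm S H K P')
    {T : FPair A (G.1.amb × K.1.amb)} (hT : ∀ x a, T.Rel x a ↔
      ∃ h b c, P.Rel (x.1, h) b ∧ P'.Rel (h, x.2) c ∧ b * c = a) :
    IsoClass.mk (tensor (basic G H P) (basic H K P')) = IsoClass.mk (basic G K T) := by
  have hd := ax.fam _ _ _ hP.1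
  have hd' := ax.fam _ _ _ hP'.1
  -- Right freeness needs only that the stabilizing pairs, all conjugate to P, have trivial k₂, so
  -- the family of all such pairs is used.
  have hU : RFree (basic G H P) := by
    refine rFree_of_good (T := fun G' H' => {Q | ∀ h, ((1 : G'.1.amb), h) ∈ Q.dom → h = 1})
      (fun _ h => h) ?_
    intro u
    obtain ⟨q, rfl⟩ := exists_basicMk u
    rw [bisetPair_basic hd]
    intro h hh
    obtain ⟨a, ha⟩ := FPair.exists_rel hh
    have := (FPair.rel_conj.mp ha).mem
    have e := ax.eq_one hP.1 (h := ((q.1.2 : H.1.amb)⁻¹ * h * q.1.2)) (by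
      convert this using 1
      ext <;> simp [incl])
    rwa [mul_eq_one_iff_eq_inv, inv_mul_eq_iff_eq_mul, mul_inv_cancel] at e
  let u : (basic G H P).X := basicMk G H P 1
  let v : (basic H K P').X := basicMk H K P' 1
  have e : (tensor (basic G H P) (basic H K P')).stabPair (hU.tmk u v) = T.pull (incl G K) := by
    refine FPair.ext_rel fun x a => ?_
    have e1 : bisetPair (basic G H P) u = P := by
      refine (bisetPair_basic hd 1).trans (FPair.ext_rel fun x a => ?_)
      rw [FPair.rel_conj]
      simp
    have e2 : bisetPair (basic H K P') v = P' := by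
      refine (bisetPair_basic hd' 1).trans (FPair.ext_rel fun x a => ?_)
      rw [FPair.rel_conj]
      simp
    obtain ⟨g, k⟩ := x
    rw [FPair.rel_pull, hT, ← rel_bisetPair_coe (G := G) (H := K) (U := tensor _ _),
      rel_bisetPair_tensor, e1, e2]
    rfl
  have e3 : basic G K T = FibSet.trans (T.pull (incl G K)) := rfl
  rw [e3, ← e]
  refine FibSet.mk_eq_trans _ _ fun w => ?_
  obtain ⟨y, z, rfl⟩ := hU.exists_tmk w
  obtain ⟨⟨⟨g, h⟩, a⟩, rfl⟩ := exists_basicMk y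
  obtain ⟨⟨⟨h', k⟩, b⟩, rfl⟩ := exists_basicMk z
  -- Here surjectivity of P' onto H enters: h⁻¹h' lifts to (h⁻¹h', l) in P', with weight d.
  -- Correcting by l⁻¹ and d moves the base point to the given one.
  obtain ⟨l, hl⟩ := hP'.2 ((h⁻¹ * h' : H.grp) : H.1.amb) (h⁻¹ * h').2
  obtain ⟨d, hd''⟩ := FPair.exists_rel hl
  refine ⟨((g, k * (⟨l, (hd' hl).2⟩ : K.grp)⁻¹), d * b * a), ?_⟩
  rw [hU.smul_tmk, hU.tmk_eq]
  refine ⟨h, d * b, ?_, ?_⟩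
  · rw [smul_basicMk, smul_basicMk]
    refine congrArg _ ?_
    ext <;> simp [mul_assoc]
  · rw [smul_basicMk, smul_basicMk, basicMk_eq]
    convert hd'' using 1
    · simp [incl]
    · simp

end Axioms

/-! ### Evaluation of a functor at the classes of transitive bisets -/

section Eval

variable {R : Type w} [CommRing R] {S : Family A 𝒢} {M : Obj 𝒢 → Type v}
  [∀ G, AddCommGroup (M G)] [∀ G, Module R (M G)] (F : FibFunctor S R M) (ax : Axioms S)

include ax

theorem ev_diag_self (G : Obj 𝒢) (m : M G) : F.ev G G (FPair.diag G.grp) m = m := by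
  have h : cls R (basic G G (FPair.diag G.grp)) ∈ homR R S G G :=
    Submodule.subset_span ⟨_, ax.i G, rfl⟩
  rw [FibFunctor.ev, dif_pos h, F.map_id]
  rfl

/-- Functoriality applied to `Axioms.mk_tensor_basic`. All three classes are morphisms of the
category, so the default value in `FibFunctor.ev` never occurs. -/
theorem ev_star {G H K : Obj 𝒢} {P : FPair A (G.1.amb × H.1.amb)}
    {P' : FPair A (H.1.amb × K.1.amb)} (hP : Adm S G H P) (hP' : Adm S H K P')
    {T : FPair A (G.1.amb × K.1.amb)} (hT : ∀ x a, T.Rel x a ↔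
      ∃ h b c, P.Rel (x.1, h) b ∧ P'.Rel (h, x.2) c ∧ b * c = a) (m : M K) :
    F.ev G H P (F.ev H K P' m) = F.ev G K T m := by
  have h1 : cls R (basic G H P) ∈ homR R S G H := Submodule.subset_span ⟨_, hP.1, rfl⟩
  have h2 : cls R (basic H K P') ∈ homR R S H K := Submodule.subset_span ⟨_, hP'.1, rfl⟩
  have h3 : cls R (basic G K T) ∈ homR R S G K :=
    Submodule.subset_span ⟨_, ax.star_mem hP.1 hP'.1 hT, rfl⟩
  have e : compR R (cls R (basic G H P)) (cls R (basic H K P')) = cls R (basic G K T) :=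
    (compR_cls R _ _).trans (cls_eq_of_mk_eq R (ax.mk_tensor_basic hP hP' hT))
  have := F.map_comp G H K ⟨_, h1⟩ ⟨_, h2⟩ (e ▸ h3)
  rw [FibFunctor.ev, FibFunctor.ev, FibFunctor.ev, dif_pos h1, dif_pos h2, dif_pos h3]
  rw [← LinearMap.comp_apply, ← this]
  simp only [e]

end Eval

end Data

/-! ### From maps attached to bisets to linear functors. -/

section FunctorConstruction

variable {A : Type u} [CommGroup A] {𝒢 : GroupClass.{u}} {R : Type w} [CommRing R]
  {S T : Family A 𝒢} {N : Obj 𝒢 → Type*} [∀ G, AddCommGroup (N G)] [∀ G, Module R (N G)]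

theorem FibFunctor.ext_map {F₁ F₂ : FibFunctor T R N} (h : F₁.map = F₂.map) : F₁ = F₂ := by
  obtain ⟨f₁, _, _⟩ := F₁
  obtain ⟨f₂, _, _⟩ := F₂
  obtain rfl : f₁ = f₂ := h
  rfl

/-- Two linear maps on the morphisms that agree on the classes of bisets with stabilizing pairs in
the family agree. -/
theorem Axioms.homR_ext (ax : Axioms S) {G H : Obj 𝒢} {B : Type*} [AddCommMonoid B] [Module R B]
    {f g : homR R (lower S) G H →ₗ[R] B}
    (h : ∀ (U : Biset A G H) (hU : Good (lower S) U),
      f ⟨cls R U, cls_mem_homR R hU⟩ = g ⟨cls R U, cls_mem_homR R hU⟩) : f = g := by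
  ext ⟨b, hb⟩
  have hb' := hb
  induction hb using Submodule.span_induction with
  | mem b hP =>
    obtain ⟨P, hP, rfl⟩ := hP
    exact h _ (ax.good_basic hP)
  | zero =>
    exact (map_zero f).trans (map_zero g).symm
  | add x y hx hy ex ey =>
    exact (map_add f ⟨x, hx⟩ ⟨y, hy⟩).trans
      ((congrArg₂ (· + ·) (ex hx) (ey hy)).trans (map_add g ⟨x, hx⟩ ⟨y, hy⟩).symm)
  | smul r x hx ex =>
    exact (map_smul f r ⟨x, hx⟩).trans
      ((congrArg (r • ·) (ex hx)).trans (map_smul g r ⟨x, hx⟩).symm)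

theorem Axioms.functor_ext (ax : Axioms S) {F₁ F₂ : FibFunctor (lower S) R N}
    (h : ∀ (G H : Obj 𝒢) (U : Biset A G H) (hU : Good (lower S) U),
      F₁.map G H ⟨cls R U, cls_mem_homR R hU⟩ = F₂.map G H ⟨cls R U, cls_mem_homR R hU⟩) :
    F₁ = F₂ :=
  FibFunctor.ext_map (funext fun G => funext fun H => ax.homR_ext (h G H))

theorem push_conj {G H : Obj 𝒢} (q : G.grp × H.grp) (P : FPair A (G.grp × H.grp)) :
    (P.conj q).push (incl G H) (incl_injective G H) =
      (P.push (incl G H) (incl_injective G H)).conj ((q.1 : G.1.amb), (q.2 : H.1.amb)) := by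
  refine FPair.ext_rel fun x a => ?_
  rw [FPair.rel_conj, FPair.rel_push, FPair.rel_push]
  constructor
  · rintro ⟨y, rfl, hy⟩
    exact ⟨_, rfl, FPair.rel_conj.mp hy⟩
  · rintro ⟨y, e, hy⟩
    refine ⟨q * y * q⁻¹, ?_, FPair.rel_conj.mpr ?_⟩
    · rw [map_mul, map_mul, e, map_inv]
      change ((q.1 : G.1.amb), (q.2 : H.1.amb)) * _ * ((q.1 : G.1.amb), (q.2 : H.1.amb))⁻¹ = x
      group
    · convert hy using 1
      group

/-- An assignment of linear maps to the bisets with stabilizing pairs in `𝒮₊` that is additive on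
disjoint unions and compatible with tensor products extends to a linear functor. -/
theorem Axioms.exists_functor (ax : Axioms S)
    (Ψ : ∀ (G H : Obj 𝒢) (U : Biset A G H), Good (lower S) U → N H →ₗ[R] N G)
    (hadd : ∀ (G H : Obj 𝒢) (U V W : Biset A G H) (hU : Good (lower S) U) (hV : Good (lower S) V)
      (hW : Good (lower S) W) (i : U.X → W.X) (j : V.X → W.X),
      FibSet.IsUnion (A := A) (Q := G.grp × H.grp) i j → Ψ G H W hW = Ψ G H U hU + Ψ G H V hV)
    (hid : ∀ (G : Obj 𝒢) (h : Good (lower S) (basic G G (FPair.diag G.grp))),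
      Ψ G G (basic G G (FPair.diag G.grp)) h = LinearMap.id)
    (hcomp : ∀ (G H K : Obj 𝒢) (U : Biset A G H) (V : Biset A H K) (hU : Good (lower S) U)
      (hV : Good (lower S) V),
      Ψ G K (tensor U V) (ax.good_tensor hU hV) = Ψ G H U hU ∘ₗ Ψ H K V hV) :
    ∃ Fc : FibFunctor (lower S) R N, ∀ (G H : Obj 𝒢) (U : Biset A G H) (hU : Good (lower S) U),
      Fc.map G H ⟨cls R U, cls_mem_homR R hU⟩ = Ψ G H U hU := by
  have ex : ∀ G H : Obj 𝒢, ∃ Φ : BR A (G.grp × H.grp) R →ₗ[R] (N H →ₗ[R] N G),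
      ∀ (U : Biset A G H) (hU : Good (lower S) U), Φ (cls R U) = Ψ G H U hU := fun G H =>
    exists_linear_extension R
      (fun P => P.push (incl G H) (incl_injective G H) ∈ lower S G H)
      (fun q P hP => by
        rw [push_conj]
        exact ax.lower_conj hP q.1 q.2) (Ψ G H) (hadd G H)
  choose Φ hΦ using ex
  have hdiag : ∀ G : Obj 𝒢, Good (lower S) (basic G G (FPair.diag G.grp)) := fun G =>
    ax.good_basic (ax.lower_diag G)
  -- Bilinearity reduces this to transitive bisets. Their tensor product need not be transitive,
  -- which is why the value of `Φ` on all good bisets is required.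
  have key : ∀ (G H K : Obj 𝒢) (a : BR A (G.grp × H.grp) R) (b : BR A (H.grp × K.grp) R),
      a ∈ homR R (lower S) G H → b ∈ homR R (lower S) H K →
      Φ G K (compR R a b) = Φ G H a ∘ₗ Φ H K b := by
    intro G H K a b ha hb
    induction ha using Submodule.span_induction with
    | zero => simp
    | add x y _ _ ex ey => simp [ex, ey, LinearMap.add_comp]
    | smul r x _ ex => simp [ex, LinearMap.smul_comp]
    | mem a hP =>
      obtain ⟨P, hP, rfl⟩ := hP
      induction hb using Submodule.span_induction with
      | zero => simp
      | add x y _ _ ex ey => simp [ex, ey, LinearMap.comp_add]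
      | smul r x _ ex => simp [ex, LinearMap.comp_smul]
      | mem b hP' =>
        obtain ⟨P', hP', rfl⟩ := hP'
        have h1 := ax.good_basic hP
        have h2 := ax.good_basic hP'
        rw [hΦ G H _ h1, hΦ H K _ h2, compR_cls]
        exact (hΦ G K _ (ax.good_tensor h1 h2)).trans (hcomp G H K _ _ h1 h2)
  refine ⟨⟨fun G H => Φ G H ∘ₗ Submodule.subtype _, ?_, ?_⟩, ?_⟩
  · intro G h
    exact (hΦ G G _ (hdiag G)).trans (hid G _)
  · intro G H K a b h
    exact key G H K a.1 b.1 a.2 b.2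
  · intro G H U hU
    exact hΦ G H U hU

end FunctorConstruction

/-! ### The module F₊(G) and the section U(s). -/

section LowerPlus

variable {A : Type u} [CommGroup A] {𝒢 : GroupClass.{u}} {R : Type w} [CommRing R]
  {S : Family A 𝒢} {M : Obj 𝒢 → Type v} [∀ G, AddCommGroup (M G)] [∀ G, Module R (M G)]
  {F : FibFunctor S R M}

/-- Composition of the values of a functor at the classes of transitive bisets, for subgroups of
fixed ambient groups. -/
theorem ev_comp (ax : Axioms S) {G H K : Obj 𝒢} {L₁ : Subgroup G.1.amb} {L₂ : Subgroup H.1.amb}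
    {L₃ : Subgroup K.1.amb} {h₁ : G.Mem L₁} {h₂ : H.Mem L₂} {h₃ : K.Mem L₃}
    {P : FPair A (G.1.amb × H.1.amb)} {P' : FPair A (H.1.amb × K.1.amb)}
    (hP : Adm S (G.sub L₁ h₁) (H.sub L₂ h₂) P) (hP' : Adm S (H.sub L₂ h₂) (K.sub L₃ h₃) P')
    {T : FPair A (G.1.amb × K.1.amb)} (hT : ∀ (g : G.1.amb) (k : K.1.amb) (a : A),
      T.Rel (g, k) a ↔ ∃ (h : H.1.amb) (b c : A), P.Rel (g, h) b ∧ P'.Rel (h, k) c ∧ b * c = a)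
    (m : M (K.sub L₃ h₃)) :
    F.ev (G.sub L₁ h₁) (H.sub L₂ h₂) P (F.ev (H.sub L₂ h₂) (K.sub L₃ h₃) P' m) =
      F.ev (G.sub L₁ h₁) (K.sub L₃ h₃) T m :=
  ev_star F ax hP hP' (fun x a => hT x.1 x.2 a) m

theorem stabMem_adm_conj (ax : Axioms S) {G : Obj 𝒢} {X : GSet A G} (hX : StabMem X) (g : G.grp)
    (a : A) (x : X.X) : Adm S (G.sub _ (hX ((g, a) • x))) (G.sub _ (hX x))
      ((FPair.diag (setPair X x).dom).conj ((g : G.1.amb), 1)) :=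
  (ax.conj_diag (hX x) (setPair_dom_le X x) g.2 (K' := (setPair X ((g, a) • x)).dom) fun y => by
    rw [setPair_smul]
    simp only [FPair.mem_dom_iff, FPair.rel_conj]).2

/-! ### Morphisms of sections -/

/-- Transport along an equality of subgroups becomes evaluation at a diagonal pair, so `ev_comp` can
absorb it. Once the subgroups are identified, this is the identity law of F. -/
theorem cast_eq_ev (ax : Axioms S) {G : Obj 𝒢} {K K' : Subgroup G.1.amb} (hK : G.Mem K)
    (hK' : G.Mem K') (e : K' = K) (h : G.sub K hK = G.sub K' hK') (m : M (G.sub K hK)) :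
    cast (congrArg M h) m = F.ev (G.sub K' hK') (G.sub K hK) (FPair.diag K) m := by
  subst e
  exact (ev_diag_self F ax (G.sub K' hK) m).symm

theorem sub_inj {G : Obj 𝒢} {K K' : Subgroup G.1.amb} {hK : G.Mem K} {hK' : G.Mem K'}
    (h : G.sub K hK = G.sub K' hK') : K = K' := by
  have h1 : (⟨G.1.amb, K⟩ : SubGrp.{u}) = ⟨G.1.amb, K'⟩ := congrArg Subtype.val h
  rw [SubGrp.mk.injEq] at h1
  exact eq_of_heq h1.2.2

theorem SecObj.isHom_of (ax : Axioms S) {G : Obj 𝒢} {X Y : SecObj F G} {f : X.X.X → Y.X.X}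
    (hf : Equivariant A G.grp f) (hd : ∀ x, (setPair Y.X (f x)).dom = (setPair X.X x).dom)
    (hs : ∀ x, Y.s.1 (f x) =
      F.ev (Y.stabObj (f x)) (X.stabObj x) (FPair.diag (setPair X.X x).dom) (X.s.1 x)) :
    X.IsHom Y f := by
  have e : ∀ x, X.stabObj x = Y.stabObj (f x) := fun x =>
    Subtype.ext (congrArg (fun K => (⟨G.1.amb, K⟩ : SubGrp.{u})) (hd x).symm)
  refine ⟨hf, fun x => ⟨e x, ?_⟩⟩
  rw [hs]
  exact cast_eq_ev ax (X.mem x) (Y.mem (f x)) (hd x) (e x) _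

theorem SecObj.IsHom.dom_eq {G : Obj 𝒢} {X Y : SecObj F G} {f : X.X.X → Y.X.X}
    (h : X.IsHom Y f) (x : X.X.X) : (setPair Y.X (f x)).dom = (setPair X.X x).dom :=
  (sub_inj (h.2 x).1).symm

theorem SecObj.IsHom.pair_eq {G : Obj 𝒢} {X Y : SecObj F G} {f : X.X.X → Y.X.X}
    (h : X.IsHom Y f) (x : X.X.X) : setPair X.X x = setPair Y.X (f x) :=
  FPair.eq_of_le_of_dom (setPair_le_map h.1 x) (h.dom_eq x).le

theorem SecObj.IsHom.sec_eq (ax : Axioms S) {G : Obj 𝒢} {X Y : SecObj F G} {f : X.X.X → Y.X.X}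
    (h : X.IsHom Y f) (x : X.X.X) : Y.s.1 (f x) =
      F.ev (Y.stabObj (f x)) (X.stabObj x) (FPair.diag (setPair X.X x).dom) (X.s.1 x) := by
  obtain ⟨e, he⟩ := h.2 x
  rw [← he]
  exact cast_eq_ev ax (X.mem x) (Y.mem (f x)) (h.dom_eq x) e _

theorem SecObj.isHom_id {G : Obj 𝒢} (X : SecObj F G) : X.IsHom X id :=
  ⟨fun _ _ => rfl, fun _ => ⟨rfl, rfl⟩⟩

variable (F) in
/-- The empty fibered set, with its only section. -/
def SecObj.empty (G : Obj 𝒢) : SecObj F G where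
  X := FibSet.empty A G.grp
  mem x := PEmpty.elim x
  s := ⟨fun x => PEmpty.elim x, fun _ _ x => PEmpty.elim x⟩

theorem SecObj.isCoprod_empty {G : Obj 𝒢} {X Y : SecObj F G} {f : X.X.X → Y.X.X}
    (h : X.IsHom Y f) (hb : Function.Bijective f) : X.IsCoprod (SecObj.empty F G) Y :=
  ⟨f, fun x => PEmpty.elim x, h, ⟨fun _ x => PEmpty.elim x, fun x => PEmpty.elim x⟩,
    (isUnion_empty f h.1 hb).2.2⟩

theorem SecObj.cl_of_isCoprod {G : Obj 𝒢} {X Y Z : SecObj F G} (h : X.IsCoprod Y Z) :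
    Z.cl = X.cl + Y.cl := by
  rw [← sub_eq_iff_eq_add', ← sub_eq_zero]
  refine (QuotientAddGroup.eq_zero_iff _).mpr ?_
  exact AddSubgroup.subset_closure (Or.inl ⟨X, Y, Z, h, rfl⟩)

theorem SecObj.cl_of_iso {G : Obj 𝒢} {X Y : SecObj F G} {f : X.X.X → Y.X.X}
    (h : X.IsHom Y f) (hb : Function.Bijective f) : X.cl = Y.cl :=
  congrArg (fun c => (QuotientAddGroup.mk (FreeAbelianGroup.of c) : LowerPlus F G))
    (Quot.sound ⟨f, h, hb⟩ : (Quot.mk _ X : SecClass F G) = Quot.mk _ Y)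

theorem smul_cl {G : Obj 𝒢} (r : R) (X : SecObj F G) : r • X.cl = (X.scale r).cl :=
  scalePlus_cl r X

theorem lowerPlus_ext {G : Obj 𝒢} {B : Type*} [AddCommGroup B] [Module R B]
    {f g : LowerPlus F G →ₗ[R] B} (h : ∀ X : SecObj F G, f X.cl = g X.cl) : f = g :=
  LinearMap.toAddMonoidHom_injective (lowerPlus_hom_ext h)

/-- The universal property of `F₊(G)`. -/
theorem exists_lowerPlus_lift {G : Obj 𝒢} {B : Type*} [AddCommGroup B] [Module R B]
    (φ : SecObj F G → B) (hc : ∀ X Y Z : SecObj F G, X.IsCoprod Y Z → φ Z = φ X + φ Y)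
    (ha : ∀ (X : GSet A G) (hX : StabMem X) (s r : Sec F X hX),
      φ ⟨X, hX, s + r⟩ = φ ⟨X, hX, s⟩ + φ ⟨X, hX, r⟩)
    (hs : ∀ (r : R) (X : SecObj F G), φ (X.scale r) = r • φ X) :
    ∃ f : LowerPlus F G →ₗ[R] B, ∀ X : SecObj F G, f X.cl = φ X := by
  -- The empty set is its own double, so additivity kills it. Invariance of `φ` under isomorphism
  -- then follows by adding an empty summand.
  have h0 : φ (SecObj.empty F G) = 0 := left_eq_add.mp
    (hc _ _ _ (SecObj.isCoprod_empty (SecObj.isHom_id (SecObj.empty F G)) Function.bijective_id))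
  let φ' : SecClass F G → B := Quot.lift φ (by
    rintro X Y ⟨f, hf, hb⟩
    rw [hc _ _ _ (SecObj.isCoprod_empty hf hb), h0, add_zero])
  let f₀ : FreeAbelianGroup (SecClass F G) →+ B := FreeAbelianGroup.lift φ'
  have hf₀ : ∀ X : SecObj F G, f₀ X.gen = φ X := fun X => FreeAbelianGroup.lift_apply_of φ' _
  have hle : lowerRel F G ≤ f₀.ker := by
    refine (AddSubgroup.closure_le _).mpr ?_
    rintro z (⟨X, Y, Z, h, rfl⟩ | ⟨X, hX, s, r, rfl⟩)
    · change f₀ _ = 0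
      rw [map_sub, map_sub, hf₀, hf₀, hf₀, hc _ _ _ h]
      abel
    · change f₀ _ = 0
      rw [map_sub, map_sub, hf₀, hf₀, hf₀, ha]
      abel
  let f₁ : LowerPlus F G →+ B := QuotientAddGroup.lift (lowerRel F G) f₀ hle
  have hf₁ : ∀ X : SecObj F G, f₁ X.cl = φ X := hf₀
  refine ⟨{ f₁ with map_smul' := fun r z => ?_ }, hf₁⟩
  refine DFunLike.congr_fun (f := f₁.comp (scalePlus F G r))
    (g := (DistribSMul.toAddMonoidHom B r).comp f₁) (lowerPlus_hom_ext fun X => ?_) z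
  change f₁ (scalePlus F G r X.cl) = r • f₁ X.cl
  rw [scalePlus_cl, hf₁, hf₁, hs]

/-! ### The section on a tensor product -/

section TensorObj

variable (ax : Axioms S) {G H : Obj 𝒢} {U : Biset A G H} (hU : Good (lower S) U)

include ax hU

/-- The stabilizer of u ⊗ x is (G × H)_u ∗ H_x, the left group for which `Axioms.resRight_adm` gives
an admissible pair. -/
theorem adm_tensor {X : GSet A H} (hX : StabMem X) {u : U.X} {x : X.X} {w : (tensorLeft U X).X}
    (e : (ax.rFree hU).tmkL u x = w) :
    ∃ h : G.Mem (setPair (tensorLeft U X) w).dom,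
      Adm S (G.sub _ h) (H.sub _ (hX x)) ((bisetPair U u).resRight (setPair X x).dom) := by
  subst e
  refine ax.resRight_adm (hU u) (setPair_dom_le X x) (hX x) fun g => ?_
  simp only [FPair.mem_dom_iff, rel_setPair_tensor]
  constructor
  · rintro ⟨_, h, b, c, h₁, h₂, _⟩
    exact ⟨h, ⟨c, h₂⟩, b, h₁⟩
  · rintro ⟨h, ⟨c, h₂⟩, b, h₁⟩
    exact ⟨_, h, b, c, h₁, h₂, rfl⟩

theorem stabMem_tensor {X : GSet A H} (hX : StabMem X) : StabMem (tensorLeft U X) := by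
  intro w
  obtain ⟨u, x, e⟩ := (ax.rFree hU).exists_tmkL w
  exact (adm_tensor ax hU hX e).1

/-- Two representatives differ by some (h, a). This conjugates P_u by (1, h) and replaces s(x) by
its conjugate under h; the two changes cancel on composing with the conjugation isomorphism. -/
theorem tensor_val_indep (X : SecObj F H) {u u' : U.X} {x x' : X.X.X} {w : (tensorLeft U X.X).X}
    (e : (ax.rFree hU).tmkL u x = w) (e' : (ax.rFree hU).tmkL u' x' = w) :
    F.ev (G.sub _ (stabMem_tensor ax hU X.mem w)) (X.stabObj x)
        ((bisetPair U u).resRight (setPair X.X x).dom) (X.s.1 x) =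
      F.ev (G.sub _ (stabMem_tensor ax hU X.mem w)) (X.stabObj x')
        ((bisetPair U u').resRight (setPair X.X x').dom) (X.s.1 x') := by
  obtain ⟨h, a, rfl, rfl⟩ := (ax.rFree hU).tmkL_eq.mp (e.trans e'.symm)
  rw [← X.s.2 h a x]
  symm
  refine ev_comp ax (adm_tensor ax hU X.mem e').2 (stabMem_adm_conj ax X.mem h a x)
    (fun g k b => ?_) _
  simp only [bisetPair_smul, setPair_smul, FPair.rel_diag_conj]
  simp only [FPair.rel_resRight, FPair.rel_conj, FPair.mem_dom_iff]
  simp only [Prod.inv_mk, Prod.mk_mul_mk, OneMemClass.coe_one, inv_one, one_mul, mul_one]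
  constructor
  · rintro ⟨h₁, h₂⟩
    exact ⟨h * k * (h : H.1.amb)⁻¹, b, 1, ⟨by simpa [mul_assoc] using h₁,
      by simpa [mul_assoc] using h₂⟩, ⟨rfl, h₂, rfl⟩, mul_one b⟩
  · rintro ⟨y, c, d, ⟨h₁, h₂⟩, ⟨rfl, h₃, rfl⟩, rfl⟩
    exact ⟨by simpa [mul_assoc] using h₁, h₃⟩

/-- The point `(u, x)` chosen to represent `w ∈ U ⊗_{AH} X`. -/
noncomputable def tensorRep (X : GSet A H) (w : (tensorLeft U X).X) : U.X × X.X :=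
  (((ax.rFree hU).exists_tmkL w).choose, ((ax.rFree hU).exists_tmkL w).choose_spec.choose)

theorem tensorRep_spec (X : GSet A H) (w : (tensorLeft U X).X) :
    (ax.rFree hU).tmkL (tensorRep ax hU X w).1 (tensorRep ax hU X w).2 = w :=
  ((ax.rFree hU).exists_tmkL w).choose_spec.choose_spec

/-- The value of the section `U(s)` at a point of `U ⊗_{AH} X`. -/
noncomputable def tensorVal (X : SecObj F H) (w : (tensorLeft U X.X).X) :
    M (G.sub _ (stabMem_tensor ax hU X.mem w)) :=
  F.ev (G.sub _ (stabMem_tensor ax hU X.mem w)) (X.stabObj (tensorRep ax hU X.X w).2)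
    ((bisetPair U (tensorRep ax hU X.X w).1).resRight
      (setPair X.X (tensorRep ax hU X.X w).2).dom) (X.s.1 (tensorRep ax hU X.X w).2)

theorem tensorVal_eq (X : SecObj F H) {u : U.X} {x : X.X.X} {w : (tensorLeft U X.X).X}
    (e : (ax.rFree hU).tmkL u x = w) :
    tensorVal ax hU X w = F.ev (G.sub _ (stabMem_tensor ax hU X.mem w)) (X.stabObj x)
        ((bisetPair U u).resRight (setPair X.X x).dom) (X.s.1 x) :=
  tensor_val_indep ax hU X (tensorRep_spec ax hU X.X w) e

theorem tensorVal_mem (X : SecObj F H) :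
    tensorVal ax hU X ∈ Sec F (tensorLeft U X.X) (stabMem_tensor ax hU X.mem) := by
  intro g a w
  obtain ⟨u, x, e⟩ := (ax.rFree hU).exists_tmkL w
  have e' : (ax.rFree hU).tmkL (((g, (1 : H.grp)), a) • u) x = (g, a) • w := by
    rw [← e, RFree.smul_tmkL]
  rw [tensorVal_eq ax hU X e, tensorVal_eq ax hU X e']
  refine ev_comp ax (stabMem_adm_conj ax (stabMem_tensor ax hU X.mem) g a w)
    (adm_tensor ax hU X.mem e).2 (fun y k b => ?_) _
  simp only [bisetPair_smul, FPair.rel_diag_conj]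
  simp only [FPair.rel_resRight, FPair.rel_conj]
  simp only [Prod.inv_mk, Prod.mk_mul_mk, OneMemClass.coe_one, inv_one, one_mul, mul_one]
  constructor
  · rintro ⟨h₁, h₂⟩
    refine ⟨(g : G.1.amb)⁻¹ * y * g, 1, b, ⟨by simp [mul_assoc], ?_, rfl⟩, ⟨h₁, h₂⟩, one_mul b⟩
    obtain ⟨c, hc⟩ := FPair.exists_rel h₂
    subst e
    exact (rel_setPair_tensor (ax.rFree hU)).mpr ⟨k, b, c, h₁, hc, rfl⟩ |>.mem
  · rintro ⟨z, c, d, ⟨rfl, h₃, rfl⟩, ⟨h₁, h₂⟩, rfl⟩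
    rw [one_mul]
    exact ⟨by simpa [mul_assoc] using h₁, h₂⟩

/-- The object `(U ⊗_{AH} X, U(s))`. -/
noncomputable def tensorObj (X : SecObj F H) : SecObj F G :=
  ⟨tensorLeft U X.X, stabMem_tensor ax hU X.mem, ⟨tensorVal ax hU X, tensorVal_mem ax hU X⟩⟩

end TensorObj

end LowerPlus

/-! ### The functor F₊. -/

section LowerFunctor

variable {A : Type u} [CommGroup A] {𝒢 : GroupClass.{u}} {R : Type w} [CommRing R]
  {S : Family A 𝒢} {M : Obj 𝒢 → Type v} [∀ G, AddCommGroup (M G)] [∀ G, Module R (M G)]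
  {F : FibFunctor S R M}

section TensorMap

variable {G H : Type u} [Group G] [Group H] {U U' : FibSet A (G × H)} {X X' : FibSet A H}
  {f : U.X → U'.X} {k : X.X → X'.X} (hf : Equivariant A (G × H) f) (hfi : Function.Injective f)
  (hk : Equivariant A H k) (hki : Function.Injective k)

/-- The map `u ⊗ x ↦ f(u) ⊗ k(x)`. -/
def tensorMap : (tensorLeft U X).X → (tensorLeft U' X').X :=
  FreeOrb.map (A := A) (N := H) (Q := G) (Y₁ := PairSetLeft U X) (Y := PairSetLeft U' X')
    (fun y => (f y.1, k y.2)) (fun _ _ => Prod.ext (hf _ _) (hk _ _))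
    fun _ _ e => Prod.ext (hfi (congrArg Prod.fst e)) (hki (congrArg Prod.snd e))

theorem tensorMap_tmkL (hU : RFree U) (hU' : RFree U') (u : U.X) (x : X.X) :
    tensorMap hf hfi hk hki (hU.tmkL u x) = hU'.tmkL (f u) (k x) := rfl

theorem tensorMap_equivariant : Equivariant A G (tensorMap hf hfi hk hki) := by
  rintro q ⟨⟨y⟩, hy⟩
  exact Subtype.ext (congrArg (Quotient.mk _) (Prod.ext (hf _ _) (hk _ _)))

theorem tensorMap_injective : Function.Injective (tensorMap hf hfi hk hki) := by
  rintro ⟨⟨y⟩, hy⟩ ⟨⟨z⟩, hz⟩ e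
  refine Subtype.ext ((BalOrb.mk_map_eq (A := A) (N := H) (Q := G) (Y₁ := PairSetLeft U X)
    (Y := PairSetLeft U' X') (fun y => (f y.1, k y.2)) (fun _ _ => Prod.ext (hf _ _) (hk _ _))
    fun _ _ e => Prod.ext (hfi (congrArg Prod.fst e)) (hki (congrArg Prod.snd e))).mp
      (congrArg Subtype.val e))

end TensorMap

theorem bijective_sumElim {α β γ : Type*} {i : α → γ} {j : β → γ} (hi : Function.Injective i)
    (hj : Function.Injective j) (hd : ∀ a b, i a ≠ j b) (hs : ∀ c, (∃ a, i a = c) ∨ ∃ b, j b = c) :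
    Function.Bijective (Sum.elim i j) :=
  ⟨hi.sumElim hj hd, fun c => (hs c).elim (fun ⟨a, h⟩ => ⟨Sum.inl a, h⟩)
    fun ⟨b, h⟩ => ⟨Sum.inr b, h⟩⟩

variable (ax : Axioms S)

section Maps

variable {G H : Obj 𝒢} {U U' : Biset A G H} (hU : Good (lower S) U) (hU' : Good (lower S) U')

/-- Injectivity preserves the stabilizing pairs of u, of x and of u ⊗ x. Both sections are then F at
the same restricted pair, up to the diagonals identifying equal stabilizers. -/
theorem tensorMap_isHom {X X' : SecObj F H} {f : U.X → U'.X} {k : X.X.X → X'.X.X}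
    (hf : Equivariant A (G.grp × H.grp) f) (hfi : Function.Injective f) (hk : X.IsHom X' k)
    (hki : Function.Injective k) :
    (tensorObj ax hU X).IsHom (tensorObj ax hU' X') (tensorMap hf hfi hk.1 hki) := by
  refine SecObj.isHom_of ax (tensorMap_equivariant hf hfi hk.1 hki) (fun w => ?_) (fun w => ?_)
  · exact congrArg FPair.dom (setPair_map (X := (tensorObj ax hU X).X)
      (Y := (tensorObj ax hU' X').X) (tensorMap_equivariant hf hfi hk.1 hki)
      (tensorMap_injective hf hfi hk.1 hki) w).symm
  · obtain ⟨u, x, e⟩ := (ax.rFree hU).exists_tmkL w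
    have e' : (ax.rFree hU').tmkL (f u) (k x) = tensorMap hf hfi hk.1 hki w := by
      rw [← e, tensorMap_tmkL hf hfi hk.1 hki (ax.rFree hU) (ax.rFree hU')]
    refine (tensorVal_eq ax hU' X' e').trans
      (Eq.trans ?_ (congrArg _ (tensorVal_eq ax hU X e).symm))
    have ha := adm_tensor ax hU X.mem e
    have ha' := adm_tensor ax hU' X'.mem e'
    have hp : setPair (tensorLeft U X.X) w =
        setPair (tensorLeft U' X'.X) (tensorMap hf hfi hk.1 hki w) :=
      setPair_map (X := (tensorObj ax hU X).X)
      (Y := (tensorObj ax hU' X').X) (tensorMap_equivariant hf hfi hk.1 hki)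
      (tensorMap_injective hf hfi hk.1 hki) w
    have hd1 : Adm S (G.sub _ ((tensorObj ax hU' X').mem (tensorMap hf hfi hk.1 hki w)))
        (G.sub _ ((tensorObj ax hU X).mem w)) (FPair.diag (setPair (tensorLeft U X.X) w).dom) :=
      ax.adm_diag_of_eq (congrArg FPair.dom hp) _ _
    have hd2 : Adm S (X'.stabObj (k x)) (X.stabObj x) (FPair.diag (setPair X.X x).dom) :=
      ax.adm_diag_of_eq (hk.dom_eq x).symm _ _
    rw [hk.sec_eq ax x]
    refine (ev_comp ax ha'.2 hd2 (T := (bisetPair U u).resRight (setPair X.X x).dom) ?_ _).trans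
      (ev_comp ax hd1 ha.2 ?_ _).symm
    · intro g y a
      rw [hk.dom_eq x, ← bisetPair_map hf hfi]
      simp only [FPair.rel_diag, FPair.rel_resRight]
      constructor
      · rintro ⟨h₁, h₂⟩
        exact ⟨y, a, 1, ⟨h₁, h₂⟩, ⟨rfl, h₂, rfl⟩, mul_one a⟩
      · rintro ⟨h, b, c, ⟨h₁, h₂⟩, ⟨rfl, h₃, rfl⟩, rfl⟩
        rw [mul_one]
        exact ⟨h₁, h₂⟩
    · intro g y a
      simp only [FPair.rel_diag, FPair.rel_resRight]
      constructor
      · rintro ⟨h₁, h₂⟩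
        refine ⟨g, 1, a, ⟨rfl, ?_, rfl⟩, ⟨h₁, h₂⟩, one_mul a⟩
        obtain ⟨c, hc⟩ := FPair.exists_rel h₂
        subst e
        exact ((rel_setPair_tensor (ax.rFree hU)).mpr ⟨y, a, c, h₁, hc, rfl⟩).mem
      · rintro ⟨h, b, c, ⟨rfl, h₃, rfl⟩, ⟨h₁, h₂⟩, rfl⟩
        rw [one_mul]
        exact ⟨h₁, h₂⟩

theorem tensorObj_isCoprod_right {X Y Z : SecObj F H} (h : X.IsCoprod Y Z) :
    (tensorObj ax hU X).IsCoprod (tensorObj ax hU Y) (tensorObj ax hU Z) := by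
  obtain ⟨i, j, hi, hj, hb⟩ := h
  have hii : Function.Injective i := fun x y e =>
    Sum.inl_injective (hb.1 (a₁ := Sum.inl x) (a₂ := Sum.inl y) e)
  have hjj : Function.Injective j := fun x y e =>
    Sum.inr_injective (hb.1 (a₁ := Sum.inr x) (a₂ := Sum.inr y) e)
  have hid : Equivariant A (G.grp × H.grp) (id : U.X → U.X) := fun _ _ => rfl
  refine ⟨_, _, tensorMap_isHom ax hU hU hid Function.injective_id hi hii,
    tensorMap_isHom ax hU hU hid Function.injective_id hj hjj, bijective_sumElim
    (tensorMap_injective _ _ _ _) (tensorMap_injective _ _ _ _) ?_ ?_⟩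
  · intro y z e
    obtain ⟨u, x, rfl⟩ := (ax.rFree hU).exists_tmkL y
    obtain ⟨v, y, rfl⟩ := (ax.rFree hU).exists_tmkL z
    obtain ⟨h, a, _, e⟩ := (ax.rFree hU).tmkL_eq.mp (e :
      (ax.rFree hU).tmkL u (i x) = (ax.rFree hU).tmkL v (j y))
    rw [← hi.1] at e
    exact absurd (hb.1 (a₁ := Sum.inl _) (a₂ := Sum.inr _) e) (by simp)
  · intro w
    obtain ⟨u, z, rfl⟩ := (ax.rFree hU).exists_tmkL w
    obtain ⟨x | y, rfl⟩ := hb.2 z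
    · exact Or.inl ⟨(ax.rFree hU).tmkL u x, rfl⟩
    · exact Or.inr ⟨(ax.rFree hU).tmkL u y, rfl⟩

theorem tensorObj_isCoprod_left {V W : Biset A G H} (hV : Good (lower S) V)
    (hW : Good (lower S) W) {i : U.X → W.X} {j : V.X → W.X}
    (h : FibSet.IsUnion (A := A) (Q := G.grp × H.grp) i j) (X : SecObj F H) :
    (tensorObj ax hU X).IsCoprod (tensorObj ax hV X) (tensorObj ax hW X) := by
  refine ⟨_, _, tensorMap_isHom ax hU hW h.1 h.inj_left X.isHom_id Function.injective_id,
    tensorMap_isHom ax hV hW h.2.1 h.inj_right X.isHom_id Function.injective_id, bijective_sumElim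
    (tensorMap_injective _ _ _ _) (tensorMap_injective _ _ _ _) ?_ ?_⟩
  · intro y z e
    obtain ⟨u, x, rfl⟩ := (ax.rFree hU).exists_tmkL y
    obtain ⟨v, y, rfl⟩ := (ax.rFree hV).exists_tmkL z
    obtain ⟨k, a, e, _⟩ := (ax.rFree hW).tmkL_eq.mp (e :
      (ax.rFree hW).tmkL (i u) x = (ax.rFree hW).tmkL (j v) y)
    rw [← h.1] at e
    exact absurd (h.2.2.1 (a₁ := Sum.inl _) (a₂ := Sum.inr _) e) (by simp)
  · intro w
    obtain ⟨z, x, rfl⟩ := (ax.rFree hW).exists_tmkL w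
    obtain ⟨u | v, rfl⟩ := h.2.2.2 z
    · exact Or.inl ⟨(ax.rFree hU).tmkL u x, rfl⟩
    · exact Or.inr ⟨(ax.rFree hV).tmkL v x, rfl⟩

theorem exists_lowerMap (F : FibFunctor S R M) : ∃ f : LowerPlus F H →ₗ[R] LowerPlus F G,
    ∀ X : SecObj F H, f X.cl = (tensorObj ax hU X).cl := by
  refine exists_lowerPlus_lift _
    (fun X Y Z h => SecObj.cl_of_isCoprod (tensorObj_isCoprod_right ax hU h))
    (fun X hX s r => ?_) (fun r X => ?_)
  · refine Eq.trans ?_ (cl_add (F := F) (tensorLeft U X) (stabMem_tensor ax hU hX)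
      (tensorObj ax hU ⟨X, hX, s⟩).s (tensorObj ax hU ⟨X, hX, r⟩).s)
    refine congrArg (fun t => SecObj.cl (F := F) ⟨tensorLeft U X, stabMem_tensor ax hU hX, t⟩) ?_
    refine Subtype.ext (funext fun w => ?_)
    exact map_add (F.ev _ _ _) _ _
  · rw [smul_cl]
    refine congrArg (fun t => SecObj.cl (F := F)
      ⟨tensorLeft U X.X, stabMem_tensor ax hU X.mem, t⟩) ?_
    refine Subtype.ext (funext fun w => ?_)
    exact map_smul (F.ev _ _ _) _ _

/-- The map `F₊([U])`. -/
noncomputable def lowerMap (F : FibFunctor S R M) : LowerPlus F H →ₗ[R] LowerPlus F G :=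
  (exists_lowerMap ax hU F).choose

theorem lowerMap_cl (X : SecObj F H) : lowerMap ax hU F X.cl = (tensorObj ax hU X).cl :=
  (exists_lowerMap ax hU F).choose_spec X

end Maps

/-- The isomorphism from (X, s) is x ↦ 1 ⊗ x. Its section agrees because restricting (Δ(G), 1) to
G_x gives (Δ(G_x), 1). -/
theorem lowerMap_id {G : Obj 𝒢} (h : Good (lower S) (basic G G (FPair.diag G.grp))) :
    lowerMap ax h F = LinearMap.id := by
  refine lowerPlus_ext fun X => ?_
  rw [lowerMap_cl, LinearMap.id_apply]
  symm
  let b := basicMk (A := A) G G (FPair.diag G.grp)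
  -- Multiplying the representative (g, k) on the right by (g⁻¹, g⁻¹) ∈ Δ(G) makes its first entry
  -- 1: the right action of G and the action of A alone reach every point from the base point.
  have h1 : ∀ (g k : G.grp) (a : A), b ((g, k), a) = (((1 : G.grp), k * g⁻¹), a) • b 1 := by
    intro g k a
    rw [smul_basicMk, mul_one, basicMk_eq, FPair.rel_diag]
    simp [incl]
  let f : X.X.X → (tensorObj ax h X).X.X := fun x => (ax.rFree h).tmkL (b 1) x
  have hf : Equivariant A G.grp f := by
    rintro ⟨g, a⟩ x
    change (ax.rFree h).tmkL (b 1) ((g, a) • x) = (g, a) • (ax.rFree h).tmkL (b 1) x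
    rw [RFree.smul_tmkL, smul_basicMk, mul_one]
    refine Eq.trans ?_ (congrArg (fun u => (ax.rFree h).tmkL u x) (h1 g 1 a).symm)
    rw [RFree.tmkL_smul]
    simp
  have hbij : Function.Bijective f := by
    constructor
    · intro x y e
      obtain ⟨k, a, e₁, e₂⟩ := (ax.rFree h).tmkL_eq.mp e
      obtain ⟨rfl, e₃⟩ := (ax.rFree h).eq_one e₁
      rw [inv_eq_one] at e₃
      subst e₃
      rw [← e₂]
      exact (one_smul (G.grp × A) x).symm
    · intro w
      obtain ⟨u, x, rfl⟩ := (ax.rFree h).exists_tmkL w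
      obtain ⟨⟨⟨g, k⟩, a⟩, rfl⟩ := exists_basicMk u
      refine ⟨((k * g⁻¹)⁻¹, a) • x, ?_⟩
      change (ax.rFree h).tmkL (b 1) _ = (ax.rFree h).tmkL (b ((g, k), a)) x
      rw [h1 g k a, RFree.tmkL_smul]
  refine SecObj.cl_of_iso (f := f) (SecObj.isHom_of ax hf (fun x => ?_) (fun x => ?_)) hbij
  · rw [← setPair_map hf hbij.1]
  · refine (tensorVal_eq ax h X (u := b 1) (x := x) rfl).trans ?_
    refine congrArg (fun P => F.ev _ (X.stabObj x) P (X.s.1 x)) ?_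
    have e1 : bisetPair (basic G G (FPair.diag G.grp)) (b 1) = FPair.diag G.grp := by
      refine (bisetPair_basic (ax.lower_diag G).1 1).trans (FPair.ext_rel fun x a => ?_)
      rw [FPair.rel_conj]
      simp
    rw [e1]
    refine FPair.ext_rel fun y a => ?_
    rw [FPair.rel_resRight, FPair.rel_diag, FPair.rel_diag]
    constructor
    · rintro ⟨⟨e, h₁, h₂⟩, h₃⟩
      exact ⟨e, e ▸ h₃, h₂⟩
    · rintro ⟨e, h₁, h₂⟩
      exact ⟨⟨e, setPair_dom_le X.X x h₁, h₂⟩, e ▸ h₁⟩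

/-- The associativity bijection matches the sections: evaluating at the two restricted pairs in turn
is evaluating at the ∗-product of P_u and P_v restricted to K_x, which is the pair of u ⊗ v. -/
theorem lowerMap_tensor {G H K : Obj 𝒢} {U : Biset A G H} {V : Biset A H K}
    (hU : Good (lower S) U) (hV : Good (lower S) V) :
    lowerMap ax (G := G) (H := K) (U := tensor U V) (ax.good_tensor hU hV) F =
      lowerMap ax hU F ∘ₗ lowerMap ax hV F := by
  refine lowerPlus_ext fun X => ?_
  rw [LinearMap.comp_apply, lowerMap_cl, lowerMap_cl, lowerMap_cl]
  obtain ⟨f, hf, hb, hfm⟩ := (ax.rFree hU).exists_assoc (ax.rFree hV) X.X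
  refine SecObj.cl_of_iso (X := tensorObj ax (G := G) (H := K) (U := tensor U V)
    (ax.good_tensor hU hV) X) (Y := tensorObj ax hU (tensorObj ax hV X)) (f := f)
    (SecObj.isHom_of ax hf (fun w => ?_) (fun w => ?_)) hb
  · exact congrArg FPair.dom (setPair_map (X := tensorLeft (tensor U V) X.X)
      (Y := tensorLeft U (tensorLeft V X.X)) hf hb.1 w).symm
  · obtain ⟨y, x, e⟩ := ((ax.rFree hU).tensor (ax.rFree hV)).exists_tmkL w
    obtain ⟨u, v, rfl⟩ := (ax.rFree hU).exists_tmk y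
    have e' : (ax.rFree hU).tmkL u ((ax.rFree hV).tmkL v x) = f w := by rw [← e, hfm]
    have hp : setPair (tensorLeft (tensor U V) X.X) w =
        setPair (tensorLeft U (tensorLeft V X.X)) (f w) :=
      setPair_map (X := tensorLeft (tensor U V) X.X)
        (Y := tensorLeft U (tensorLeft V X.X)) hf hb.1 w
    have ha₁ := adm_tensor ax (G := G) (H := K) (U := tensor U V) (ax.good_tensor hU hV) X.mem e
    have ha₂ := adm_tensor ax hV X.mem (u := v) (x := x) rfl
    have ha₃ := adm_tensor ax hU (tensorObj ax hV X).mem e'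
    have hd1 : Adm S (G.sub _ ((tensorObj ax hU (tensorObj ax hV X)).mem (f w)))
        (G.sub _ ((tensorObj ax (G := G) (H := K) (U := tensor U V)
          (ax.good_tensor hU hV) X).mem w))
        (FPair.diag (setPair (tensorLeft (tensor U V) X.X) w).dom) :=
      ax.adm_diag_of_eq (congrArg FPair.dom hp) _ _
    refine (tensorVal_eq ax hU (tensorObj ax hV X) e').trans ?_
    refine Eq.trans ?_ (congrArg (F.ev _ _ _) (tensorVal_eq ax (G := G) (H := K)
      (U := tensor U V) (ax.good_tensor hU hV) X e).symm)
    refine (congrArg (F.ev _ _ _) (tensorVal_eq ax hV X (u := v) (x := x) rfl)).trans ?_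
    refine (ev_comp ax ha₃.2 ha₂.2 ?_ _).trans (ev_comp ax hd1 ha₁.2
      (T := (bisetPair (G := G) (H := K) (tensor U V) ((ax.rFree hU).tmk u v)).resRight
        (setPair X.X x).dom) ?_ _).symm
    · intro g k a
      simp only [FPair.rel_resRight, rel_bisetPair_tensor]
      constructor
      · rintro ⟨⟨h, b, c, h₁, h₂, e⟩, h₃⟩
        refine ⟨h, b, c, ⟨h₁, ?_⟩, ⟨h₂, h₃⟩, e⟩
        obtain ⟨d, hd⟩ := FPair.exists_rel h₃
        exact ((rel_setPair_tensor (ax.rFree hV)).mpr ⟨k, c, d, h₂, hd, rfl⟩).mem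
      · rintro ⟨h, b, c, ⟨h₁, _⟩, ⟨h₂, h₃⟩, e⟩
        exact ⟨⟨h, b, c, h₁, h₂, e⟩, h₃⟩
    · intro g k a
      simp only [FPair.rel_diag]
      constructor
      · intro h₁
        refine ⟨g, 1, a, ⟨rfl, ?_, rfl⟩, h₁, one_mul a⟩
        rw [FPair.rel_resRight] at h₁
        obtain ⟨c, hc⟩ := FPair.exists_rel h₁.2
        subst e
        exact ((rel_setPair_tensor (G := G) (H := K) (U := tensor U V) _).mpr
          ⟨k, a, c, h₁.1, hc, rfl⟩).mem
      · rintro ⟨h, b, c, ⟨rfl, h₃, rfl⟩, h₁, rfl⟩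
        rw [one_mul]
        exact h₁

theorem exists_lowerFunctor (F : FibFunctor S R M) :
    ∃ Fp : FibFunctor (lower S) R (LowerPlus F), ∀ (G H : Obj 𝒢) (U : Biset A G H)
      (hU : Good (lower S) U), Fp.map G H ⟨cls R U, cls_mem_homR R hU⟩ = lowerMap ax hU F := by
  refine ax.exists_functor (fun G H U hU => lowerMap ax hU F) ?_ ?_ ?_
  · intro G H U V W hU hV hW i j h
    refine lowerPlus_ext fun X => ?_
    rw [LinearMap.add_apply, lowerMap_cl, lowerMap_cl, lowerMap_cl]
    exact SecObj.cl_of_isCoprod (tensorObj_isCoprod_left ax hU hV hW h X)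
  · exact fun G h => lowerMap_id ax h
  · exact fun G H K U V hU hV => lowerMap_tensor ax hU hV

/-- By right freeness every point of the tensor product has the form u ⊗ x, so the formula
determines the section, and the classes [X, s] determine the map. With `Axioms.functor_ext` this
gives uniqueness of the functor. -/
theorem isLowerPlus_iff {Fp : FibFunctor (lower S) R (LowerPlus F)} :
    IsLowerPlus F Fp ↔ ∀ (G H : Obj 𝒢) (U : Biset A G H) (hU : Good (lower S) U),
      Fp.map G H ⟨cls R U, cls_mem_homR R hU⟩ = lowerMap ax hU F := by
  constructor
  · intro h G H U hU
    obtain ⟨hc, h⟩ := h G H U hU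
    refine lowerPlus_ext fun X => ?_
    obtain ⟨hm, t, ht, e⟩ := h X
    rw [lowerMap_cl]
    refine e.trans (congrArg (fun t => SecObj.cl (F := F) ⟨tensorLeft U X.X, hm, t⟩) ?_)
    refine Subtype.ext (funext fun w => ?_)
    obtain ⟨u, x, rfl⟩ := (ax.rFree hU).exists_tmkL w
    refine (ht u x ((ax.rFree hU).aFree_left _ _ _)).trans ?_
    exact (tensorVal_eq ax hU X rfl).symm
  · intro h G H U hU
    refine ⟨cls_mem_homR R hU, fun X => ⟨_, (tensorObj ax hU X).s, fun u x hux => ?_, ?_⟩⟩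
    · exact tensorVal_eq ax hU X rfl
    · rw [h]
      exact lowerMap_cl ax hU X

end LowerFunctor

/-! ### Elements of ℳ'(G) and pairs contributing to F⁺([U]). -/

section UpperFunctor

variable {A : Type u} [CommGroup A] {𝒢 : GroupClass.{u}} {R : Type w} [CommRing R]
  {S : Family A 𝒢} {M : Obj 𝒢 → Type v} [∀ G, AddCommGroup (M G)] [∀ G, Module R (M G)]
  {F : FibFunctor S R M}

/-! ### Sums -/

theorem finsum_of_bijective_sumElim {α β γ N : Type*} [AddCommMonoid N] [Finite α] [Finite β]
    (f : γ → N) {i : α → γ} {j : β → γ} (h : Function.Bijective (Sum.elim i j)) :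
    ∑ᶠ c, f c = ∑ᶠ a, f (i a) + ∑ᶠ b, f (j b) := by
  have := Fintype.ofFinite α
  have := Fintype.ofFinite β
  rw [← finsum_eq_of_bijective (f := fun c => f (Sum.elim i j c)) _ h fun _ => rfl,
    finsum_eq_sum_of_fintype, finsum_eq_sum_of_fintype, finsum_eq_sum_of_fintype,
    Fintype.sum_sum_type]
  rfl

theorem finsum_of_bijective_prod {α β γ N : Type*} [AddCommMonoid N] [Finite α] [Finite β]
    (f : γ → N) {i : α × β → γ} (h : Function.Bijective i) :
    ∑ᶠ c, f c = ∑ᶠ a, ∑ᶠ b, f (i (a, b)) := by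
  rw [← finsum_eq_of_bijective (f := fun c => f (i c)) _ h fun _ => rfl]
  exact finsum_curry _ (Set.toFinite _)

open Classical in
/-- The element of a direct sum with given components, almost all of them zero. -/
noncomputable def directSumMk {ι : Type*} {β : ι → Type*} [∀ i, AddCommGroup (β i)]
    (f : ∀ i, β i) (h : {i | f i ≠ 0}.Finite) : ⨁ i, β i :=
  DirectSum.mk β h.toFinset fun i => f i

open Classical in
theorem directSumMk_apply {ι : Type*} {β : ι → Type*} [∀ i, AddCommGroup (β i)]
    (f : ∀ i, β i) (h : {i | f i ≠ 0}.Finite) (i : ι) : directSumMk f h i = f i := by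
  by_cases hi : i ∈ h.toFinset
  · exact DirectSum.mk_apply_of_mem hi
  · rw [directSumMk, DirectSum.mk_apply_of_notMem hi]
    rw [Set.Finite.mem_toFinset, Set.mem_ofPred_eq, not_not] at hi
    exact hi.symm

/-! ### Pairs of subgroups in the class -/

theorem MPair.ext_pair {G : Obj 𝒢} {κ μ : MPair A G} (h : κ.pair = μ.pair) : κ = μ := by
  obtain ⟨κ, _, _⟩ := κ
  obtain ⟨μ, _, _⟩ := μ
  obtain rfl : κ = μ := h
  rfl

theorem finite_subgroups (G : Obj 𝒢) : {K : Subgroup G.1.amb | K ≤ G.grp}.Finite := by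
  have : Function.Injective (fun K : {K : Subgroup G.1.amb | K ≤ G.grp} =>
      K.1.subgroupOf G.grp) := fun K L e => by
    have := Subgroup.subgroupOf_inj.mp e
    rw [inf_of_le_left K.2, inf_of_le_left L.2] at this
    exact Subtype.ext this
  have := Finite.of_injective _ this
  exact Set.toFinite _

/-- G has finitely many subgroups, whereas Hom(K, A) may be infinite. Finite support in F⁺(G) is
always obtained from a bound of one character per subgroup. -/
theorem finite_mPair {G : Obj 𝒢} (s : Set (MPair A G))
    (h : ∀ κ ∈ s, ∀ μ ∈ s, κ.pair.dom = μ.pair.dom → κ = μ) : s.Finite :=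
  Set.Finite.of_finite_image ((finite_subgroups G).subset (by
    rintro _ ⟨κ, _, rfl⟩
    exact κ.le : (fun κ : MPair A G => κ.pair.dom) '' s ⊆ _)) fun κ hκ μ hμ e => h κ hκ μ hμ e

/-- The conjugate of an element of `ℳ'(G)`. -/
theorem Axioms.exists_conj (ax : Axioms S) {G : Obj 𝒢} (κ : MPair A G) (g : G.grp) :
    ∃ μ : MPair A G, μ.pair = κ.pair.conj (g : G.1.amb) := by
  obtain ⟨h, -⟩ := ax.conj_diag κ.mem κ.le g.2 (K' := (κ.pair.conj (g : G.1.amb)).dom) fun y => by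
    simp only [FPair.mem_dom_iff, FPair.rel_conj]
  refine ⟨⟨_, fun y hy => ?_, h⟩, rfl⟩
  obtain ⟨a, ha⟩ := FPair.exists_rel hy
  have := κ.le (FPair.rel_conj.mp ha).mem
  exact (Subgroup.mul_mem_cancel_left _ (G.grp.inv_mem g.2)).mp
    ((Subgroup.mul_mem_cancel_right _ g.2).mp this)

theorem Axioms.mPair_adm_conj (ax : Axioms S) {G : Obj 𝒢} {κ μ : MPair A G} {g : G.grp}
    (h : μ.pair = κ.pair.conj (g : G.1.amb)) :
    Adm S μ.obj κ.obj ((FPair.diag κ.pair.dom).conj ((g : G.1.amb), 1)) :=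
  (ax.conj_diag κ.mem κ.le g.2 (K' := μ.pair.dom) fun y => by
    rw [h]
    simp only [FPair.mem_dom_iff, FPair.rel_conj]).2

/-- The form used for commuting squares: both composites are F at a ∗-product, and the two products
have the same graph. -/
theorem ev_comp_eq (ax : Axioms S) {G H H' K : Obj 𝒢} {L₁ : Subgroup G.1.amb}
    {L₂ : Subgroup H.1.amb} {L₂' : Subgroup H'.1.amb}
    {L₃ : Subgroup K.1.amb} {h₁ : G.Mem L₁} {h₂ : H.Mem L₂} {h₂' : H'.Mem L₂'} {h₃ : K.Mem L₃}
    {P : FPair A (G.1.amb × H.1.amb)} {P' : FPair A (H.1.amb × K.1.amb)}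
    {Q : FPair A (G.1.amb × H'.1.amb)} {Q' : FPair A (H'.1.amb × K.1.amb)}
    (hP : Adm S (G.sub L₁ h₁) (H.sub L₂ h₂) P) (hP' : Adm S (H.sub L₂ h₂) (K.sub L₃ h₃) P')
    (hQ : Adm S (G.sub L₁ h₁) (H'.sub L₂' h₂') Q) (hQ' : Adm S (H'.sub L₂' h₂') (K.sub L₃ h₃) Q')
    (hT : ∀ (g : G.1.amb) (k : K.1.amb) (a : A),
      (∃ (h : H'.1.amb) (b c : A), Q.Rel (g, h) b ∧ Q'.Rel (h, k) c ∧ b * c = a) ↔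
        ∃ (h : H.1.amb) (b c : A), P.Rel (g, h) b ∧ P'.Rel (h, k) c ∧ b * c = a)
    (m : M (K.sub L₃ h₃)) :
    F.ev (G.sub L₁ h₁) (H.sub L₂ h₂) P (F.ev (H.sub L₂ h₂) (K.sub L₃ h₃) P' m) =
      F.ev (G.sub L₁ h₁) (H'.sub L₂' h₂') Q (F.ev (H'.sub L₂' h₂') (K.sub L₃ h₃) Q' m) :=
  (ev_comp ax hP hP' (T := Q.star Q' (ax.compat (G := G.sub L₁ h₁) (H := H'.sub L₂' h₂')
    (K := K.sub L₃ h₃) hQ.1)) (fun g k a => FPair.rel_star.trans (hT g k a)) m).trans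
  (ev_comp ax hQ hQ' (fun _ _ _ => FPair.rel_star) m).symm

/-! ### Contributing pairs -/

section Contributes

variable (ax : Axioms S) {G H : Obj 𝒢} {U : Biset A G H} (hU : Good (lower S) U)

include ax hU in
-- The condition on k₂((G × H)_u) ∩ K^u is empty because that group is trivial.
theorem contributes_iff {u : U.X} {κ : MPair A G} {μ : MPair A H} :
    Contributes U u κ μ ↔ κ.pair.dom ≤ p1 (bisetPair U u).dom ∧
      (∀ h, h ∈ μ.pair.dom ↔ ∃ k ∈ κ.pair.dom, (k, h) ∈ (bisetPair U u).dom) ∧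
      ∀ k h a b, k ∈ κ.pair.dom → (bisetPair U u).Rel (k, h) a → μ.pair.Rel h b →
        κ.pair.Rel k (a * b) := by
  constructor
  · rintro ⟨h₁, h₂, _, h₄⟩
    refine ⟨h₁, fun h => by rw [h₂]; rfl, ?_⟩
    rintro k h _ _ hk ⟨hu, rfl⟩ ⟨hμ, rfl⟩
    exact ⟨hk, (h₄ k h hk hu hμ).symm⟩
  · rintro ⟨h₁, h₂, h₃⟩
    refine ⟨h₁, Subgroup.ext h₂, ?_, ?_⟩
    · intro h hu hμ
      obtain rfl := ax.lower_eq_one (hU u) hu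
      have e1 := ((bisetPair U u).rel_char hu).unique (FPair.rel_one _)
      have e2 := (μ.pair.rel_char hμ).unique (FPair.rel_one _)
      rw [e1, e2, inv_one]
    · intro k h hk hu hμ
      obtain ⟨_, e⟩ := h₃ k h _ _ hk ((bisetPair U u).rel_char hu) (μ.pair.rel_char hμ)
      exact e.symm

/-- Each h ∈ K^u comes with some k ∈ K such that (k, h) ∈ (G × H)_u, and then λ(h) is forced by
φ_u(k, h)λ(h) = α(k). The sum over λ thus has at most one term. -/
theorem Contributes.unique {u : U.X} {κ : MPair A G} {μ μ' : MPair A H}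
    (h : Contributes U u κ μ) (h' : Contributes U u κ μ') : μ = μ' := by
  refine MPair.ext_pair (FPair.eq_of_le_of_dom (FPair.le_iff_rel.mpr ?_)
    (h'.2.1.trans h.2.1.symm).le)
  rintro x _ ⟨hx, rfl⟩
  have hx' : x ∈ μ'.pair.dom := by
    rw [h'.2.1, ← h.2.1]
    exact hx
  obtain ⟨k, hk, hu⟩ : ∃ k ∈ κ.pair.dom, (k, x) ∈ (bisetPair U u).dom := by
    rw [h.2.1] at hx
    exact hx
  refine ⟨hx', ?_⟩
  have := (h.2.2.2 k x hk hu hx).trans (h'.2.2.2 k x hk hu hx').symm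
  exact (mul_left_cancel this).symm

/-- The same equation read for α: K, u and λ determine α. This is the bound on characters needed for
finite support. -/
theorem Contributes.eq_of_dom {u : U.X} {κ κ' : MPair A G} {μ : MPair A H}
    (h : Contributes U u κ μ) (h' : Contributes U u κ' μ) (e : κ.pair.dom = κ'.pair.dom) :
    κ = κ' := by
  refine MPair.ext_pair (FPair.eq_of_le_of_dom (FPair.le_iff_rel.mpr ?_) e.ge)
  rintro k _ ⟨hk, rfl⟩
  obtain ⟨x, hx⟩ := mem_p1.mp (h.1 hk)
  have hμ : x ∈ μ.pair.dom := by
    rw [h.2.1]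
    exact ⟨k, hk, hx⟩
  exact ⟨e ▸ hk, (h'.2.2.2 k x (e ▸ hk) hx hμ).symm.trans (h.2.2.2 k x hk hx hμ)⟩

include ax hU

/-- A pair `μ ≤ ν` contributes to `κ` if and only if `κ ≤ ((G × H)_u, φ_u) ∗ ν`. -/
theorem exists_contributes_le_iff {u : U.X} {κ : MPair A G} {ν : FPair A H.1.amb} :
    (∃ μ : MPair A H, Contributes U u κ μ ∧ μ.pair ≤ ν) ↔ ∀ k a, κ.pair.Rel k a →
      ∃ h b c, (bisetPair U u).Rel (k, h) b ∧ ν.Rel h c ∧ b * c = a := by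
  constructor
  · rintro ⟨μ, hc, hle⟩ k a hk
    rw [contributes_iff ax hU] at hc
    obtain ⟨h, hh⟩ := mem_p1.mp (hc.1 hk.mem)
    obtain ⟨b, hb⟩ := FPair.exists_rel hh
    obtain ⟨c, hc'⟩ := FPair.exists_rel ((hc.2.1 h).mpr ⟨k, hk.mem, hh⟩)
    exact ⟨h, b, c, hb, FPair.le_iff_rel.mp hle _ _ hc', (hc.2.2 _ _ _ _ hk.mem hb hc').unique hk⟩
  · intro h
    -- By right freeness (G × H)_u is the graph of a function on its first projection.
    have un : ∀ {k x y}, (k, x) ∈ (bisetPair U u).dom → (k, y) ∈ (bisetPair U u).dom → x = y := by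
      intro k x y hx hy
      have := (bisetPair U u).dom.mul_mem hx ((bisetPair U u).dom.inv_mem hy)
      rw [Prod.inv_mk, Prod.mk_mul_mk, mul_inv_cancel] at this
      exact mul_inv_eq_one.mp (ax.lower_eq_one (hU u) this)
    have hle : starLeft κ.pair.dom (bisetPair U u).dom ≤ ν.dom := by
      rintro x ⟨k, hk, hx⟩
      obtain ⟨a, ha⟩ := FPair.exists_rel hk
      obtain ⟨y, b, c, hb, hc, _⟩ := h k a ha
      rw [un hx hb.mem]
      exact hc.mem
    have hp : κ.pair.dom ≤ p1 (bisetPair U u).dom := fun k hk => by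
      obtain ⟨a, ha⟩ := FPair.exists_rel hk
      obtain ⟨y, b, c, hb, hc, _⟩ := h k a ha
      exact mem_p1.mpr ⟨y, hb.mem⟩
    obtain ⟨hm, -⟩ := ax.resLeft_adm (hU u) hp κ.mem
      (L := starLeft κ.pair.dom (bisetPair U u).dom) fun _ => Iff.rfl
    -- The only candidate is the restriction of ν to K^u, which lies in 𝒢 by axiom (viii).
    refine ⟨⟨ν.restrict _ hle, ?_, hm⟩, (contributes_iff ax hU).mpr ⟨hp, fun _ => Iff.rfl, ?_⟩, ?_⟩
    · rintro x ⟨k, hk, hx⟩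
      exact (bisetPair_dom_le U u hx).2
    · intro k x b c hk hb hc
      obtain ⟨a, ha⟩ := FPair.exists_rel hk
      obtain ⟨y, b', c', hb', hc', rfl⟩ := h k a ha
      obtain rfl := un hb.mem hb'.mem
      rw [hb.unique hb', (FPair.rel_restrict.mp hc).1.unique hc']
      exact ha
    · exact FPair.le_iff_rel.mpr fun _ _ h => (FPair.rel_restrict.mp h).1

theorem Contributes.adm {u : U.X} {κ : MPair A G} {μ : MPair A H} (h : Contributes U u κ μ) :
    Adm S κ.obj μ.obj (FPair.resLeft κ.pair.dom (bisetPair (G := G) (H := H) U u)) :=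
  (ax.resLeft_adm (hU u) h.1 κ.mem (L := μ.pair.dom) fun x => by rw [h.2.1]; rfl).2

theorem Contributes.smul {u : U.X} {κ κ' : MPair A G} {μ μ' : MPair A H}
    (hc : Contributes U u κ μ) {g : G.grp} {h : H.grp} (a : A)
    (hκ : κ'.pair = κ.pair.conj (g : G.1.amb)) (hμ : μ'.pair = μ.pair.conj (h : H.1.amb)) :
    Contributes U (((g, h), a) • u) κ' μ' := by
  rw [contributes_iff ax hU] at hc ⊢
  obtain ⟨h₁, h₂, h₃⟩ := hc
  rw [hκ, hμ, bisetPair_smul]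
  simp only [SetLike.le_def, mem_p1, FPair.mem_dom_iff, FPair.rel_conj, Prod.inv_mk,
    Prod.mk_mul_mk] at h₁ h₂ h₃ ⊢
  refine ⟨?_, ?_, ?_⟩
  · intro k hk
    obtain ⟨x, b, hb⟩ := h₁ hk
    exact ⟨h * x * (h : H.1.amb)⁻¹, b, by simpa [mul_assoc] using hb⟩
  · intro x
    rw [h₂]
    constructor
    · rintro ⟨k, hk, b, hb⟩
      exact ⟨g * k * (g : G.1.amb)⁻¹, by simpa [mul_assoc] using hk, b,
        by simpa [mul_assoc] using hb⟩
    · rintro ⟨k, hk, b, hb⟩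
      exact ⟨_, hk, b, hb⟩
  · intro k x b c hk hb hc
    exact h₃ _ _ _ _ hk hb hc

end Contributes

end UpperFunctor

/-! ### The functor F⁺. -/

section UpperMaps

variable {A : Type u} [CommGroup A] {𝒢 : GroupClass.{u}} {R : Type w} [CommRing R]
  {S : Family A 𝒢} {M : Obj 𝒢 → Type v} [∀ G, AddCommGroup (M G)] [∀ G, Module R (M G)]
  {F : FibFunctor S R M}

instance finite_ahQuotient {G H : Obj 𝒢} (U : Biset A G H) : Finite (Quotient (ahRel U)) := by
  have := U.fin
  refine Finite.of_surjective (Quotient.map' id ?_ : U.Orb → Quotient (ahRel U)) ?_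
  · rintro u _ ⟨a, rfl⟩
    exact ⟨1, a, rfl⟩
  · rintro ⟨u⟩
    exact ⟨Quotient.mk _ u, rfl⟩

instance finite_orb {A Q : Type u} [CommGroup A] [Group Q] (X : FibSet A Q) : Finite X.Orb := X.fin

open Classical in
variable (F) in
/-- The contribution of the `(A, H)`-orbit of `u` to the `κ`-component of the image under
`F⁺([U])`. -/
noncomputable def upTerm {G H : Obj 𝒢} (U : Biset A G H) (u : U.X) (κ : MPair A G)
    (x : ⨁ μ : MPair A H, M μ.obj) : M κ.obj :=
  ∑ᶠ μ : MPair A H, if Contributes U u κ μ then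
    F.ev κ.obj μ.obj (FPair.resLeft κ.pair.dom (bisetPair (G := G) (H := H) U u)) (x μ) else 0

theorem upperPlus_ext {G : Obj 𝒢} {x y : UpperPlus F G} (h : ∀ κ, x.1 κ = y.1 κ) : x = y :=
  Subtype.ext (DFinsupp.ext h)

theorem upperPlus_add_apply {G : Obj 𝒢} (x y : UpperPlus F G) (κ : MPair A G) :
    (x + y).1 κ = x.1 κ + y.1 κ :=
  DirectSum.add_apply x.1 y.1 κ

theorem upperPlus_smul_apply {G : Obj 𝒢} (r : R) (x : UpperPlus F G) (κ : MPair A G) :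
    (r • x).1 κ = r • x.1 κ :=
  DirectSum.smul_apply r x.1 κ

section Term

variable {G H : Obj 𝒢} {U : Biset A G H}

theorem upTerm_eq {u : U.X} {κ : MPair A G} {μ : MPair A H} (h : Contributes U u κ μ)
    (x : ⨁ μ : MPair A H, M μ.obj) : upTerm F U u κ x =
      F.ev κ.obj μ.obj (FPair.resLeft κ.pair.dom (bisetPair (G := G) (H := H) U u)) (x μ) := by
  rw [upTerm, finsum_eq_single _ μ, if_pos h]
  intro μ' hne
  exact if_neg fun h' => hne (h'.unique h)

theorem upTerm_eq_zero {u : U.X} {κ : MPair A G} (h : ∀ μ, ¬ Contributes U u κ μ)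
    (x : ⨁ μ : MPair A H, M μ.obj) : upTerm F U u κ x = 0 := by
  rw [upTerm]
  exact (finsum_congr fun μ => if_neg (h μ)).trans finsum_zero

theorem upTerm_add (u : U.X) (κ : MPair A G) (x y : ⨁ μ : MPair A H, M μ.obj) :
    upTerm F U u κ (x + y) = upTerm F U u κ x + upTerm F U u κ y := by
  by_cases h : ∃ μ, Contributes U u κ μ
  · obtain ⟨μ, h⟩ := h
    rw [upTerm_eq h, upTerm_eq h, upTerm_eq h, DirectSum.add_apply, map_add]
  · rw [not_exists] at h
    rw [upTerm_eq_zero h, upTerm_eq_zero h, upTerm_eq_zero h, add_zero]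

theorem upTerm_smul_scalar (u : U.X) (κ : MPair A G) (r : R) (x : ⨁ μ : MPair A H, M μ.obj) :
    upTerm F U u κ (r • x) = r • upTerm F U u κ x := by
  by_cases h : ∃ μ, Contributes U u κ μ
  · obtain ⟨μ, h⟩ := h
    rw [upTerm_eq h, upTerm_eq h, DirectSum.smul_apply, map_smul]
  · rw [not_exists] at h
    rw [upTerm_eq_zero h, upTerm_eq_zero h, smul_zero]

theorem upTerm_map {V : Biset A G H} {f : U.X → V.X} (hf : Equivariant A (G.grp × H.grp) f)
    (hi : Function.Injective f) (u : U.X) (κ : MPair A G) (x : ⨁ μ : MPair A H, M μ.obj) :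
    upTerm F V (f u) κ x = upTerm F U u κ x := by
  unfold upTerm Contributes
  rw [← bisetPair_map hf hi u]

variable (ax : Axioms S) (hU : Good (lower S) U)

include ax hU

/-- Translating u by (g, h) turns a contribution of μ to κ into one of the h-conjugate of μ to the
g-conjugate of κ. The invariance of x absorbs h, and the remaining identity says that conjugation
commutes with restriction of P_u. -/
theorem upTerm_act (x : UpperPlus F H) (u : U.X) {κ κ' : MPair A G} (g : G.grp) (h : H.grp) (a : A)
    (hκ : κ'.pair = κ.pair.conj (g : G.1.amb)) :
    upTerm F U (((g, h), a) • u) κ' x.1 =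
      F.ev κ'.obj κ.obj ((FPair.diag κ.pair.dom).conj ((g : G.1.amb), 1)) (upTerm F U u κ x.1) := by
  by_cases hc : ∃ μ, Contributes U u κ μ
  · obtain ⟨μ, hc⟩ := hc
    obtain ⟨μ', hμ⟩ := ax.exists_conj μ h
    have hc' := hc.smul ax hU a hκ hμ
    rw [upTerm_eq hc, upTerm_eq hc', ← x.2 h μ μ' hμ]
    refine ev_comp_eq ax (hc'.adm ax hU) (ax.mPair_adm_conj hμ) (ax.mPair_adm_conj hκ)
      (hc.adm ax hU) (fun y k b => ?_) _
    have hd : ∀ {k y}, k ∈ κ.pair.dom → (k, y) ∈ (bisetPair U u).dom → y ∈ μ.pair.dom :=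
      fun hk hy => by
        rw [hc.2.1]
        exact ⟨_, hk, hy⟩
    simp only [FPair.rel_diag_conj]
    simp only [FPair.rel_resLeft, hκ, bisetPair_smul]
    simp only [FPair.rel_conj, FPair.mem_dom_iff, Prod.inv_mk, Prod.mk_mul_mk]
    constructor
    · rintro ⟨z, c, d, ⟨rfl, h₁, rfl⟩, ⟨h₂, h₃⟩, rfl⟩
      obtain ⟨e, he⟩ := h₃
      exact ⟨h * k * (h : H.1.amb)⁻¹, d, 1, ⟨by simpa [mul_assoc] using h₂, e,
        by simpa [mul_assoc] using he⟩, ⟨rfl, FPair.exists_rel (hd he.mem h₂.mem), rfl⟩,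
        mul_comm _ _⟩
    · rintro ⟨z, c, d, ⟨h₁, h₂⟩, ⟨rfl, h₃, rfl⟩, rfl⟩
      refine ⟨(g : G.1.amb)⁻¹ * y * g, 1, c, ⟨by simp [mul_assoc], h₂, rfl⟩,
        ⟨by simpa [mul_assoc] using h₁, h₂⟩, mul_comm _ _⟩
  · rw [not_exists] at hc
    rw [upTerm_eq_zero hc, map_zero, upTerm_eq_zero]
    -- A pair contributing at the translate would, moved back by (g, h)⁻¹, contribute to κ at u.
    intro μ' hc'
    obtain ⟨μ, hμ⟩ := ax.exists_conj μ' h⁻¹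
    have := hc'.smul ax hU (g := g⁻¹) (h := h⁻¹) a⁻¹ (κ' := κ) (μ' := μ) (by
      rw [hκ]
      refine FPair.ext_rel fun q b => ?_
      simp only [FPair.rel_conj]
      simp [mul_assoc]) hμ
    apply hc μ
    have e : ((g⁻¹, h⁻¹), a⁻¹) • ((g, h), a) • u = u := inv_smul_smul ((g, h), a) u
    rwa [e] at this

omit U hU in
theorem ev_diag_conj_one {κ : MPair A G} (m : M κ.obj) :
    F.ev κ.obj κ.obj ((FPair.diag κ.pair.dom).conj (((1 : G.grp) : G.1.amb), 1)) m = m := by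
  have e : (FPair.diag κ.pair.dom : FPair A _).conj (((1 : G.grp) : G.1.amb), 1) =
      FPair.diag κ.pair.dom := by
    refine FPair.ext_rel fun q b => ?_
    rw [FPair.rel_conj]
    simp [← Prod.one_eq_mk]
  rw [e]
  exact ev_diag_self F ax κ.obj m

theorem upTerm_rel (x : UpperPlus F H) {u u' : U.X} (κ : MPair A G) (h : ahRel U u u') :
    upTerm F U u κ x.1 = upTerm F U u' κ x.1 := by
  obtain ⟨h, a, rfl⟩ := h
  rw [upTerm_act ax hU x u (κ := κ) (κ' := κ) 1 h a, ev_diag_conj_one ax]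
  refine FPair.ext_rel fun q b => ?_
  rw [FPair.rel_conj]
  simp

theorem upTerm_out (x : UpperPlus F H) (u : U.X) (κ : MPair A G) :
    upTerm F U (Quotient.mk (ahRel U) u).out κ x.1 = upTerm F U u κ x.1 :=
  upTerm_rel ax hU x κ (Quotient.exact (Quotient.out_eq _))

omit ax hU in
-- Only finitely many orbits of U and finitely many μ in the support of x are involved, and for each
-- choice of both, κ is determined by its subgroup.
theorem finite_upSum (x : ⨁ μ : MPair A H, M μ.obj) :
    {κ : MPair A G | ∑ᶠ c : Quotient (ahRel U), upTerm F U c.out κ x ≠ 0}.Finite := by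
  classical
  have hx : {μ | x μ ≠ 0}.Finite := DFinsupp.finite_support x
  refine (Set.Finite.subset (Set.finite_iUnion fun c : Quotient (ahRel U) => hx.biUnion
    fun μ _ => finite_mPair {κ : MPair A G | Contributes U c.out κ μ}
      fun κ hκ κ' hκ' e => Contributes.eq_of_dom hκ hκ' e) ?_)
  intro κ hκ
  obtain ⟨c, hc⟩ : ∃ c : Quotient (ahRel U), upTerm F U c.out κ x ≠ 0 := by
    by_contra! h
    exact hκ ((finsum_congr h).trans finsum_zero)
  by_cases h : ∃ μ, Contributes U c.out κ μ
  · obtain ⟨μ, h⟩ := h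
    rw [upTerm_eq h] at hc
    refine Set.mem_iUnion.mpr ⟨c, Set.mem_biUnion (x := μ) ?_ h⟩
    intro h0
    rw [h0, map_zero] at hc
    exact hc rfl
  · rw [not_exists] at h
    exact absurd (upTerm_eq_zero h x) hc

/-- Left multiplication by g commutes with the actions of A and H, so it permutes the (A, H)-orbits.
Reindexing along this permutation matches the terms by `upTerm_act`. -/
theorem upSum_mem (x : UpperPlus F H) :
    directSumMk _ (finite_upSum (F := F) (U := U) x.1) ∈ UpperPlus F G := by
  intro g κ μ h
  rw [directSumMk_apply, directSumMk_apply]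
  refine ((F.ev μ.obj κ.obj _).toAddMonoidHom.map_finsum (Set.toFinite _)).trans ?_
  have hcomm : ∀ (g : G.grp) (k : H.grp) (a : A) (u : U.X), ((g, (1 : H.grp)), (1 : A)) •
      (((1 : G.grp), k), a) • u = (((1 : G.grp), k), a) • ((g, (1 : H.grp)), (1 : A)) • u := by
    intro g k a u
    simp [smul_smul]
  let e : G.grp → Quotient (ahRel U) → Quotient (ahRel U) := fun g =>
    Quotient.map' (fun u => ((g, (1 : H.grp)), (1 : A)) • u) (by
      rintro u _ ⟨k, a, rfl⟩
      exact ⟨k, a, (hcomm g k a u).symm⟩)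
  have hinv : ∀ g c, e g⁻¹ (e g c) = c := by
    rintro g ⟨u⟩
    refine congrArg (Quotient.mk _) ?_
    simp [smul_smul, mk_one_one_smul]
  refine finsum_eq_of_bijective (e g)
    ⟨Function.LeftInverse.injective (g := e g⁻¹) (hinv g), fun c => ⟨e g⁻¹ c, ?_⟩⟩ fun c => ?_
  · have := hinv g⁻¹ c
    rwa [inv_inv] at this
  · refine (upTerm_act ax hU x c.out g 1 1 h).symm.trans ?_
    refine upTerm_rel ax hU x μ (Quotient.exact ?_)
    rw [Quotient.out_eq]
    conv_rhs => rw [← Quotient.out_eq c]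
    rfl

/-- The map `F⁺([U])`. -/
noncomputable def upperMap (F : FibFunctor S R M) : UpperPlus F H →ₗ[R] UpperPlus F G where
  toFun x := ⟨_, upSum_mem ax hU x⟩
  map_add' x y := by
    refine Subtype.ext (DFinsupp.ext fun κ => ?_)
    refine (directSumMk_apply _ _ κ).trans (Eq.trans ?_ (upperPlus_add_apply _ _ κ).symm)
    refine Eq.trans ?_ (congrArg₂ (· + ·)
      (directSumMk_apply _ (finite_upSum x.1) κ) (directSumMk_apply _ (finite_upSum y.1) κ)).symm
    refine Eq.trans ?_ (finsum_add_distrib (Set.toFinite _) (Set.toFinite _))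
    exact finsum_congr fun c => upTerm_add _ _ _ _
  map_smul' r x := by
    refine Subtype.ext (DFinsupp.ext fun κ => ?_)
    refine (directSumMk_apply _ _ κ).trans (Eq.trans ?_ (upperPlus_smul_apply r _ κ).symm)
    refine Eq.trans ?_ (congrArg (r • ·) (directSumMk_apply _ (finite_upSum x.1) κ)).symm
    refine Eq.trans ?_ (smul_finsum' r (Set.toFinite _)).symm
    exact finsum_congr fun c => upTerm_smul_scalar _ _ _ _

theorem upperMap_apply (x : UpperPlus F H) (κ : MPair A G) :
    (upperMap ax hU F x).1 κ = ∑ᶠ c : Quotient (ahRel U), upTerm F U c.out κ x.1 :=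
  directSumMk_apply _ _ κ

end Term

variable (ax : Axioms S)

theorem upperMap_union {G H : Obj 𝒢} {U V W : Biset A G H} (hU : Good (lower S) U)
    (hV : Good (lower S) V) (hW : Good (lower S) W) {i : U.X → W.X} {j : V.X → W.X}
    (h : FibSet.IsUnion (A := A) (Q := G.grp × H.grp) i j) :
    upperMap ax hW F = upperMap ax hU F + upperMap ax hV F := by
  refine LinearMap.ext fun x => upperPlus_ext fun κ => ?_
  rw [LinearMap.add_apply]
  refine Eq.trans ?_ (upperPlus_add_apply _ _ _).symm
  rw [upperMap_apply, upperMap_apply, upperMap_apply]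
  let i' : Quotient (ahRel U) → Quotient (ahRel W) := Quotient.map' i (by
    rintro u _ ⟨k, a, rfl⟩
    exact ⟨k, a, (h.1 _ _).symm⟩)
  let j' : Quotient (ahRel V) → Quotient (ahRel W) := Quotient.map' j (by
    rintro u _ ⟨k, a, rfl⟩
    exact ⟨k, a, (h.2.1 _ _).symm⟩)
  have hb : Function.Bijective (Sum.elim i' j') := by
    refine bijective_sumElim ?_ ?_ ?_ ?_
    · rintro ⟨u⟩ ⟨v⟩ e
      obtain ⟨k, a, e⟩ := Quotient.exact e
      rw [← h.1] at e
      exact Quotient.sound ⟨k, a, h.inj_left e⟩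
    · rintro ⟨u⟩ ⟨v⟩ e
      obtain ⟨k, a, e⟩ := Quotient.exact e
      rw [← h.2.1] at e
      exact Quotient.sound ⟨k, a, h.inj_right e⟩
    · rintro ⟨u⟩ ⟨v⟩ e
      obtain ⟨k, a, e⟩ := Quotient.exact e
      rw [← h.1] at e
      exact absurd (h.2.2.1 (a₁ := Sum.inl _) (a₂ := Sum.inr _) e) (by simp)
    · rintro ⟨w⟩
      obtain ⟨u | v, rfl⟩ := h.2.2.2 w
      · exact Or.inl ⟨Quotient.mk _ u, rfl⟩
      · exact Or.inr ⟨Quotient.mk _ v, rfl⟩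
  rw [finsum_of_bijective_sumElim _ hb]
  congr 1
  · refine finsum_congr fun c => ?_
    refine (upTerm_rel ax hW x κ (Quotient.exact ?_)).trans (upTerm_map h.1 h.inj_left c.out κ x.1)
    rw [Quotient.out_eq]
    conv_lhs => rw [← Quotient.out_eq c]
    rfl
  · refine finsum_congr fun c => ?_
    refine (upTerm_rel ax hW x κ (Quotient.exact ?_)).trans (upTerm_map h.2.1 h.inj_right c.out κ x.1)
    rw [Quotient.out_eq]
    conv_lhs => rw [← Quotient.out_eq c]
    rfl

/-- The identity biset has a single (A, H)-orbit, and at its base point κ contributes to itself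
through (Δ(K), 1). -/
theorem upperMap_id {G : Obj 𝒢} (h : Good (lower S) (basic G G (FPair.diag G.grp))) :
    upperMap ax h F = LinearMap.id := by
  refine LinearMap.ext fun x => upperPlus_ext fun κ => ?_
  rw [upperMap_apply, LinearMap.id_apply]
  let b := basicMk (A := A) G G (FPair.diag G.grp)
  have hs : ∀ c : Quotient (ahRel (basic G G (FPair.diag (A := A) G.grp))),
      c = Quotient.mk _ (b 1) := by
    rintro ⟨u⟩
    obtain ⟨⟨⟨g, k⟩, a⟩, rfl⟩ := exists_basicMk u
    refine (Quotient.sound ⟨k * g⁻¹, a, ?_⟩ : Quotient.mk (ahRel _) _ = Quotient.mk _ _).symm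
    rw [smul_basicMk, mul_one, basicMk_eq, FPair.rel_diag]
    simp [incl]
  rw [finsum_eq_single _ (Quotient.mk _ (b 1)) fun c hc => absurd (hs c) hc, upTerm_out ax h]
  have e1 : bisetPair (basic G G (FPair.diag G.grp)) (b 1) = FPair.diag G.grp := by
    refine (bisetPair_basic (ax.lower_diag G).1 1).trans (FPair.ext_rel fun x a => ?_)
    rw [FPair.rel_conj]
    simp
  have hc : Contributes (basic G G (FPair.diag G.grp)) (b 1) κ κ := by
    rw [contributes_iff ax h, e1]
    simp only [SetLike.le_def, mem_p1, FPair.mem_dom_iff (P := FPair.diag G.grp), FPair.rel_diag]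
    refine ⟨fun k hk => ⟨k, 1, rfl, κ.le hk, rfl⟩, fun k => ⟨fun hk => ?_, ?_⟩, ?_⟩
    · exact ⟨k, hk, 1, rfl, κ.le hk, rfl⟩
    · rintro ⟨k', hk, a, rfl, _⟩
      exact hk
    · rintro k _ a c hk ⟨rfl, _, rfl⟩ hc
      rwa [one_mul]
  rw [upTerm_eq hc]
  refine Eq.trans (congrArg (fun P => F.ev κ.obj κ.obj P (x.1 κ)) ?_)
    (ev_diag_self F ax κ.obj (x.1 κ))
  rw [e1]
  refine FPair.ext_rel fun y a => ?_
  rw [FPair.rel_resLeft, FPair.rel_diag, FPair.rel_diag]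
  exact ⟨fun ⟨⟨e, _, h₂⟩, h₃⟩ => ⟨e, h₃, h₂⟩, fun ⟨e, h₃, h₂⟩ => ⟨⟨e, κ.le h₃, h₂⟩, h₃⟩⟩

section Tensor

variable {G H K : Obj 𝒢} {U : Biset A G H} {V : Biset A H K} (hU : Good (lower S) U)
  (hV : Good (lower S) V)

include hV

/-- The intermediate pair is P_v ∗ ν restricted to K^u. The rest is K^{u⊗v} = (K^u)^v and
associativity of the product of the character values. -/
theorem contributes_tensor_iff {u : U.X} {v : V.X} {κ : MPair A G} {ν : MPair A K} :
    Contributes (G := G) (H := K) (tensor U V) ((ax.rFree hU).tmk u v) κ ν ↔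
      ∃ μ, Contributes U u κ μ ∧ Contributes V v μ ν := by
  have hdom : ∀ {μ : MPair A H}, Contributes U u κ μ → ∀ k,
      ((∃ h ∈ μ.pair.dom, (h, k) ∈ (bisetPair V v).dom) ↔ ∃ g ∈ κ.pair.dom,
        (g, k) ∈ (bisetPair (G := G) (H := K) (tensor U V) ((ax.rFree hU).tmk u v)).dom) := by
    intro μ hc k
    rw [contributes_iff ax hU] at hc
    simp only [FPair.mem_dom_iff (P := bisetPair (G := G) (H := K) (tensor U V) _),
      rel_bisetPair_tensor]
    constructor
    · rintro ⟨h, hh, hk⟩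
      obtain ⟨g, hg, hgh⟩ := (hc.2.1 h).mp hh
      obtain ⟨b, hb⟩ := FPair.exists_rel hgh
      obtain ⟨c, hc'⟩ := FPair.exists_rel hk
      exact ⟨g, hg, _, h, b, c, hb, hc', rfl⟩
    · rintro ⟨g, hg, _, h, b, c, hb, hc', rfl⟩
      exact ⟨h, (hc.2.1 h).mpr ⟨g, hg, hb.mem⟩, hc'.mem⟩
  constructor
  · intro hc
    have hc0 := hc
    rw [contributes_iff ax (G := G) (H := K) (U := tensor U V) (ax.good_tensor hU hV)] at hc
    obtain ⟨h₁, h₂, h₃⟩ := hc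
    have hk2 : ∀ k, (1, k) ∈ (bisetPair V v).dom → k = 1 := fun k hk => ax.lower_eq_one (hV v) hk
    -- A contribution of ν at u ⊗ v says that κ lies below P_u ∗ (P_v ∗ ν), so the order criterion
    -- for contributions at u produces μ below P_v ∗ ν.
    obtain ⟨μ, hμ, hle⟩ := (exists_contributes_le_iff ax hU (u := u) (κ := κ)
      (ν := (bisetPair V v).act hk2 ν.pair)).mpr (by
        intro g a hg
        obtain ⟨k, hk⟩ := mem_p1.mp (h₁ hg.mem)
        obtain ⟨_, hk⟩ := FPair.exists_rel hk
        obtain ⟨c, hc⟩ := FPair.exists_rel ((h₂ k).mpr ⟨g, hg.mem, hk.mem⟩)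
        obtain ⟨h, b, d, hb, hd, rfl⟩ := (rel_bisetPair_tensor _).mp hk
        refine ⟨h, b, d * c, hb, FPair.rel_act.mpr ⟨k, d, c, hd, hc, rfl⟩, ?_⟩
        rw [← mul_assoc]
        exact (h₃ _ _ _ _ hg.mem hk hc).unique hg)
    refine ⟨μ, hμ, (contributes_iff ax hV).mpr ⟨?_, ?_, ?_⟩⟩
    · intro h hh
      obtain ⟨a, ha⟩ := FPair.exists_rel hh
      obtain ⟨k, b, c, hb, _⟩ := FPair.rel_act.mp (FPair.le_iff_rel.mp hle _ _ ha)
      exact mem_p1.mpr ⟨k, hb.mem⟩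
    · intro k
      rw [hdom hμ, h₂]
    · intro h k b c hh hb hc
      obtain ⟨a, ha⟩ := FPair.exists_rel hh
      have : ((bisetPair V v).act hk2 ν.pair).Rel h (b * c) :=
        FPair.rel_act.mpr ⟨k, b, c, hb, hc, rfl⟩
      rwa [this.unique (FPair.le_iff_rel.mp hle _ _ ha)]
  · rintro ⟨μ, hμ, hν⟩
    have hd := hdom hμ
    rw [contributes_iff ax hU] at hμ
    rw [contributes_iff ax hV] at hν
    refine (contributes_iff ax (G := G) (H := K) (U := tensor U V)
      (ax.good_tensor hU hV)).mpr ⟨?_, ?_, ?_⟩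
    · intro g hg
      obtain ⟨h, hh⟩ := mem_p1.mp (hμ.1 hg)
      obtain ⟨k, hk⟩ := mem_p1.mp (hν.1 ((hμ.2.1 h).mpr ⟨g, hg, hh⟩))
      obtain ⟨b, hb⟩ := FPair.exists_rel hh
      obtain ⟨c, hc⟩ := FPair.exists_rel hk
      exact mem_p1.mpr ⟨k, ((rel_bisetPair_tensor _).mpr ⟨h, b, c, hb, hc, rfl⟩).mem⟩
    · intro k
      rw [hν.2.1, hd]
    · intro g k a c hg ha hc
      obtain ⟨h, b, d, hb, hd, rfl⟩ := (rel_bisetPair_tensor _).mp ha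
      rw [mul_assoc]
      have hh := (hμ.2.1 h).mpr ⟨g, hg, hb.mem⟩
      exact hμ.2.2 _ _ _ _ hg hb (hν.2.2 _ _ _ _ hh hd hc)

theorem upTerm_tensor {u : U.X} (v : V.X) {κ : MPair A G} {μ : MPair A H}
    (h : Contributes U u κ μ) (x : ⨁ ν : MPair A K, M ν.obj) :
    upTerm F (G := G) (H := K) (tensor U V) ((ax.rFree hU).tmk u v) κ x =
      F.ev κ.obj μ.obj (FPair.resLeft κ.pair.dom (bisetPair (G := G) (H := H) U u))
        (upTerm F V v μ x) := by
  by_cases hν : ∃ ν, Contributes V v μ ν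
  · obtain ⟨ν, hν⟩ := hν
    have hc := (contributes_tensor_iff ax hU hV).mpr ⟨μ, h, hν⟩
    rw [upTerm_eq hν, upTerm_eq hc]
    refine (ev_comp ax (h.adm ax hU) (hν.adm ax hV) (fun g k a => ?_) _).symm
    simp only [FPair.rel_resLeft, rel_bisetPair_tensor]
    constructor
    · rintro ⟨⟨y, b, c, hb, hc, e⟩, hg⟩
      refine ⟨y, b, c, ⟨hb, hg⟩, ⟨hc, ?_⟩, e⟩
      rw [h.2.1]
      exact ⟨g, hg, hb.mem⟩
    · rintro ⟨y, b, c, ⟨hb, hg⟩, ⟨hc, _⟩, e⟩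
      exact ⟨⟨y, b, c, hb, hc, e⟩, hg⟩
  · have hν' : ∀ ν, ¬ Contributes (G := G) (H := K) (tensor U V) ((ax.rFree hU).tmk u v) κ ν := by
      intro ν hc
      obtain ⟨μ', hμ', hν'⟩ := (contributes_tensor_iff ax hU hV).mp hc
      rw [← h.unique hμ'] at hν'
      exact hν ⟨ν, hν'⟩
    rw [not_exists] at hν
    rw [upTerm_eq_zero hν, upTerm_eq_zero hν', map_zero]

theorem upTerm_tensor_eq_zero {u : U.X} (v : V.X) {κ : MPair A G}
    (h : ∀ μ, ¬ Contributes U u κ μ) (x : ⨁ ν : MPair A K, M ν.obj) :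
    upTerm F (G := G) (H := K) (tensor U V) ((ax.rFree hU).tmk u v) κ x = 0 :=
  upTerm_eq_zero (fun ν hc => by
    obtain ⟨μ, hμ, _⟩ := (contributes_tensor_iff ax hU hV).mp hc
    exact h μ hμ) x

omit hV in
-- For surjectivity the left factor is moved to its chosen representative and the balancing element
-- passes to V. For injectivity the element that relates two pairs fixes u up to A, so its H-part is
-- trivial and only the action of K × A on V remains.
theorem bijective_tensor_orbits (hU : RFree U) : Function.Bijective
    (fun p : Quotient (ahRel U) × Quotient (ahRel V) =>
      Quotient.mk (ahRel (G := G) (H := K) (tensor U V)) (hU.tmk p.1.out p.2.out)) := by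
  constructor
  · rintro ⟨c, d⟩ ⟨c', d'⟩ e
    obtain ⟨k, b, e⟩ := Quotient.exact e
    rw [hU.smul_tmk, hU.tmk_eq] at e
    obtain ⟨h, a, e₁, e₂⟩ := e
    simp only [smul_smul, Prod.mk_mul_mk, one_mul, mul_one] at e₁ e₂
    have hc : c = c' := by
      rw [← Quotient.out_eq c, ← Quotient.out_eq c']
      exact Quotient.sound ⟨h, _, e₁⟩
    subst hc
    obtain ⟨rfl, _⟩ := hU.eq_one e₁
    refine Prod.ext rfl ?_
    change d = d'
    rw [← Quotient.out_eq d, ← Quotient.out_eq d']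
    exact Quotient.sound ⟨k, _, e₂⟩
  · rintro ⟨w⟩
    obtain ⟨u, v, rfl⟩ := hU.exists_tmk w
    obtain ⟨h, a, hu⟩ : ahRel U (Quotient.mk (ahRel U) u).out u :=
      Quotient.exact (Quotient.out_eq _)
    let v' : V.X := ((h⁻¹, (1 : K.grp)), a) • v
    have e1 : hU.tmk u v = hU.tmk (V := V) (Quotient.mk (ahRel U) u).out v' := by
      conv_lhs => rw [← hu]
      rw [hU.tmk_smul]
    obtain ⟨k, b, hv⟩ : ahRel V (Quotient.mk (ahRel V) v').out v' :=
      Quotient.exact (Quotient.out_eq _)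
    refine ⟨(Quotient.mk (ahRel U) u, Quotient.mk (ahRel V) v'), Quotient.sound ⟨k, b, ?_⟩⟩
    rw [e1]
    refine (hU.smul_tmk 1 k b _ _).trans ?_
    rw [hU.tmk_smul]
    refine congrArg _ (Eq.trans ?_ hv)
    simp [smul_smul]

/-- For each (A, H)-orbit of U there is at most one intermediate μ. The terms over the orbits of V
add up to the μ-component of F⁺([V])(x), to which F at the restricted P_u is applied; without such a
μ both sides vanish. -/
theorem upperMap_tensor :
    upperMap ax (G := G) (H := K) (U := tensor U V) (ax.good_tensor hU hV) F =
      upperMap ax hU F ∘ₗ upperMap ax hV F := by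
  refine LinearMap.ext fun x => upperPlus_ext fun κ => ?_
  rw [LinearMap.comp_apply, upperMap_apply, upperMap_apply,
    finsum_of_bijective_prod _ (bijective_tensor_orbits (ax.rFree hU))]
  refine finsum_congr fun c => ?_
  by_cases h : ∃ μ, Contributes U c.out κ μ
  · obtain ⟨μ, h⟩ := h
    rw [upTerm_eq h, upperMap_apply]
    refine Eq.trans ?_ ((F.ev κ.obj μ.obj _).toAddMonoidHom.map_finsum (Set.toFinite _)).symm
    refine finsum_congr fun d => ?_
    rw [upTerm_out ax (G := G) (H := K) (U := tensor U V) (ax.good_tensor hU hV)]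
    exact upTerm_tensor ax hU hV _ h _
  · rw [not_exists] at h
    rw [upTerm_eq_zero h]
    refine (finsum_congr fun d => ?_).trans finsum_zero
    rw [upTerm_out ax (G := G) (H := K) (U := tensor U V) (ax.good_tensor hU hV)]
    exact upTerm_tensor_eq_zero ax hU hV _ h _

end Tensor

theorem exists_upperFunctor (F : FibFunctor S R M) :
    ∃ Fu : FibFunctor (lower S) R (fun G => UpperPlus F G), ∀ (G H : Obj 𝒢) (U : Biset A G H)
      (hU : Good (lower S) U), Fu.map G H ⟨cls R U, cls_mem_homR R hU⟩ = upperMap ax hU F :=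
  ax.exists_functor (N := fun G => UpperPlus F G) (fun _ _ _ hU => upperMap ax hU F)
    (fun _ _ _ _ _ hU hV hW _ _ h => upperMap_union ax hU hV hW h)
    (fun _ h => upperMap_id ax h) fun _ _ _ _ _ hU hV => upperMap_tensor ax hU hV

/-- The defining property of `F⁺`, for a family of morphisms that is equal to `𝒮⁺`. -/
theorem isUpperPlus_iff {T : Family A 𝒢} (hT : T = lower S)
    {Fu : FibFunctor T R (fun G => UpperPlus F G)} :
    (∀ (G H : Obj 𝒢) (U : Biset A G H), (∀ u, bisetPair U u ∈ T G H) →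
      ∃ hU : cls R U ∈ homR R T G H, ∀ rep : Quotient (ahRel U) → U.X, IsRep (ahRel U) rep →
        ∀ (x : UpperPlus F H) (κ : MPair A G), (Fu.map G H ⟨cls R U, hU⟩ x).1 κ =
          ∑ᶠ c : Quotient (ahRel U), upTerm F U (rep c) κ x.1) ↔
      ∀ (G H : Obj 𝒢) (U : Biset A G H) (hU : Good (lower S) U),
        Fu.map G H ⟨cls R U, cls_mem_homR R (hT ▸ hU)⟩ = upperMap ax hU F := by
  subst hT
  constructor
  · intro h G H U hU
    obtain ⟨hc, h⟩ := h G H U hU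
    refine LinearMap.ext fun x => upperPlus_ext fun κ => ?_
    rw [upperMap_apply, h _ (fun c => Quotient.out_eq c)]
  · intro h G H U (hU : Good (lower S) U)
    refine ⟨cls_mem_homR R hU, fun rep hrep x κ => ?_⟩
    rw [h G H U hU, upperMap_apply]
    refine finsum_congr fun c => upTerm_rel ax hU x κ (Quotient.exact ?_)
    rw [Quotient.out_eq, hrep]

end UpperMaps

/-! ### The mark maps and their naturality. -/

section Mark

variable {A : Type u} [CommGroup A] {𝒢 : GroupClass.{u}} {R : Type w} [CommRing R]
  {S : Family A 𝒢} {M : Obj 𝒢 → Type v} [∀ G, AddCommGroup (M G)] [∀ G, Module R (M G)]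
  {F : FibFunctor S R M}

theorem FPair.conj_le_conj_iff {Q : Type u} [Group Q] {P P' : FPair A Q} (g : Q) :
    P.conj g ≤ P'.conj g ↔ P ≤ P' := by
  simp only [FPair.le_iff_rel, FPair.rel_conj]
  refine ⟨fun h q a hq => ?_, fun h q a hq => h _ _ hq⟩
  have := h (g * q * g⁻¹) a (by simpa [mul_assoc] using hq)
  simpa [mul_assoc] using this

open Classical in
/-- The contribution of the `A`-orbit of `x` to the `κ`-component of the mark of `(X, s)`. -/
noncomputable def markTerm {G : Obj 𝒢} (X : SecObj F G) (x : X.X.X) (κ : MPair A G) : M κ.obj :=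
  if κ.pair ≤ setPair X.X x then
    F.ev κ.obj (X.stabObj x) (FPair.diag κ.pair.dom) (X.s.1 x) else 0

section Term

variable {G : Obj 𝒢} {X : SecObj F G}

theorem markTerm_eq {x : X.X.X} {κ : MPair A G} (h : κ.pair ≤ setPair X.X x) :
    markTerm X x κ = F.ev κ.obj (X.stabObj x) (FPair.diag κ.pair.dom) (X.s.1 x) :=
  if_pos h

theorem markTerm_eq_zero {x : X.X.X} {κ : MPair A G} (h : ¬ κ.pair ≤ setPair X.X x) :
    markTerm X x κ = 0 :=
  if_neg h

variable (ax : Axioms S)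

include ax

theorem adm_diag_stab {x : X.X.X} {κ : MPair A G} (h : κ.pair ≤ setPair X.X x) :
    Adm S κ.obj (X.stabObj x) (FPair.diag κ.pair.dom) :=
  ax.adm_diag G h.1 κ.mem (X.mem x)

/-- Conjugation preserves the order on pairs, and restricting to κ commutes with conjugation by g;
the section already satisfies the required equivariance. -/
theorem markTerm_act (x : X.X.X) {κ κ' : MPair A G} (g : G.grp) (a : A)
    (hκ : κ'.pair = κ.pair.conj (g : G.1.amb)) : markTerm X ((g, a) • x) κ' =
      F.ev κ'.obj κ.obj ((FPair.diag κ.pair.dom).conj ((g : G.1.amb), 1)) (markTerm X x κ) := by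
  have hiff : κ'.pair ≤ setPair X.X ((g, a) • x) ↔ κ.pair ≤ setPair X.X x := by
    rw [hκ, setPair_smul, FPair.conj_le_conj_iff]
  by_cases h : κ.pair ≤ setPair X.X x
  · rw [markTerm_eq h, markTerm_eq (hiff.mpr h), ← X.s.2 g a x]
    refine ev_comp_eq ax (adm_diag_stab ax (hiff.mpr h)) (stabMem_adm_conj ax X.mem g a x)
      (ax.mPair_adm_conj hκ) (adm_diag_stab ax h) (fun y k b => ?_) _
    simp only [FPair.rel_diag_conj]
    simp only [hκ, FPair.rel_diag, FPair.mem_dom_iff, FPair.rel_conj]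
    have hle := FPair.le_iff_rel.mp h
    constructor
    · rintro ⟨z, c, d, ⟨rfl, ⟨e, he⟩, rfl⟩, ⟨rfl, h₂, rfl⟩, rfl⟩
      exact ⟨_, 1, 1, ⟨rfl, ⟨e, by simpa [mul_assoc] using he⟩, rfl⟩, ⟨rfl, ⟨e, hle _ _ he⟩, rfl⟩,
        rfl⟩
    · rintro ⟨z, c, d, ⟨rfl, h₂, rfl⟩, ⟨rfl, h₃, rfl⟩, rfl⟩
      have h₄ : ∃ a, κ.pair.Rel k a := by simpa [mul_assoc] using h₂
      exact ⟨k, 1, 1, ⟨rfl, h₄, rfl⟩, ⟨rfl, h₄, rfl⟩, rfl⟩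
  · rw [markTerm_eq_zero h, markTerm_eq_zero (mt hiff.mp h), map_zero]

theorem markTerm_rel {x y : X.X.X} (κ : MPair A G) (h : aRel A G.grp X.X.X x y) :
    markTerm X x κ = markTerm X y κ := by
  obtain ⟨a, rfl⟩ := h
  rw [markTerm_act ax x (κ := κ) (κ' := κ) 1 a, ev_diag_conj_one ax]
  refine FPair.ext_rel fun q b => ?_
  rw [FPair.rel_conj]
  simp

omit ax in
-- A pair below (G_x, φ_x) has the restriction of φ_x as its character, so it is determined by its
-- subgroup.
theorem finite_markSum (X : SecObj F G) :
    {κ : MPair A G | ∑ᶠ c : X.X.Orb, markTerm X c.out κ ≠ 0}.Finite := by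
  refine (Set.finite_iUnion fun c : X.X.Orb => finite_mPair
    {κ : MPair A G | κ.pair ≤ setPair X.X c.out} fun κ hκ μ hμ e => ?_).subset ?_
  · refine MPair.ext_pair (FPair.eq_of_le_of_dom ?_ e.ge)
    refine FPair.le_iff_rel.mpr fun q a hq => ?_
    have hq' : q ∈ μ.pair.dom := e ▸ hq.mem
    obtain ⟨b, hb⟩ := FPair.exists_rel hq'
    rwa [(FPair.le_iff_rel.mp hκ _ _ hq).unique (FPair.le_iff_rel.mp hμ _ _ hb)]
  · intro κ hκ
    obtain ⟨c, hc⟩ : ∃ c : X.X.Orb, markTerm X c.out κ ≠ 0 := by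
      by_contra! h
      exact hκ ((finsum_congr h).trans finsum_zero)
    refine Set.mem_iUnion.mpr ⟨c, ?_⟩
    by_contra h
    exact hc (markTerm_eq_zero h)

theorem markSum_mem (X : SecObj F G) : directSumMk _ (finite_markSum X) ∈ UpperPlus F G := by
  intro g κ μ h
  rw [directSumMk_apply, directSumMk_apply]
  refine ((F.ev μ.obj κ.obj _).toAddMonoidHom.map_finsum (Set.toFinite _)).trans ?_
  let e : G.grp → X.X.Orb → X.X.Orb := fun g => Quotient.map' (fun x => (g, (1 : A)) • x) (by
    rintro x _ ⟨a, rfl⟩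
    exact ⟨a, by simp [smul_smul]⟩)
  have hinv : ∀ g c, e g⁻¹ (e g c) = c := by
    rintro g ⟨x⟩
    refine congrArg (Quotient.mk _) ?_
    simp [smul_smul, ← Prod.one_eq_mk]
  refine finsum_eq_of_bijective (e g)
    ⟨Function.LeftInverse.injective (g := e g⁻¹) (hinv g), fun c => ⟨e g⁻¹ c, ?_⟩⟩ fun c => ?_
  · have := hinv g⁻¹ c
    rwa [inv_inv] at this
  · refine (markTerm_act ax c.out g 1 h).symm.trans ?_
    refine markTerm_rel ax μ (Quotient.exact ?_)
    rw [Quotient.out_eq]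
    conv_rhs => rw [← Quotient.out_eq c]
    rfl

/-- The mark of `(X, s)`. -/
noncomputable def markVal (X : SecObj F G) : UpperPlus F G := ⟨_, markSum_mem ax X⟩

theorem markVal_apply (X : SecObj F G) (κ : MPair A G) :
    (markVal ax X).1 κ = ∑ᶠ c : X.X.Orb, markTerm X c.out κ :=
  directSumMk_apply _ _ κ

theorem SecObj.IsHom.markTerm_eq {Y : SecObj F G} {f : X.X.X → Y.X.X} (h : X.IsHom Y f)
    (x : X.X.X) (κ : MPair A G) : markTerm Y (f x) κ = markTerm X x κ := by
  by_cases hκ : κ.pair ≤ setPair X.X x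
  · have hκ' : κ.pair ≤ setPair Y.X (f x) := by rwa [← h.pair_eq x]
    rw [Fibered.markTerm_eq hκ, Fibered.markTerm_eq hκ', h.sec_eq ax x]
    refine ev_comp ax (adm_diag_stab ax hκ') (ax.adm_diag_of_eq (h.dom_eq x).symm _ _)
      (fun y k b => ?_) _
    simp only [FPair.rel_diag]
    constructor
    · rintro ⟨rfl, h₁, rfl⟩
      exact ⟨_, 1, 1, ⟨rfl, h₁, rfl⟩, ⟨rfl, hκ.1 h₁, rfl⟩, mul_one 1⟩
    · rintro ⟨z, c, d, ⟨rfl, h₁, rfl⟩, ⟨rfl, h₂, rfl⟩, rfl⟩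
      exact ⟨rfl, h₁, mul_one 1⟩
  · rw [markTerm_eq_zero hκ, markTerm_eq_zero (by rwa [← h.pair_eq x])]

theorem markVal_of_isCoprod {Y Z : SecObj F G} (h : X.IsCoprod Y Z) :
    markVal ax Z = markVal ax X + markVal ax Y := by
  obtain ⟨i, j, hi, hj, hb⟩ := h
  have hu : FibSet.IsUnion (A := A) (Q := G.grp) i j := ⟨hi.1, hj.1, hb⟩
  refine upperPlus_ext fun κ => Eq.trans ?_ (upperPlus_add_apply _ _ _).symm
  rw [markVal_apply, markVal_apply, markVal_apply]
  let i' : X.X.Orb → Z.X.Orb := Quotient.map' i (by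
    rintro x _ ⟨a, rfl⟩
    exact ⟨a, (hi.1 _ _).symm⟩)
  let j' : Y.X.Orb → Z.X.Orb := Quotient.map' j (by
    rintro x _ ⟨a, rfl⟩
    exact ⟨a, (hj.1 _ _).symm⟩)
  have hb' : Function.Bijective (Sum.elim i' j') := by
    refine bijective_sumElim ?_ ?_ ?_ ?_
    · rintro ⟨x⟩ ⟨y⟩ e
      obtain ⟨a, e⟩ := Quotient.exact e
      rw [← hi.1] at e
      exact Quotient.sound ⟨a, hu.inj_left e⟩
    · rintro ⟨x⟩ ⟨y⟩ e
      obtain ⟨a, e⟩ := Quotient.exact e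
      rw [← hj.1] at e
      exact Quotient.sound ⟨a, hu.inj_right e⟩
    · rintro ⟨x⟩ ⟨y⟩ e
      obtain ⟨a, e⟩ := Quotient.exact e
      rw [← hi.1] at e
      exact absurd (hb.1 (a₁ := Sum.inl _) (a₂ := Sum.inr _) e) (by simp)
    · rintro ⟨z⟩
      obtain ⟨x | y, rfl⟩ := hb.2 z
      · exact Or.inl ⟨Quotient.mk _ x, rfl⟩
      · exact Or.inr ⟨Quotient.mk _ y, rfl⟩
  rw [finsum_of_bijective_sumElim _ hb']
  congr 1
  · refine finsum_congr fun c => ?_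
    refine (markTerm_rel ax κ (Quotient.exact ?_)).trans (hi.markTerm_eq ax c.out κ)
    rw [Quotient.out_eq]
    conv_lhs => rw [← Quotient.out_eq c]
    rfl
  · refine finsum_congr fun c => ?_
    refine (markTerm_rel ax κ (Quotient.exact ?_)).trans (hj.markTerm_eq ax c.out κ)
    rw [Quotient.out_eq]
    conv_lhs => rw [← Quotient.out_eq c]
    rfl

omit ax in
theorem markTerm_add (X : GSet A G) (hX : StabMem X) (s r : Sec F X hX) (x : X.X)
    (κ : MPair A G) : markTerm (F := F) ⟨X, hX, s + r⟩ x κ =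
      markTerm (F := F) ⟨X, hX, s⟩ x κ + markTerm (F := F) ⟨X, hX, r⟩ x κ := by
  unfold markTerm
  split_ifs
  · exact map_add (F.ev _ _ _) _ _
  · exact (add_zero 0).symm

omit ax in
theorem markTerm_scale (r : R) (X : SecObj F G) (x : X.X.X) (κ : MPair A G) :
    markTerm (X.scale r) x κ = r • markTerm X x κ := by
  unfold markTerm
  by_cases h : κ.pair ≤ setPair X.X x
  · exact (if_pos h).trans ((map_smul (F.ev _ _ _) r _).trans (congrArg _ (if_pos h).symm))
  · exact (if_neg h).trans ((smul_zero r).symm.trans (congrArg _ (if_neg h).symm))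

theorem exists_markMap (F : FibFunctor S R M) (G : Obj 𝒢) :
    ∃ f : LowerPlus F G →ₗ[R] UpperPlus F G, ∀ X : SecObj F G, f X.cl = markVal ax X := by
  refine exists_lowerPlus_lift _ (fun X Y Z h => markVal_of_isCoprod ax h)
    (fun X hX s r => upperPlus_ext fun κ => ?_) (fun r X => upperPlus_ext fun κ => ?_)
  · refine Eq.trans ?_ (upperPlus_add_apply _ _ _).symm
    rw [markVal_apply, markVal_apply, markVal_apply]
    refine Eq.trans ?_ (finsum_add_distrib (Set.toFinite _) (Set.toFinite _))
    exact finsum_congr fun c => markTerm_add X hX s r _ κ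
  · refine Eq.trans ?_ (upperPlus_smul_apply r _ κ).symm
    rw [markVal_apply, markVal_apply]
    refine Eq.trans ?_ (smul_finsum' r (Set.toFinite _)).symm
    exact finsum_congr fun c => markTerm_scale r X _ κ

/-- The mark map `m_{F,G}`. -/
noncomputable def markMap (F : FibFunctor S R M) (G : Obj 𝒢) :
    LowerPlus F G →ₗ[R] UpperPlus F G :=
  (exists_markMap ax F G).choose

theorem markMap_cl (X : SecObj F G) (κ : MPair A G) :
    (markMap ax F G X.cl).1 κ = ∑ᶠ c : X.X.Orb, markTerm X c.out κ := by
  rw [markMap, (exists_markMap ax F G).choose_spec X, markVal_apply]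

end Term

variable (ax : Axioms S)

/-- The prescribed values on the classes [X, s] leave no freedom, and `markTerm_rel` makes the
choice of representatives irrelevant. -/
theorem isMark_iff {m : ∀ G : Obj 𝒢, LowerPlus F G →ₗ[R] UpperPlus F G} :
    IsMark F m ↔ m = markMap ax F := by
  constructor
  · intro h
    refine funext fun G => lowerPlus_ext fun X => upperPlus_ext fun κ => ?_
    rw [markMap_cl]
    exact h G X _ (fun c => Quotient.out_eq c) κ
  · rintro rfl G X rep hrep κ
    rw [markMap_cl]
    refine finsum_congr fun c => markTerm_rel ax κ (Quotient.exact ?_)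
    rw [Quotient.out_eq, hrep]

/-! ### Compatibility of the mark maps with bisets -/

section Commute

theorem bijective_tensorLeft_orbits {G H : Obj 𝒢} {U : Biset A G H} {X : GSet A H}
    (hU : RFree U) : Function.Bijective (fun p : Quotient (ahRel U) × X.Orb =>
      (Quotient.mk _ (hU.tmkL p.1.out p.2.out) : (tensorLeft U X).Orb)) := by
  constructor
  · rintro ⟨c, d⟩ ⟨c', d'⟩ e
    obtain ⟨b, e⟩ := Quotient.exact e
    rw [hU.smul_tmkL, hU.tmkL_eq] at e
    obtain ⟨h, a, e₁, e₂⟩ := e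
    simp only [smul_smul, Prod.mk_mul_mk, mul_one] at e₁
    have hc : c = c' := by
      rw [← Quotient.out_eq c, ← Quotient.out_eq c']
      exact Quotient.sound ⟨h, _, e₁⟩
    subst hc
    obtain ⟨rfl, _⟩ := hU.eq_one e₁
    refine Prod.ext rfl ?_
    change d = d'
    rw [← Quotient.out_eq d, ← Quotient.out_eq d']
    exact Quotient.sound ⟨_, e₂⟩
  · rintro ⟨w⟩
    obtain ⟨u, x, rfl⟩ := hU.exists_tmkL w
    obtain ⟨h, a, hu⟩ : ahRel U (Quotient.mk (ahRel U) u).out u :=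
      Quotient.exact (Quotient.out_eq _)
    let x' : X.X := (h⁻¹, a) • x
    have e1 : hU.tmkL u x = hU.tmkL (X := X) (Quotient.mk (ahRel U) u).out x' := by
      conv_lhs => rw [← hu]
      rw [hU.tmkL_smul]
    obtain ⟨b, hx⟩ : aRel A H.grp X.X (Quotient.mk (aRel A H.grp X.X) x').out x' :=
      Quotient.exact (Quotient.out_eq _)
    refine ⟨(Quotient.mk (ahRel U) u, Quotient.mk _ x'), Quotient.sound ⟨b, ?_⟩⟩
    rw [e1]
    refine (hU.smul_tmkL 1 b _ _).trans ?_
    refine Eq.trans ?_ (congrArg _ hx)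
    refine (hU.tmkL_smul _ _ _ _).trans ?_
    simp

variable {G H : Obj 𝒢} {U : Biset A G H} (hU : Good (lower S) U)

include hU

/-- The stabilizing pair of u ⊗ x is P_u ∗ (H_x, φ_x), which is the situation of
`exists_contributes_le_iff`. -/
theorem le_tensor_iff {X : SecObj F H} {u : U.X} {x : X.X.X} {κ : MPair A G} :
    κ.pair ≤ setPair (tensorObj ax hU X).X ((ax.rFree hU).tmkL u x) ↔
      ∃ μ : MPair A H, Contributes U u κ μ ∧ μ.pair ≤ setPair X.X x := by
  rw [exists_contributes_le_iff ax hU, FPair.le_iff_rel]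
  exact forall₂_congr fun k a => imp_congr_right fun _ => rel_setPair_tensor _

/-- When μ lies below (H_x, φ_x), restricting to K after applying P_u equals applying P_u,
restricted to K, after restricting to K^u: both give (Δ(K), 1) ∗ P_u, whose second projection K^u
already lies in H_x. Otherwise both sides are zero, since no other pair can contribute. -/
theorem markTerm_tensor {X : SecObj F H} {u : U.X} (x : X.X.X) {κ : MPair A G}
    {μ : MPair A H} (h : Contributes U u κ μ) :
    markTerm (tensorObj ax hU X) ((ax.rFree hU).tmkL u x) κ =
      F.ev κ.obj μ.obj (FPair.resLeft κ.pair.dom (bisetPair (G := G) (H := H) U u))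
        (markTerm X x μ) := by
  by_cases hμ : μ.pair ≤ setPair X.X x
  · have hκ := (le_tensor_iff ax hU).mpr ⟨μ, h, hμ⟩
    rw [markTerm_eq hμ, markTerm_eq hκ]
    refine (congrArg (F.ev _ _ _) (tensorVal_eq ax hU X rfl)).trans ?_
    refine ev_comp_eq ax (adm_diag_stab ax hκ) (adm_tensor ax hU X.mem rfl).2 (h.adm ax hU)
      (adm_diag_stab ax hμ) (fun g k b => ?_) _
    simp only [FPair.rel_diag, FPair.rel_resLeft, FPair.rel_resRight]
    constructor
    · rintro ⟨y, c, d, ⟨h₁, h₂⟩, ⟨rfl, h₃, rfl⟩, rfl⟩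
      exact ⟨g, 1, c, ⟨rfl, h₂, rfl⟩, ⟨h₁, hμ.1 h₃⟩, mul_comm _ _⟩
    · rintro ⟨y, c, d, ⟨rfl, h₂, rfl⟩, ⟨h₁, _⟩, rfl⟩
      refine ⟨k, d, 1, ⟨h₁, h₂⟩, ⟨rfl, ?_, rfl⟩, mul_comm _ _⟩
      rw [h.2.1]
      exact ⟨_, h₂, h₁.mem⟩
  · rw [markTerm_eq_zero hμ, map_zero]
    refine markTerm_eq_zero fun hκ => ?_
    obtain ⟨μ', h', hμ'⟩ := (le_tensor_iff ax hU).mp hκ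
    rw [← h.unique h'] at hμ'
    exact hμ hμ'

/-- The A-orbits of U ⊗_{AH} X form the product of the orbit sets of U and X. For a fixed orbit of U
the sum over X is F at the restricted P_u applied to the μ-component of the mark of (X, s). -/
theorem markMap_lowerMap (F : FibFunctor S R M) :
    markMap ax F G ∘ₗ lowerMap ax hU F = upperMap ax hU F ∘ₗ markMap ax F H := by
  refine lowerPlus_ext fun X => upperPlus_ext fun κ => ?_
  rw [LinearMap.comp_apply, LinearMap.comp_apply, lowerMap_cl, markMap_cl, upperMap_apply]
  refine (finsum_of_bijective_prod _ (bijective_tensorLeft_orbits (X := X.X)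
    (ax.rFree hU))).trans (finsum_congr fun c => ?_)
  have ho : ∀ d : X.X.Orb, markTerm (tensorObj ax hU X)
      (Quotient.mk (aRel A G.grp (tensorObj ax hU X).X.X)
        ((ax.rFree hU).tmkL c.out d.out)).out κ =
      markTerm (tensorObj ax hU X) ((ax.rFree hU).tmkL c.out d.out) κ := fun d =>
    markTerm_rel ax κ (Quotient.exact (Quotient.out_eq _))
  refine (finsum_congr ho).trans ?_
  by_cases h : ∃ μ, Contributes U c.out κ μ
  · obtain ⟨μ, h⟩ := h
    rw [upTerm_eq h, markMap_cl]
    refine Eq.trans ?_ ((F.ev κ.obj μ.obj _).toAddMonoidHom.map_finsum (Set.toFinite _)).symm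
    exact finsum_congr fun d => markTerm_tensor ax hU _ h
  · rw [not_exists] at h
    rw [upTerm_eq_zero h]
    refine (finsum_congr fun d => markTerm_eq_zero fun hκ => ?_).trans finsum_zero
    obtain ⟨μ, hμ, _⟩ := (le_tensor_iff ax hU).mp hκ
    exact h μ hμ

end Commute

/-- Naturality of the mark maps, where the family of the target functor is equal to `𝒮₊`. -/
theorem mark_natural {T : Family A 𝒢} (hT : T = lower S)
    {Fp : FibFunctor (lower S) R (LowerPlus F)}
    {Fu : FibFunctor T R (fun G => UpperPlus F G)}
    (hp : ∀ (G H : Obj 𝒢) (U : Biset A G H) (hU : Good (lower S) U),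
      Fp.map G H ⟨cls R U, cls_mem_homR R hU⟩ = lowerMap ax hU F)
    (hu : ∀ (G H : Obj 𝒢) (U : Biset A G H) (hU : Good (lower S) U),
      Fu.map G H ⟨cls R U, cls_mem_homR R (hT ▸ hU)⟩ = upperMap ax hU F)
    (G H : Obj 𝒢) (b : BR A (G.grp × H.grp) R) (h : b ∈ homR R (lower S) G H)
    (h' : b ∈ homR R T G H) :
    markMap ax F G ∘ₗ Fp.map G H ⟨b, h⟩ = Fu.map G H ⟨b, h'⟩ ∘ₗ markMap ax F H := by
  subst hT
  -- Both composites are linear in the morphism, so it suffices to compare them on classes of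
  -- bisets, where `markMap_lowerMap` applies.
  let f : homR R (lower S) G H →ₗ[R] LowerPlus F H →ₗ[R] UpperPlus F G :=
    { toFun := fun b => markMap ax F G ∘ₗ Fp.map G H b
      map_add' := fun b c => by rw [map_add, LinearMap.comp_add]
      map_smul' := fun r b => by rw [map_smul, LinearMap.comp_smul, RingHom.id_apply] }
  let f' : homR R (lower S) G H →ₗ[R] LowerPlus F H →ₗ[R] UpperPlus F G :=
    { toFun := fun b => Fu.map G H b ∘ₗ markMap ax F H
      map_add' := fun b c => by rw [map_add, LinearMap.add_comp]
      map_smul' := fun r b => by rw [map_smul, LinearMap.smul_comp, RingHom.id_apply] }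
  have e : f = f' := by
    refine ax.homR_ext (f := f) (g := f') fun U hU => ?_
    change markMap ax F G ∘ₗ Fp.map G H _ = Fu.map G H _ ∘ₗ markMap ax F H
    rw [hp G H U hU, hu G H U hU, markMap_lowerMap]
  exact LinearMap.congr_fun e ⟨b, h⟩

end Mark

/-- The construction is carried out over 𝒮₊. Passing through an arbitrary family equal to 𝒮₊ lets
the equality with 𝒮⁺ be substituted, so that no functor has to be transported along it. -/
theorem existsUnique_isUpperPlus {A : Type u} [CommGroup A] {𝒢 : GroupClass.{u}} {R : Type w}
    [CommRing R] {S : Family A 𝒢} {M : Obj 𝒢 → Type v} [∀ G, AddCommGroup (M G)]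
    [∀ G, Module R (M G)] (ax : Axioms S) (F : FibFunctor S R M) :
    ∃! Fu : FibFunctor (upper S) R (fun G => UpperPlus F G), IsUpperPlus F Fu := by
  have key : ∀ T : Family A 𝒢, ∀ hT : T = lower S,
      ∃! Fu : FibFunctor T R (fun G => UpperPlus F G), ∀ (G H : Obj 𝒢) (U : Biset A G H)
        (hU : Good (lower S) U),
        Fu.map G H ⟨cls R U, cls_mem_homR R (hT ▸ hU)⟩ = upperMap ax hU F := by
    rintro _ rfl
    obtain ⟨Fu, hu⟩ := exists_upperFunctor ax F
    exact ⟨Fu, hu, fun Fu' hu' => ax.functor_ext fun G H U hU => (hu' G H U hU).trans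
      (hu G H U hU).symm⟩
  obtain ⟨Fu, hu, huniq⟩ := key _ ax.lower_eq_upper.symm
  exact ⟨Fu, (isUpperPlus_iff ax ax.lower_eq_upper.symm).mpr hu, fun Fu' hu' =>
    huniq Fu' ((isUpperPlus_iff ax ax.lower_eq_upper.symm).mp hu')⟩

end Fibered

theorem mainTheorem3 {A : Type u} [CommGroup A] {R : Type w} [CommRing R]
    (𝒢 : Fibered.GroupClass.{u}) (S : Fibered.Family A 𝒢) (hS : Fibered.IsFamily S)
    (h1 : Fibered.AxiomI S) (h2 : Fibered.AxiomII S) (h3 : Fibered.AxiomIII S)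
    (h4 : Fibered.AxiomIV S) (h6 : Fibered.AxiomVI S) (h7 : Fibered.AxiomVII S)
    (h8 : Fibered.AxiomVIII S) (hk : Fibered.CondK2 S)
    {M : Fibered.Obj 𝒢 → Type v} [∀ G, AddCommGroup (M G)] [∀ G, Module R (M G)]
    (F : Fibered.FibFunctor S R M) :
    -- the categories `D₊` and `D⁺` coincide
    (Fibered.lower S = Fibered.upper S ∧
      ∀ G H : Fibered.Obj 𝒢,
        Fibered.homR R (Fibered.lower S) G H = Fibered.homR R (Fibered.upper S) G H) ∧
    -- the functors `F₊` and `F⁺` and the mark maps are well defined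
    (∃! Fp : Fibered.FibFunctor (Fibered.lower S) R (Fibered.LowerPlus F),
      Fibered.IsLowerPlus F Fp) ∧
    (∃! Fu : Fibered.FibFunctor (Fibered.upper S) R (fun G => Fibered.UpperPlus F G),
      Fibered.IsUpperPlus F Fu) ∧
    (∃! m : ∀ G : Fibered.Obj 𝒢, Fibered.LowerPlus F G →ₗ[R] Fibered.UpperPlus F G,
      Fibered.IsMark F m) ∧
    -- the mark maps commute with the bisets and form a natural transformation `F₊ → F⁺`
    ∀ (Fp : Fibered.FibFunctor (Fibered.lower S) R (Fibered.LowerPlus F))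
      (Fu : Fibered.FibFunctor (Fibered.upper S) R (fun G => Fibered.UpperPlus F G))
      (m : ∀ G : Fibered.Obj 𝒢, Fibered.LowerPlus F G →ₗ[R] Fibered.UpperPlus F G),
      Fibered.IsLowerPlus F Fp → Fibered.IsUpperPlus F Fu → Fibered.IsMark F m →
      (∀ (G H : Fibered.Obj 𝒢) (U : Fibered.Biset A G H),
        (∀ u, Fibered.bisetPair U u ∈ Fibered.lower S G H) →
        ∃ (hp : Fibered.cls R U ∈ Fibered.homR R (Fibered.lower S) G H)
          (hu : Fibered.cls R U ∈ Fibered.homR R (Fibered.upper S) G H),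
          m G ∘ₗ Fp.map G H ⟨Fibered.cls R U, hp⟩ =
            Fu.map G H ⟨Fibered.cls R U, hu⟩ ∘ₗ m H) ∧
      (∀ (G H : Fibered.Obj 𝒢) (b : Fibered.BR A (G.grp × H.grp) R)
        (hp : b ∈ Fibered.homR R (Fibered.lower S) G H)
        (hu : b ∈ Fibered.homR R (Fibered.upper S) G H),
        m G ∘ₗ Fp.map G H ⟨b, hp⟩ = Fu.map G H ⟨b, hu⟩ ∘ₗ m H) := by
  have ax : Fibered.Axioms S := ⟨hS, h1, h2, h3, h4, h6, h7, h8, hk⟩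
  have hT : Fibered.upper S = Fibered.lower S := ax.lower_eq_upper.symm
  refine ⟨⟨hT.symm, fun G H => by rw [hT]⟩, ?_, ?_, ?_, ?_⟩
  · obtain ⟨Fp, hp⟩ := Fibered.exists_lowerFunctor ax F
    refine ⟨Fp, (Fibered.isLowerPlus_iff ax).mpr hp, fun Fp' hp' => ax.functor_ext ?_⟩
    intro G H U hU
    exact ((Fibered.isLowerPlus_iff ax).mp hp' G H U hU).trans (hp G H U hU).symm
  · exact Fibered.existsUnique_isUpperPlus ax F
  · exact ⟨_, (Fibered.isMark_iff ax).mpr rfl, fun _ hm => (Fibered.isMark_iff ax).mp hm⟩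
  · intro Fp Fu m hp hu hm
    obtain rfl := (Fibered.isMark_iff ax).mp hm
    have key := Fibered.mark_natural ax hT ((Fibered.isLowerPlus_iff ax).mp hp)
      ((Fibered.isUpperPlus_iff ax hT).mp hu)
    exact ⟨fun G H U hU => ⟨Fibered.cls_mem_homR R hU,
      Fibered.cls_mem_homR R (by rwa [hT]), key G H _ _ _⟩, key⟩
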